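/- **Theorem 2.1.** Let $t_0<T$, $\nu\in\mathbb N$, and let $m_1\le m_2\le\dots\le m_{\nu+1}$ be dimensions; put $n=m_1+\dots+m_\nu$, $m=m_{\nu+1}$, and write $x=(x_1,\dots,x_\nu)\in\mathbb R^n=\mathbb R^{m_1}\times\dots\times\mathbb R^{m_\nu}$. Consider the control system $$\dot x(t)=f(t,x(t),u(t)),\quad t\in[t_0,T],$$ with state $x\in\mathbb R^n$, control $u\in\mathbb R^m$, and right-hand side of the triangular form $$f(t,x,u)=\bigl(f_1(t,x_1,x_2),\,f_2(t,x_1,x_2,x_3),\dots,f_{\nu-1}(t,x_1,\dots,x_\nu),\,f_\nu(t,x_1,\dots,x_\nu,u)\bigr),\qquad f_i(t,x_1,\dots,x_{i+1})\in\mathbb R^{m_i}.$$ Assume: (I) $f$, $\partial f/\partial x$ and $\partial f/\partial u$ exist and are continuous on $[t_0,T]\times\mathbb R^n\times\mathbb R^m$; (II) for each $i=1,\dots,\nu$ and each $(t,x_1,\dots,x_i)\in[t_0,T]\times\mathbb R^{m_1}\times\dots\times\mathbb R^{m_i}$, the map $f_i(t,x_1,\dots,x_i,\cdot)$ is of class $C^{m_{i+1}-m_i+1}(\mathbb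 R^{m_{i+1}};\mathbb R^{m_i})$ and $f_i(t,x_1,\dots,x_i,\mathbb R^{m_{i+1}})=\mathbb R^{m_i}$. Let $t_1\in(t_0,T)$, $x^*=(x_1^*,\dots,x_\nu^*)\in\mathbb R^n$ and $u^*=x_{\nu+1}^*\in\mathbb R^m$ be such that $$\operatorname{rank}\frac{\partial f_i}{\partial x_{i+1}}(t_1,x_1^*,\dots,x_{i+1}^*)=m_i,\qquad i=1,\dots,\nu.$$ For a continuous control $u(\cdot)$ on an interval $J\ni t_1$, let $x(\cdot,t_1,x^*,u(\cdot))$ denote the (unique) trajectory of the system with control $u(\cdot)$ and $x(t_1)=x^*$. Then there exist families of controls $\{\bar u_{x^T}(\cdot)\}_{x^T\in\mathbb R^n}$ on $[t_1,T]$ and $\{\tilde u_{x^0}(\cdot)\}_{x^0\in\mathbb R^n}$ on $[t_0,t_1]$ such that: 1. the maps $x^T\mapsto\bar u_{x^T}(\cdot)$ and $x^0\mapsto\tilde u_{x^0}(\cdot)$ are of classes $C(\mathbb R^n;C([t_1,T];\mathbb R^m))$ and $C(\mathbb R^n;C([t_0,t_1];\mathbb R^m))$ respectively (the spaces $C([a,b];\mathbb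 R^m)$ carry the topology of uniform convergence); 2. $\tilde u_{x^0}(t_1)=\bar u_{x^T}(t_1)=u^*$ for all $x^0,x^T\in\mathbb R^n$; 3. for all $x^0,x^T\in\mathbb R^n$, the trajectories $t\mapsto x(t,t_1,x^*,\bar u_{x^T}(\cdot))$ and $t\mapsto x(t,t_1,x^*,\tilde u_{x^0}(\cdot))$ are defined on all of $[t_1,T]$ and $[t_0,t_1]$ respectively, and $$x(T,t_1,x^*,\bar u_{x^T}(\cdot))=x^T,\qquad x(t_0,t_1,x^*,\tilde u_{x^0}(\cdot))=x^0.$$ -/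

import Mathlib

namespace TriangularControl

/-- The Euclidean space of dimension `d`. -/
abbrev Vec (d : ℕ) : Type := EuclideanSpace ℝ (Fin d)

/-- The state space `ℝⁿ = ℝ^{m_1} × ⋯ × ℝ^{m_ν}`, where `n = m_1 + ⋯ + m_ν`. The block sizes
`m_1, …, m_ν, m_{ν+1}` are given by `m : Fin (ν + 1) → ℕ`, numbered from `0`. -/
abbrev State {ν : ℕ} (m : Fin (ν + 1) → ℕ) : Type := (i : Fin ν) → Vec (m i.castSucc)

/-- The control space, of dimension `m_{ν+1}`. -/
abbrev Control {ν : ℕ} (m : Fin (ν + 1) → ℕ) : Type := Vec (m (Fin.last ν))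

/-- The space of the first `i` blocks `(x_1, …, x_i)` of a state. -/
abbrev Head {ν : ℕ} (m : Fin (ν + 1) → ℕ) (i : Fin ν) : Type :=
  (j : Set.Iic i) → Vec (m j.1.castSucc)

/-- The components `f_i(t, (x_1, …, x_i), x_{i+1}) ∈ ℝ^{m_i}`, `i = 1, …, ν`, of a right-hand side
of triangular form. -/
abbrev Components {ν : ℕ} (m : Fin (ν + 1) → ℕ) : Type :=
  (i : Fin ν) → ℝ → Head m i → Vec (m i.succ) → Vec (m i.castSucc)

/-- The first `i` blocks of a state. -/
def head {ν : ℕ} {m : Fin (ν + 1) → ℕ} (x : State m) (i : Fin ν) : Head m i := fun j => x j.1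

/-- The block `x_{i+1}` that follows the `i`-th block of the state `x`, with `x_{ν+1} = u`. -/
def next {ν : ℕ} {m : Fin (ν + 1) → ℕ} (x : State m) (u : Control m) (i : Fin ν) :
    Vec (m i.succ) :=
  Fin.snoc (α := fun j : Fin (ν + 1) => Vec (m j)) x u i.succ

/-- The right-hand side of triangular form
`f(t,x,u) = (f_1(t,x_1,x_2), …, f_{ν-1}(t,x_1,…,x_ν), f_ν(t,x_1,…,x_ν,u))`. -/
def field {ν : ℕ} {m : Fin (ν + 1) → ℕ} (F : Components m) (t : ℝ) (x : State m)
    (u : Control m) : State m :=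
  fun i => F i t (head x i) (next x u i)

/-- Condition (I): `f`, `∂f/∂x` and `∂f/∂u` exist and are continuous on `[t₀,T] × ℝⁿ × ℝᵐ`. -/
structure ConditionI {ν : ℕ} {m : Fin (ν + 1) → ℕ} (t₀ T : ℝ)
    (f : ℝ → State m → Control m → State m) : Prop where
  continuousOn :
    ContinuousOn (fun p : ℝ × State m × Control m => f p.1 p.2.1 p.2.2)
      (Set.Icc t₀ T ×ˢ Set.univ)
  differentiable_state :
    ∀ t ∈ Set.Icc t₀ T, ∀ u : Control m, Differentiable ℝ (fun x : State m => f t x u)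
  differentiable_control :
    ∀ t ∈ Set.Icc t₀ T, ∀ x : State m, Differentiable ℝ (fun u : Control m => f t x u)
  continuousOn_deriv_state :
    ContinuousOn (fun p : ℝ × State m × Control m =>
        fderiv ℝ (fun x : State m => f p.1 x p.2.2) p.2.1)
      (Set.Icc t₀ T ×ˢ Set.univ)
  continuousOn_deriv_control :
    ContinuousOn (fun p : ℝ × State m × Control m =>
        fderiv ℝ (fun u : Control m => f p.1 p.2.1 u) p.2.2)
      (Set.Icc t₀ T ×ˢ Set.univ)

/-- Condition (II): each map `f_i(t,x_1,…,x_i,·)` is of class `C^{m_{i+1}-m_i+1}` and maps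
`ℝ^{m_{i+1}}` onto `ℝ^{m_i}`. -/
structure ConditionII {ν : ℕ} {m : Fin (ν + 1) → ℕ} (t₀ T : ℝ) (F : Components m) : Prop where
  contDiff :
    ∀ i : Fin ν, ∀ t ∈ Set.Icc t₀ T, ∀ y : Head m i,
      ContDiff ℝ ((m i.succ - m i.castSucc + 1 : ℕ) : WithTop ℕ∞) (F i t y)
  surjective :
    ∀ i : Fin ν, ∀ t ∈ Set.Icc t₀ T, ∀ y : Head m i, Function.Surjective (F i t y)

/-- Every `∂f_i/∂x_{i+1}`, `i = 1, …, ν`, has rank `m_i` at `(t₁, x*, u*)`. -/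
def HasFullRanks {ν : ℕ} {m : Fin (ν + 1) → ℕ} (F : Components m) (t₁ : ℝ) (x : State m)
    (u : Control m) : Prop :=
  ∀ i : Fin ν,
    Module.finrank ℝ (LinearMap.range
      (fderiv ℝ (F i t₁ (head x i)) (next x u i)).toLinearMap) = m i.castSucc

/-- On the interval `J`, the function `x` solves `ẋ(t) = f(t, x(t), u(t))`, `x(τ) = ξ`
(with one-sided derivatives at the end points of `J`). -/
structure IsSolution {ν : ℕ} {m : Fin (ν + 1) → ℕ} (f : ℝ → State m → Control m → State m)
    (J : Set ℝ) (u : J → Control m) (τ : ℝ) (ξ : State m) (x : ℝ → State m) : Prop where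
  initial : x τ = ξ
  hasDerivWithinAt : ∀ t : J, HasDerivWithinAt x (f t (x t) (u t)) J t

/-- The trajectory `t ↦ x(t, τ, ξ, u(·))` is defined on the whole interval `J`, and its value
at `t = s` is `η`: the initial value problem has exactly one solution on `J`, and this solution
passes through `η` at time `s`. -/
def TrajectoryReaches {ν : ℕ} {m : Fin (ν + 1) → ℕ} (f : ℝ → State m → Control m → State m)
    (J : Set ℝ) (u : J → Control m) (τ : ℝ) (ξ : State m) (s : ℝ) (η : State m) : Prop :=
  ∃ x : ℝ → State m, IsSolution f J u τ ξ x ∧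
    (∀ y : ℝ → State m, IsSolution f J u τ ξ y → Set.EqOn y x J) ∧ x s = η

end TriangularControl

/-! Running time away from `t₁` with speed `1` or `-1` reduces both halves of the theorem to one
problem: steer from `xs` at time `0` to an arbitrary state `l` at time `S`, by a control that is
continuous in `l` and equals `us` at time `0` (`HasContDeriv.exists_steering`). The trajectory is
glued from two pieces.

On a short interval `[0, δ]` the steering is exact but local. Full rank at the initial point
persists for a short time along the trajectory with constant control `us`. The triangular structure
then makes the linearization observable in the dual sense (`HasContDeriv.observable`), hence
controllable, and the inverse function theorem in a space of continuous functions reaches every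
point of a ball about the end `x₁` of this trajectory (`exists_local_steering`).

On `[δ, S]` the steering is global but approximate, since away from the reference point only
surjectivity of each `f_i` in its last argument is available. The curves are built one block at a
time (`SteeredUpTo.exists_succ`). Let block `i` have an arbitrary continuous velocity `q`. A
continuous choice of `x_{i+1}` with `f_i = q` need not exist, but `q` is a convex combination, with
continuous weights, of the values of `f_i` at locally finitely many fixed points (`exists_weights`).
A rapid oscillation of `x_{i+1}` between these points, with time shares given by the weights,
realizes `q` on the average (`exists_chattering`). The averaging error is a small defect in an
integral equation, and a true solution lies nearby (`LipschitzOnBalls.exists_tolerance`). After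
smoothing, block `i+1` has a continuous velocity as well, and the construction repeats until the
control is reached.

This second piece is run backward, from exactly `l` at time `S` to a point near `x₁` at time `δ`.
Its error therefore sits at the junction, where the local piece absorbs it, and no fixed point
argument is needed. The targets form a noncompact space, so frequencies and tolerances are
continuous functions of `l`, obtained from partitions of unity. -/

open Set Filter Topology MeasureTheory

namespace TriangularControl

/-! ### Volterra equations: shadowing, uniqueness, continuous dependence. -/

section Volterra

variable {E : Type*} [NormedAddCommGroup E] [NormedSpace ℝ E]

/-- `y` solves the Volterra equation `y(t) = c(t) + ∫₀ᵗ H(τ, y(τ)) dτ` on `[0, S]`. -/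
def SolvesVolterra (H : ℝ → E → E) (S : ℝ) (c y : ℝ → E) : Prop :=
  ∀ t ∈ Icc 0 S, y t = c t + ∫ τ in (0 : ℝ)..t, H τ (y τ)

/-- `H(t, ·)` is Lipschitz on balls, uniformly in `t ∈ [0, S]`. -/
def LipschitzOnBalls {E' : Type*} [NormedAddCommGroup E'] (H : ℝ → E → E') (S : ℝ) : Prop :=
  ∀ R : ℝ, ∃ L : ℝ, ∀ t ∈ Icc 0 S, ∀ x y : E, ‖x‖ ≤ R → ‖y‖ ≤ R →
    ‖H t x - H t y‖ ≤ L * ‖x - y‖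

lemma integral_mul_exp (L t : ℝ) :
    ∫ τ in (0 : ℝ)..t, L * Real.exp (2 * L * τ) = (Real.exp (2 * L * t) - 1) / 2 := by
  have h : ∀ x ∈ uIcc 0 t, HasDerivAt (fun τ => Real.exp (2 * L * τ) / 2)
      (L * Real.exp (2 * L * x)) x := fun x _ => by
    have := (((hasDerivAt_id x).const_mul (2 * L)).exp).div_const 2
    simp only [id] at this
    exact this.congr_deriv (by ring)
  rw [intervalIntegral.integral_eq_sub_of_hasDerivAt h
    (Continuous.intervalIntegrable (by fun_prop) _ _)]
  simp
  ring

/-- With the weight `exp (2 * L * t)`, integration of an increment with Lipschitz constant `L` gains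
the factor `1 / 2` on an interval of any length. Contraction and uniqueness follow without cutting
`[0, S]` into short pieces. -/
lemma norm_integral_le_exp {f : ℝ → E} {L M t : ℝ} (hM : 0 ≤ M) (ht : 0 ≤ t)
    (hf : ∀ τ ∈ Icc 0 t, ‖f τ‖ ≤ L * (Real.exp (2 * L * τ) * M)) :
    ‖∫ τ in (0 : ℝ)..t, f τ‖ ≤ Real.exp (2 * L * t) * (M / 2) := by
  have h1 : ‖∫ τ in (0 : ℝ)..t, f τ‖ ≤ ∫ τ in (0 : ℝ)..t, (L * Real.exp (2 * L * τ)) * M := by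
    refine intervalIntegral.norm_integral_le_of_norm_le ht ?_
      (Continuous.intervalIntegrable (by fun_prop) _ _)
    refine Eventually.of_forall fun τ hτ => ?_
    rw [mul_assoc]
    exact hf τ ⟨hτ.1.le, hτ.2⟩
  rw [intervalIntegral.integral_mul_const, integral_mul_exp] at h1
  nlinarith [Real.exp_pos (2 * L * t)]

omit [NormedSpace ℝ E] in
lemma intervalIntegrable_field {E' : Type*} [NormedAddCommGroup E'] {H : ℝ → E → E'}
    (hH : Continuous (Function.uncurry H)) {y : ℝ → E} (hy : Continuous y) (a b : ℝ) :
    IntervalIntegrable (fun τ => H τ (y τ)) volume a b :=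
  (hH.comp (continuous_id.prodMk hy)).intervalIntegrable _ _

lemma continuous_integral_field {H : ℝ → E → E} (hH : Continuous (Function.uncurry H))
    {y : ℝ → E} (hy : Continuous y) : Continuous fun t => ∫ τ in (0 : ℝ)..t, H τ (y τ) :=
  intervalIntegral.continuous_primitive (fun _ _ => intervalIntegrable_field hH hy _ _) _

variable [CompleteSpace E]

/-- An approximate solution of a Volterra equation with a small defect lies near a solution. -/
theorem exists_solvesVolterra {H : ℝ → E → E} (hH : Continuous (Function.uncurry H)) {S : ℝ}
    (hS : 0 ≤ S) {ρ c : ℝ → E} (hρ : Continuous ρ) (hc : Continuous c) {ε a L : ℝ} (hL : 0 < L)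
    (hlip : ∀ t ∈ Icc 0 S, ∀ x y : E, ‖x - ρ t‖ ≤ ε → ‖y - ρ t‖ ≤ ε →
      ‖H t x - H t y‖ ≤ L * ‖x - y‖)
    (hres : ∀ t ∈ Icc 0 S, ‖c t + (∫ τ in (0 : ℝ)..t, H τ (ρ τ)) - ρ t‖ ≤ a)
    (ha : 2 * a * Real.exp (2 * L * S) ≤ ε) :
    ∃ y : ℝ → E, Continuous y ∧ SolvesVolterra H S c y ∧ ∀ t ∈ Icc 0 S, ‖y t - ρ t‖ ≤ ε := by
  have ha0 : 0 ≤ a := (norm_nonneg _).trans (hres 0 (left_mem_Icc.2 hS))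
  let I := Icc (0 : ℝ) S
  -- The unknown is the weighted deviation `d` from `ρ`, so its sup norm is the exponentially
  -- weighted norm of `Y d - ρ`.
  let Y : C(I, E) → ℝ → E := fun d t => ρ t + Real.exp (2 * L * t) • d (projIcc 0 S hS t)
  have hY : ∀ d, Continuous (Y d) := fun d => by
    have : Continuous (projIcc 0 S hS) := continuous_projIcc
    fun_prop
  have hYsub : ∀ d d' : C(I, E), ∀ t, Y d t - Y d' t
      = Real.exp (2 * L * t) • (d (projIcc 0 S hS t) - d' (projIcc 0 S hS t)) := fun d d' t => by
    simp only [Y, smul_sub]; abel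
  have hYρ : ∀ d : C(I, E), ∀ t, Y d t - ρ t
      = Real.exp (2 * L * t) • d (projIcc 0 S hS t) := fun d t => by
    simp only [Y]; abel
  have hbd : ∀ d : C(I, E), ‖d‖ ≤ 2 * a → ∀ t ∈ I, ‖Y d t - ρ t‖ ≤ ε := fun d hd t ht => by
    rw [hYρ, norm_smul, Real.norm_of_nonneg (Real.exp_pos _).le]
    refine le_trans ?_ ha
    rw [mul_comm]
    refine mul_le_mul ((d.norm_coe_le_norm _).trans hd) ?_ (Real.exp_pos _).le (by positivity)
    exact Real.exp_le_exp.2 (by nlinarith [ht.2])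
  have hρε : ∀ t ∈ I, ‖ρ t - ρ t‖ ≤ ε := fun t ht => by
    simpa using le_trans (by positivity) ha
  let Φ : C(I, E) → C(I, E) := fun d =>
    ⟨fun t => Real.exp (-(2 * L * t)) •
      (c t + (∫ τ in (0 : ℝ)..t, H τ (Y d τ)) - ρ t), by
      have := (continuous_integral_field hH (hY d)).comp (continuous_subtype_val : Continuous
        (Subtype.val : I → ℝ))
      simp only [Function.comp_def] at this
      fun_prop⟩
  have key : ∀ u v : ℝ → E, Continuous u → Continuous v → ∀ M, 0 ≤ M →
      (∀ τ ∈ I, ‖H τ (u τ) - H τ (v τ)‖ ≤ L * (Real.exp (2 * L * τ) * M)) → ∀ t ∈ I,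
      ‖(∫ τ in (0 : ℝ)..t, H τ (u τ)) - ∫ τ in (0 : ℝ)..t, H τ (v τ)‖
        ≤ Real.exp (2 * L * t) * (M / 2) := by
    intro u v hu hv M hM h t ht
    rw [← intervalIntegral.integral_sub
      (intervalIntegrable_field hH hu _ _) (intervalIntegrable_field hH hv _ _)]
    exact norm_integral_le_exp hM ht.1 fun τ hτ => h τ ⟨hτ.1, hτ.2.trans ht.2⟩
  -- The radius is `2 * a` because the defect of `ρ` contributes at most `a`, and half of the
  -- radius, from the contraction, contributes another `a`.
  have hmaps : MapsTo Φ (Metric.closedBall 0 (2 * a)) (Metric.closedBall 0 (2 * a)) := by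
    intro d hd
    rw [mem_closedBall_zero_iff] at hd ⊢
    refine (ContinuousMap.norm_le _ (by positivity)).2 fun t => ?_
    have h1 := key (Y d) ρ (hY d) hρ (2 * a) (by positivity) (fun τ hτ => by
      refine (hlip τ hτ _ _ (hbd d hd τ hτ) (hρε τ hτ)).trans ?_
      gcongr
      rw [hYρ, norm_smul, Real.norm_of_nonneg (Real.exp_pos _).le]
      gcongr
      exact (d.norm_coe_le_norm _).trans hd) t t.2
    have h2 := hres t t.2
    simp only [Φ, ContinuousMap.coe_mk, norm_smul, Real.norm_of_nonneg (Real.exp_pos _).le]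
    rw [Real.exp_neg, inv_mul_le_iff₀ (Real.exp_pos _)]
    have h3 : c t + (∫ τ in (0 : ℝ)..t, H τ (Y d τ)) - ρ t =
      (c t + (∫ τ in (0 : ℝ)..t, H τ (ρ τ)) - ρ t) +
      ((∫ τ in (0 : ℝ)..t, H τ (Y d τ)) - ∫ τ in (0 : ℝ)..t, H τ (ρ τ)) := by abel
    rw [h3]
    refine (norm_add_le _ _).trans ?_
    have h4 : 1 ≤ Real.exp (2 * L * t) := Real.one_le_exp (by have := t.2.1; positivity)
    nlinarith
  have hcontr : ContractingWith (1 / 2) (hmaps.restrict Φ _ _) := by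
    refine ⟨by norm_num, LipschitzWith.of_dist_le_mul fun d d' => ?_⟩
    rw [Subtype.dist_eq, Subtype.dist_eq, dist_eq_norm, dist_eq_norm]
    simp only [MapsTo.val_restrict_apply]
    refine (ContinuousMap.norm_le _ (by positivity)).2 fun t => ?_
    have h1 := key (Y d) (Y d') (hY d) (hY d') ‖(d : C(I, E)) - (d' : C(I, E))‖ (norm_nonneg _)
      (fun τ hτ => by
        refine (hlip τ hτ _ _ (hbd d (mem_closedBall_zero_iff.1 d.2) τ hτ)
          (hbd d' (mem_closedBall_zero_iff.1 d'.2) τ hτ)).trans ?_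
        gcongr
        rw [hYsub, norm_smul, Real.norm_of_nonneg (Real.exp_pos _).le]
        gcongr
        exact ContinuousMap.norm_coe_le_norm ((d : C(I, E)) - (d' : C(I, E))) _) t t.2
    simp only [Φ, ContinuousMap.sub_apply, ContinuousMap.coe_mk, ← smul_sub, norm_smul,
      Real.norm_of_nonneg (Real.exp_pos _).le]
    rw [Real.exp_neg, inv_mul_le_iff₀ (Real.exp_pos _), sub_sub_sub_cancel_right,
      add_sub_add_left_eq_sub]
    refine h1.trans (le_of_eq ?_)
    simp
    ring
  obtain ⟨d, hd, hfix, -⟩ := hcontr.exists_fixedPoint' Metric.isClosed_closedBall.isComplete hmaps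
    (x := 0) (by simpa using by positivity) (edist_ne_top _ _)
  refine ⟨Y d, hY d, fun t ht => ?_, hbd d (mem_closedBall_zero_iff.1 hd)⟩
  have h := congrArg (fun g : C(I, E) => Real.exp (2 * L * t) • g ⟨t, ht⟩) hfix
  simp only [Φ, ContinuousMap.coe_mk, smul_smul, ← Real.exp_add, add_neg_cancel, Real.exp_zero,
    one_smul] at h
  have h2 := hYρ d t
  rw [projIcc_of_mem hS ht, ← h] at h2
  exact sub_left_injective h2

-- At a maximum point of the weighted difference, `norm_integral_le_exp` bounds the maximum by half
-- of itself.
omit [CompleteSpace E] in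
theorem SolvesVolterra.eqOn {H : ℝ → E → E} (hH : Continuous (Function.uncurry H)) {S : ℝ}
    (hlip : LipschitzOnBalls H S) {c y z : ℝ → E} (hy : Continuous y) (hz : Continuous z)
    (hys : SolvesVolterra H S c y) (hzs : SolvesVolterra H S c z) : EqOn y z (Icc 0 S) := by
  rcases lt_or_ge S 0 with hS | hS
  · simp [Icc_eq_empty_of_lt hS]
  obtain ⟨R₁, hR₁⟩ := isCompact_Icc.exists_bound_of_continuousOn (s := Icc 0 S) hy.continuousOn
  obtain ⟨R₂, hR₂⟩ := isCompact_Icc.exists_bound_of_continuousOn (s := Icc 0 S) hz.continuousOn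
  obtain ⟨L₀, hL₀⟩ := hlip (max R₁ R₂)
  set L := max L₀ 1
  have hL : 0 < L := lt_max_of_lt_right one_pos
  obtain ⟨s, hs, hmax⟩ := isCompact_Icc.exists_isMaxOn (s := Icc 0 S) (nonempty_Icc.2 hS)
    (f := fun t => Real.exp (-(2 * L * t)) * ‖y t - z t‖) (by fun_prop)
  set M := Real.exp (-(2 * L * s)) * ‖y s - z s‖
  have hM0 : 0 ≤ M := by positivity
  have hM : ∀ t ∈ Icc 0 S, ‖y t - z t‖ ≤ Real.exp (2 * L * t) * M := fun t ht => by
    have : Real.exp (-(2 * L * t)) * ‖y t - z t‖ ≤ M := hmax ht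
    rwa [Real.exp_neg, inv_mul_le_iff₀ (Real.exp_pos _)] at this
  have h1 : ‖y s - z s‖ ≤ Real.exp (2 * L * s) * (M / 2) := by
    rw [hys s hs, hzs s hs, add_sub_add_left_eq_sub, ← intervalIntegral.integral_sub
      (intervalIntegrable_field hH hy _ _) (intervalIntegrable_field hH hz _ _)]
    refine norm_integral_le_exp hM0 hs.1 fun τ hτ => ?_
    have hτ' : τ ∈ Icc 0 S := ⟨hτ.1, hτ.2.trans hs.2⟩
    refine (hL₀ τ hτ' _ _ ((hR₁ τ hτ').trans (le_max_left _ _))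
      ((hR₂ τ hτ').trans (le_max_right _ _))).trans ?_
    exact mul_le_mul (le_max_left _ _) (hM τ hτ') (norm_nonneg _) hL.le
  have h2 : M ≤ M / 2 := by
    rw [← inv_mul_le_iff₀ (Real.exp_pos _), ← Real.exp_neg] at h1
    exact h1
  intro t ht
  have h3 := hM t ht
  rw [show M = 0 by linarith, mul_zero] at h3
  exact sub_eq_zero.1 (norm_le_zero_iff.1 h3)

/-- One Lipschitz constant, on the ball of radius `R + ε`, serves all approximate solutions bounded
by `R`. Hence `a` does not depend on `ρ` or `c`, and an oscillating `ρ` may be chosen after `a` is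
fixed. -/
theorem LipschitzOnBalls.exists_tolerance {H : ℝ → E → E} (hH : Continuous (Function.uncurry H))
    {S : ℝ} (hS : 0 ≤ S) (hlip : LipschitzOnBalls H S) (R : ℝ) {ε : ℝ} (hε : 0 < ε) :
    ∃ a > 0, ∀ ρ c : ℝ → E, Continuous ρ → Continuous c → (∀ t ∈ Icc 0 S, ‖ρ t‖ ≤ R) →
      (∀ t ∈ Icc 0 S, ‖c t + (∫ τ in (0 : ℝ)..t, H τ (ρ τ)) - ρ t‖ ≤ a) →
      ∃ y : ℝ → E, Continuous y ∧ SolvesVolterra H S c y ∧ ∀ t ∈ Icc 0 S, ‖y t - ρ t‖ ≤ ε := by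
  obtain ⟨L₀, hL₀⟩ := hlip (R + ε)
  set L := max L₀ 1
  have hL : 0 < L := lt_max_of_lt_right one_pos
  refine ⟨ε / (2 * Real.exp (2 * L * S)), by positivity, fun ρ c hρ hc hR hres => ?_⟩
  refine exists_solvesVolterra hH hS hρ hc hL (fun t ht x y hx hy => ?_) hres (le_of_eq ?_)
  · have aux : ∀ w : E, ‖w - ρ t‖ ≤ ε → ‖w‖ ≤ R + ε := fun w hw => by
      have := norm_add_le (ρ t) (w - ρ t)
      rw [add_sub_cancel] at this
      linarith [hR t ht]
    exact (hL₀ t ht x y (aux x hx) (aux y hy)).trans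
      (mul_le_mul_of_nonneg_right (le_max_left _ _) (norm_nonneg _))
  · field_simp

/-- The solution for `l₀` satisfies the equation for a nearby `l` up to the defect `c l - c l₀`, so
some solution for `l` lies near it, and by uniqueness this is `y l`. The projection appears because
`y l` is determined on `[0, S]` only. -/
theorem continuous_solvesVolterra {Λ : Type*} [TopologicalSpace Λ] {H : ℝ → E → E}
    (hH : Continuous (Function.uncurry H)) {S : ℝ} (hS : 0 ≤ S) (hlip : LipschitzOnBalls H S)
    {c y : Λ → ℝ → E} (hc : Continuous (Function.uncurry c)) (hy : ∀ l, Continuous (y l))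
    (hys : ∀ l, SolvesVolterra H S (c l) (y l)) :
    Continuous fun p : Λ × ℝ => y p.1 (projIcc 0 S hS p.2) := by
  refine continuous_iff_continuousAt.2 fun ⟨l₀, t₀⟩ => Metric.tendsto_nhds.2 fun ε hε => ?_
  obtain ⟨R, hR⟩ := isCompact_Icc.exists_bound_of_continuousOn (s := Icc 0 S) (hy l₀).continuousOn
  obtain ⟨a, ha, htol⟩ := hlip.exists_tolerance hH hS R (half_pos hε)
  have hcl : ∀ l, Continuous (c l) := fun l => hc.comp (continuous_const.prodMk continuous_id)
  have h1 : ∀ᶠ l in 𝓝 l₀, ∀ t ∈ Icc 0 S, ‖c l t - c l₀ t‖ ≤ a := by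
    refine isCompact_Icc.eventually_forall_of_forall_eventually fun t _ => ?_
    have : Continuous fun q : Λ × ℝ => ‖c q.1 q.2 - c l₀ q.2‖ :=
      (hc.sub ((hcl l₀).comp continuous_snd)).norm
    have h := this.tendsto (l₀, t)
    simp only [sub_self, norm_zero] at h
    exact (h.eventually (gt_mem_nhds ha)).mono fun _ hq => le_of_lt hq
  have h2 : ∀ᶠ l in 𝓝 l₀, ∀ t ∈ Icc 0 S, ‖y l t - y l₀ t‖ ≤ ε / 2 := by
    filter_upwards [h1] with l hl
    obtain ⟨z, hz, hzs, hzε⟩ := htol (y l₀) (c l) (hy l₀) (hcl l) hR fun t ht => by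
      have := hys l₀ t ht
      rw [show c l t + (∫ τ in (0 : ℝ)..t, H τ (y l₀ τ)) - y l₀ t
        = c l t - c l₀ t - (y l₀ t - (c l₀ t + ∫ τ in (0 : ℝ)..t, H τ (y l₀ τ))) by abel,
        ← this, sub_self, sub_zero]
      exact hl t ht
    intro t ht
    rw [(hys l).eqOn hH hlip (hy l) hz hzs ht]
    exact hzε t ht
  have h3 : ∀ᶠ t in 𝓝 t₀, dist (y l₀ (projIcc 0 S hS t)) (y l₀ (projIcc 0 S hS t₀)) < ε / 2 := by
    have : Continuous fun t => y l₀ (projIcc 0 S hS t) :=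
      (hy l₀).comp (continuous_subtype_val.comp continuous_projIcc)
    exact Metric.tendsto_nhds.1 (this.tendsto t₀) _ (half_pos hε)
  rw [nhds_prod_eq]
  filter_upwards [h2.prod_mk h3] with p hp
  have := hp.1 (projIcc 0 S hS p.2) (projIcc 0 S hS p.2).2
  rw [← dist_eq_norm] at this
  linarith [dist_triangle (y p.1 (projIcc 0 S hS p.2)) (y l₀ (projIcc 0 S hS p.2))
    (y l₀ (projIcc 0 S hS t₀)), hp.2]

end Volterra

end TriangularControl

/-! ### Continuous choice of parameters. -/

namespace TriangularControl

/-- A property of a parameter that holds locally uniformly for all large values of the parameter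
can be satisfied by a parameter depending continuously on the point. -/
theorem exists_continuous_of_eventually_forall_ge {Λ : Type*} [TopologicalSpace Λ] [NormalSpace Λ]
    [ParacompactSpace Λ] {Q : Λ → ℝ → Prop}
    (h : ∀ l₀, ∃ c, ∀ᶠ l in 𝓝 l₀, ∀ ω ≥ c, Q l ω) :
    ∃ ω : C(Λ, ℝ), ∀ l, 0 < ω l ∧ ∀ c ≥ ω l, Q l c :=
  exists_continuous_forall_mem_convex_of_local_const
    (t := fun l : Λ => {c : ℝ | 0 < c ∧ ∀ ω ≥ c, Q l ω})
    -- Requiring `Q` at all larger values makes the admissible set upward closed, hence convex, as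
    -- gluing by a partition of unity needs.
    (fun l => Set.OrdConnected.convex ⟨fun x hx y _ z hz =>
      ⟨hx.1.trans_le hz.1, fun ω hω => hx.2 ω (hz.1.trans hω)⟩⟩)
    (fun l₀ => by
      obtain ⟨c, hc⟩ := h l₀
      refine ⟨max c 1, hc.mono fun l hl => ⟨lt_max_of_lt_right one_pos, fun ω hω =>
        hl ω ((le_max_left _ _).trans hω)⟩⟩)

/-- Compactness turns a strict inequality at a point into a locally uniform one. -/
lemma eventually_forall_lt {X Y : Type*} [TopologicalSpace X] [TopologicalSpace Y] {K : Set Y}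
    (hK : IsCompact K) {φ ψ : X → Y → ℝ} (hφ : Continuous (Function.uncurry φ))
    (hψ : Continuous (Function.uncurry ψ)) {x₀ : X} (h : ∀ y ∈ K, φ x₀ y < ψ x₀ y) :
    ∀ᶠ x in 𝓝 x₀, ∀ y ∈ K, φ x y < ψ x y :=
  hK.eventually_forall_of_forall_eventually fun y hy =>
    (hφ.tendsto (x₀, y)).eventually_lt (hψ.tendsto (x₀, y)) (h y hy)

/-- A continuous threshold on `Λ × Y` is bounded over `K` locally uniformly in `l`, so a continuous
function of `l` alone dominates it there. With `K = [0, S]` this yields parameters that do not vary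
in time. -/
theorem exists_continuous_of_eventually_forall_ge_prod {Λ Y : Type*} [TopologicalSpace Λ]
    [NormalSpace Λ] [ParacompactSpace Λ] [TopologicalSpace Y] [NormalSpace (Λ × Y)]
    [ParacompactSpace (Λ × Y)] {K : Set Y} (hK : IsCompact K) {Q : Λ × Y → ℝ → Prop}
    (h : ∀ p₀, ∃ c, ∀ᶠ p in 𝓝 p₀, ∀ ω ≥ c, Q p ω) :
    ∃ ω : C(Λ, ℝ), ∀ l, 0 < ω l ∧ ∀ y ∈ K, ∀ c ≥ ω l, Q (l, y) c := by
  obtain ⟨c, hc⟩ := exists_continuous_of_eventually_forall_ge h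
  obtain ⟨ω, hω⟩ := exists_continuous_of_eventually_forall_ge
    (Q := fun l ω => ∀ y ∈ K, c (l, y) ≤ ω) fun l₀ => by
      have h1 : Continuous fun y => c (l₀, y) := by fun_prop
      obtain ⟨B, hB⟩ := hK.exists_bound_of_continuousOn h1.continuousOn
      refine ⟨B + 1, (eventually_forall_lt hK (φ := fun l y => c (l, y)) (ψ := fun _ _ => B + 1)
        c.continuous continuous_const (x₀ := l₀) fun y hy => ?_).mono
        fun l hl ω hω y hy => (hl y hy).le.trans hω⟩
      have := (Real.le_norm_self _).trans (hB y hy)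
      linarith
  exact ⟨ω, fun l => ⟨(hω l).1, fun y hy d hd => (hc (l, y)).2 d ((hω l).2 d hd y hy)⟩⟩

lemma periodic_eq_fract {α : Type*} {f : ℝ → α} (hf : Function.Periodic f 1) (θ : ℝ) :
    f θ = f (Int.fract θ) := by
  have := hf.sub_int_mul_eq (x := θ) ⌊θ⌋
  rw [mul_one] at this
  exact this.symm

/-! ### Averaging of fast oscillations and smoothing of curves. -/

section Integrals

variable {E : Type*} [NormedAddCommGroup E] [NormedSpace ℝ E]

/-- Only two end layers of width `δ` contribute, and if they overlap the trivial bound is enough.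
This measures the cost of the ramps of trapezoids and of the cutoff at the ends of the time
interval. -/
lemma norm_integral_le_of_eq_zero_middle {f : ℝ → E} (hf : Continuous f) {a b δ C : ℝ}
    (hab : a ≤ b) (hδ : 0 < δ) (hC : ∀ x ∈ Icc a b, ‖f x‖ ≤ C)
    (h0 : ∀ x ∈ Icc (a + δ) (b - δ), f x = 0) : ‖∫ x in a..b, f x‖ ≤ 2 * C * δ := by
  have hC0 : 0 ≤ C := (norm_nonneg _).trans (hC a (left_mem_Icc.2 hab))
  have aux : ∀ u v, a ≤ u → u ≤ v → v ≤ b → ‖∫ x in u..v, f x‖ ≤ C * (v - u) := by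
    intro u v h1 h2 h3
    rw [← abs_of_nonneg (sub_nonneg.2 h2)]
    refine intervalIntegral.norm_integral_le_of_norm_le_const fun x hx => ?_
    rw [uIoc_of_le h2] at hx
    exact hC x ⟨by linarith [hx.1], by linarith [hx.2]⟩
  rcases le_or_gt (b - a) (2 * δ) with h | h
  · refine (aux a b le_rfl hab le_rfl).trans ?_
    nlinarith
  · rw [← intervalIntegral.integral_add_adjacent_intervals (b := a + δ)
      (hf.intervalIntegrable _ _) (hf.intervalIntegrable _ _),
      ← intervalIntegral.integral_add_adjacent_intervals (a := a + δ) (b := b - δ)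
      (hf.intervalIntegrable _ _) (hf.intervalIntegrable _ _)]
    have hz : ∫ x in (a + δ)..(b - δ), f x = 0 := by
      rw [intervalIntegral.integral_congr (g := fun _ => (0 : E)), intervalIntegral.integral_zero]
      intro x hx
      rw [uIcc_of_le (by linarith)] at hx
      exact h0 x hx
    rw [hz, zero_add]
    refine (norm_add_le _ _).trans ?_
    have h1 := aux a (a + δ) le_rfl (by linarith) (by linarith)
    have h2 := aux (b - δ) b (by linarith) (by linarith) le_rfl
    linarith

/-- Integrals of rapidly oscillating functions with mean zero are small. -/
lemma exists_norm_integral_oscillating_le {G : ℝ → ℝ → E} (hG : Continuous (Function.uncurry G))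
    (hper : ∀ τ, Function.Periodic (G τ) 1) (hmean : ∀ τ, ∫ θ in (0 : ℝ)..1, G τ θ = 0)
    {S : ℝ} (hS : 0 ≤ S) {η : ℝ} (hη : 0 < η) :
    ∃ c, ∀ ω ≥ c, ∀ t ∈ Icc 0 S, ‖∫ τ in (0 : ℝ)..t, G τ (ω * τ)‖ ≤ η := by
  obtain ⟨C, hC⟩ := (isCompact_Icc (a := (0 : ℝ)) (b := S)).prod
    (isCompact_Icc (a := (0 : ℝ)) (b := 1)) |>.exists_bound_of_continuousOn hG.continuousOn
  have hfr : ∀ θ : ℝ, Int.fract θ ∈ Icc (0 : ℝ) 1 := fun θ =>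
    ⟨Int.fract_nonneg θ, (Int.fract_lt_one θ).le⟩
  have hC' : ∀ τ ∈ Icc 0 S, ∀ θ, ‖G τ θ‖ ≤ C := fun τ hτ θ => by
    rw [periodic_eq_fract (hper τ)]
    exact hC (τ, Int.fract θ) ⟨hτ, hfr θ⟩
  have hC0 : 0 ≤ C := (norm_nonneg _).trans (hC' 0 (left_mem_Icc.2 hS) 0)
  -- The denominator has `S + 1` because `S` may vanish.
  set η' := η / (2 * (S + 1))
  have hη' : 0 < η' := by positivity
  have hev : ∀ᶠ s in 𝓝 (0 : ℝ), ∀ y ∈ Icc 0 S ×ˢ Icc (0 : ℝ) 1,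
      ‖G (y.1 + s) y.2 - G y.1 y.2‖ < η' := by
    refine eventually_forall_lt (isCompact_Icc.prod isCompact_Icc)
      (φ := fun (s : ℝ) (y : ℝ × ℝ) => ‖G (y.1 + s) y.2 - G y.1 y.2‖) (ψ := fun _ _ => η') ?_
      continuous_const (fun y _ => by simpa using hη')
    simp only [Function.uncurry_def] at hG ⊢
    exact ((hG.comp (f := fun p : ℝ × ℝ × ℝ => (p.2.1 + p.1, p.2.2)) (by fun_prop)).sub
      (hG.comp (f := fun p : ℝ × ℝ × ℝ => (p.2.1, p.2.2)) (by fun_prop))).norm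
  obtain ⟨δ, hδ, hδ'⟩ := Metric.eventually_nhds_iff.1 hev
  have hosc : ∀ a ∈ Icc 0 S, ∀ s, |s| < δ → ∀ θ, ‖G (a + s) θ - G a θ‖ ≤ η' := by
    intro a ha s hs θ
    rw [periodic_eq_fract (hper (a + s)), periodic_eq_fract (hper a)]
    exact (hδ' (y := s) (by simpa using hs) (a, Int.fract θ) ⟨ha, hfr θ⟩).le
  have hint : ∀ ω a b, IntervalIntegrable (fun τ => G τ (ω * τ)) volume a b := fun ω a b =>
    (hG.comp (continuous_id.prodMk (continuous_const.mul continuous_id))).intervalIntegrable _ _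
  have hint' : ∀ ω c a b, IntervalIntegrable (fun τ => G c (ω * τ)) volume a b := fun ω c a b =>
    (hG.comp (continuous_const.prodMk (continuous_const.mul continuous_id))).intervalIntegrable _ _
  -- `2 / δ` makes a period shorter than `δ`, `2 * C / η` bounds the last, incomplete period by `η /
  -- 2`, and `1` keeps `ω` positive.
  refine ⟨max (max (2 / δ) (2 * C / η)) 1, fun ω hω t ht => ?_⟩
  have hω1 : 2 / δ ≤ ω := (le_max_left _ _).trans ((le_max_left _ _).trans hω)
  have hω2 : 2 * C / η ≤ ω := (le_max_right _ _).trans ((le_max_left _ _).trans hω)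
  have hω0 : 0 < ω := one_pos.trans_le ((le_max_right _ _).trans hω)
  have hωδ : 1 / ω < δ := by
    rw [div_le_iff₀ hδ] at hω1
    rw [div_lt_iff₀ hω0]
    linarith
  -- Over one period the slow variable is frozen at the left end; the frozen integrand has mean
  -- zero, so only its variation in the slow variable remains.
  have hcell : ∀ a ∈ Icc 0 S, ‖∫ τ in a..(a + 1 / ω), G τ (ω * τ)‖ ≤ η' * (1 / ω) := by
    intro a ha
    have hzero : ∫ τ in a..(a + 1 / ω), G a (ω * τ) = 0 := by
      rw [intervalIntegral.integral_comp_mul_left _ hω0.ne', mul_add, mul_one_div_cancel hω0.ne',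
        (hper a).intervalIntegral_add_eq _ 0, zero_add, hmean, smul_zero]
    rw [← sub_zero (∫ τ in a..(a + 1 / ω), G τ (ω * τ)), ← hzero,
      ← intervalIntegral.integral_sub (hint _ _ _) (hint' _ _ _ _)]
    refine (intervalIntegral.norm_integral_le_of_norm_le_const (C := η') fun τ hτ => ?_).trans ?_
    · rw [uIoc_of_le (by simpa using hω0.le)] at hτ
      have := hosc a ha (τ - a) (by
        rw [abs_of_nonneg (by linarith [hτ.1])]; linarith [hτ.2]) (ω * τ)
      rwa [add_sub_cancel] at this
    · rw [add_sub_cancel_left, abs_of_pos (by positivity)]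
  have hcells : ∀ j : ℕ, (j : ℝ) / ω ≤ S →
      ‖∫ τ in (0 : ℝ)..(j / ω), G τ (ω * τ)‖ ≤ η' * (j / ω) := by
    intro j
    induction j with
    | zero => simp
    | succ j ih =>
      intro hj
      push_cast at hj ⊢
      rw [add_div] at hj ⊢
      have h1 : 0 < 1 / ω := by positivity
      rw [← intervalIntegral.integral_add_adjacent_intervals (b := (j : ℝ) / ω) (hint _ _ _)
        (hint _ _ _)]
      refine (norm_add_le _ _).trans ?_
      rw [mul_add]
      exact add_le_add (ih (by linarith)) (hcell _ ⟨by positivity, by linarith⟩)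
  have hωt : 0 ≤ ω * t := mul_nonneg hω0.le ht.1
  have hfl := Nat.floor_le hωt
  have hfl' := Nat.lt_floor_add_one (ω * t)
  have hjt : (⌊ω * t⌋₊ : ℝ) / ω ≤ t := by rw [div_le_iff₀ hω0]; linarith
  rw [← intervalIntegral.integral_add_adjacent_intervals (b := (⌊ω * t⌋₊ : ℝ) / ω) (hint _ _ _)
        (hint _ _ _)]
  refine (norm_add_le _ _).trans ?_
  have h1 := hcells ⌊ω * t⌋₊ (hjt.trans ht.2)
  have h2 : ‖∫ τ in ((⌊ω * t⌋₊ : ℝ) / ω)..t, G τ (ω * τ)‖ ≤ C * (1 / ω) := by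
    refine (intervalIntegral.norm_integral_le_of_norm_le_const (C := C) fun τ hτ => ?_).trans ?_
    · rw [uIoc_of_le hjt] at hτ
      exact hC' τ ⟨le_trans (by positivity) hτ.1.le, hτ.2.trans ht.2⟩ _
    · refine mul_le_mul_of_nonneg_left ?_ hC0
      rw [abs_of_nonneg (sub_nonneg.2 hjt), sub_le_iff_le_add, ← add_div, le_div_iff₀ hω0]
      linarith
  have h3 : C * (1 / ω) ≤ η / 2 := by
    rw [div_le_iff₀ hη] at hω2
    rw [mul_one_div, div_le_iff₀ hω0]
    linarith
  have h4 : η' * (⌊ω * t⌋₊ / ω) ≤ η / 2 := by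
    refine (mul_le_mul_of_nonneg_left (hjt.trans ht.2) hη'.le).trans ?_
    rw [div_mul_eq_mul_div, div_le_div_iff₀ (by positivity) two_pos]
    nlinarith
  linarith

/-- The averaging lemma with a parameter. -/
theorem eventually_norm_integral_oscillating_le {Λ : Type*} [TopologicalSpace Λ]
    {G : Λ → ℝ → ℝ → E} (hG : Continuous fun p : Λ × ℝ × ℝ => G p.1 p.2.1 p.2.2)
    (hper : ∀ l τ, Function.Periodic (G l τ) 1)
    (hmean : ∀ l τ, ∫ θ in (0 : ℝ)..1, G l τ θ = 0)
    {S : ℝ} (hS : 0 ≤ S) {η : ℝ} (hη : 0 < η) (l₀ : Λ) :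
    ∃ c, ∀ᶠ l in 𝓝 l₀, ∀ ω ≥ c, ∀ t ∈ Icc 0 S, ‖∫ τ in (0 : ℝ)..t, G l τ (ω * τ)‖ ≤ η := by
  obtain ⟨c, hc⟩ := exists_norm_integral_oscillating_le (G := G l₀)
    (hG.comp (continuous_const.prodMk continuous_id)) (hper l₀) (hmean l₀) hS (half_pos hη)
  refine ⟨c, ?_⟩
  set η' := η / (2 * (S + 1))
  have hη' : 0 < η' := by positivity
  -- Periodicity confines the fast variable to a compact interval, so the change of the integrand
  -- with `l` is small uniformly in `ω`, and the threshold found for `l₀` works nearby.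
  have hev : ∀ᶠ l in 𝓝 l₀, ∀ y ∈ Icc 0 S ×ˢ Icc (0 : ℝ) 1,
      ‖G l y.1 y.2 - G l₀ y.1 y.2‖ < η' := by
    refine eventually_forall_lt (isCompact_Icc.prod isCompact_Icc)
      (φ := fun (l : Λ) (y : ℝ × ℝ) => ‖G l y.1 y.2 - G l₀ y.1 y.2‖) (ψ := fun _ _ => η') ?_
      continuous_const (fun y _ => by simpa using hη')
    exact (hG.sub (hG.comp (continuous_const.prodMk continuous_snd))).norm
  have hint : ∀ l ω a b, IntervalIntegrable (fun τ => G l τ (ω * τ)) volume a b := fun l ω a b =>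
    (hG.comp (f := fun τ => (l, τ, ω * τ)) (by fun_prop)).intervalIntegrable _ _
  filter_upwards [hev] with l hl ω hω t ht
  have h1 : ‖∫ τ in (0 : ℝ)..t, (G l τ (ω * τ) - G l₀ τ (ω * τ))‖ ≤ η / 2 := by
    refine (intervalIntegral.norm_integral_le_of_norm_le_const (C := η') fun τ hτ => ?_).trans ?_
    · rw [uIoc_of_le ht.1] at hτ
      rw [periodic_eq_fract (hper l τ), periodic_eq_fract (hper l₀ τ)]
      exact (hl (τ, Int.fract (ω * τ)) ⟨⟨hτ.1.le, hτ.2.trans ht.2⟩, Int.fract_nonneg _,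
        (Int.fract_lt_one _).le⟩).le
    · rw [sub_zero, abs_of_nonneg ht.1, div_mul_eq_mul_div,
        div_le_div_iff₀ (by positivity) two_pos]
      nlinarith [ht.2]
  rw [intervalIntegral.integral_sub (hint _ _ _ _) (hint _ _ _ _)] at h1
  have h2 := norm_add_le ((∫ τ in (0 : ℝ)..t, G l τ (ω * τ)) - ∫ τ in (0 : ℝ)..t, G l₀ τ (ω * τ))
    (∫ τ in (0 : ℝ)..t, G l₀ τ (ω * τ))
  rw [sub_add_cancel] at h2
  linarith [hc ω hω t ht]

/-- Continuous families of continuous curves can be approximated by continuous families of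
continuously differentiable ones with the same end points. -/
theorem exists_smoothing {Λ : Type*} [TopologicalSpace Λ] [NormalSpace Λ] [ParacompactSpace Λ]
    [CompleteSpace E] {v : Λ → ℝ → E} (hv : Continuous (Function.uncurry v)) {S : ℝ} (hS : 0 < S)
    {η : Λ → ℝ} (hη : Continuous η) (hη0 : ∀ l, 0 < η l) :
    ∃ q : Λ → ℝ → E, Continuous (Function.uncurry q) ∧
      (∀ l, v l 0 + ∫ τ in (0 : ℝ)..S, q l τ = v l S) ∧
      ∀ l, ∀ t ∈ Icc 0 S, ‖v l 0 + (∫ τ in (0 : ℝ)..t, q l τ) - v l t‖ ≤ η l := by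
  have hvl : ∀ l, Continuous (v l) := fun l => hv.comp (continuous_const.prodMk continuous_id)
  obtain ⟨ω, hω⟩ := exists_continuous_of_eventually_forall_ge
    (Q := fun l ω => ∀ t ∈ Icc 0 S, ∀ s ∈ Icc 0 (1 / ω), ‖v l (t + s) - v l t‖ ≤ η l / 4) (by
    intro l₀
    have hev : ∀ᶠ p in 𝓝 (l₀, (0 : ℝ)), ∀ t ∈ Icc 0 S,
        ‖v p.1 (t + p.2) - v p.1 t‖ < η p.1 / 4 := by
      refine eventually_forall_lt isCompact_Icc
        (φ := fun (p : Λ × ℝ) (t : ℝ) => ‖v p.1 (t + p.2) - v p.1 t‖)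
        (ψ := fun p _ => η p.1 / 4) ?_ (by fun_prop) (fun y _ => by simpa using hη0 l₀)
      exact ((hv.comp (f := fun q : (Λ × ℝ) × ℝ => (q.1.1, q.2 + q.1.2)) (by fun_prop)).sub
        (hv.comp (f := fun q : (Λ × ℝ) × ℝ => (q.1.1, q.2)) (by fun_prop))).norm
    rw [nhds_prod_eq] at hev
    obtain ⟨p₁, hp₁, p₂, hp₂, h⟩ := eventually_prod_iff.1 hev
    obtain ⟨δ, hδ, hδ'⟩ := Metric.eventually_nhds_iff.1 hp₂
    refine ⟨2 / δ, hp₁.mono fun l hl ω hω t ht s hs => (h hl (hδ' ?_) t ht).le⟩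
    have hω0 : 0 < ω := lt_of_lt_of_le (by positivity) hω
    have h1 : 1 / ω < δ := by
      rw [ge_iff_le, div_le_iff₀ hδ] at hω
      rw [div_lt_iff₀ hω0]
      linarith
    rw [Real.dist_eq, sub_zero, abs_of_nonneg hs.1]
    exact hs.2.trans_lt h1)
  let h : Λ → ℝ := fun l => 1 / ω l
  have hh : ∀ l, 0 < h l := fun l => one_div_pos.2 (hω l).1
  have hhc : Continuous h := continuous_const.div ω.continuous fun l => (hω l).1.ne'
  -- The primitive of this difference quotient is the moving average of `v l` over length `h l`,
  -- minus its value at `0`.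
  let q₀ : Λ → ℝ → E := fun l t => ω l • (v l (t + h l) - v l t)
  have hq₀ : Continuous (Function.uncurry q₀) := by
    refine (ω.continuous.comp continuous_fst).smul ((hv.comp (f := fun q : Λ × ℝ =>
      (q.1, q.2 + h q.1)) (by fun_prop)).sub hv)
  have hmean : ∀ l, ∀ t ∈ Icc 0 S,
      ‖ω l • (∫ τ in t..(t + h l), v l τ) - v l t‖ ≤ η l / 4 := by
    intro l t ht
    have h1 : ω l • (∫ τ in t..(t + h l), v l τ) - v l t
        = ω l • ∫ τ in t..(t + h l), (v l τ - v l t) := by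
      rw [intervalIntegral.integral_sub ((hvl l).intervalIntegrable _ _)
        intervalIntegrable_const, intervalIntegral.integral_const, smul_sub, add_sub_cancel_left,
        smul_smul, mul_one_div_cancel (hω l).1.ne', one_smul]
    rw [h1, norm_smul, Real.norm_of_nonneg (hω l).1.le]
    have h2 : ‖∫ τ in t..(t + h l), (v l τ - v l t)‖ ≤ η l / 4 * h l := by
      refine (intervalIntegral.norm_integral_le_of_norm_le_const (C := η l / 4)
        fun τ hτ => ?_).trans ?_
      · rw [uIoc_of_le (by linarith [hh l])] at hτ
        have := (hω l).2 _ le_rfl t ht (τ - t) ⟨by linarith [hτ.1], by linarith [hτ.2]⟩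
        rwa [add_sub_cancel] at this
      · rw [add_sub_cancel_left, abs_of_pos (hh l)]
    calc _ ≤ ω l * (η l / 4 * h l) := mul_le_mul_of_nonneg_left h2 (hω l).1.le
      _ = η l / 4 * (ω l * (1 / ω l)) := by ring
      _ = _ := by rw [mul_one_div_cancel (hω l).1.ne', mul_one]
  have hq₀int : ∀ l, ∀ t, ∫ τ in (0 : ℝ)..t, q₀ l τ
      = ω l • (∫ τ in t..(t + h l), v l τ) - ω l • ∫ τ in (0 : ℝ)..(0 + h l), v l τ := by
    intro l t
    have h1 : Continuous fun τ => v l (τ + h l) := (hvl l).comp (continuous_add_const (h l))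
    simp only [q₀]
    rw [intervalIntegral.integral_smul, intervalIntegral.integral_sub
      (h1.intervalIntegrable _ _) ((hvl l).intervalIntegrable _ _), intervalIntegral.integral_comp_add_right (v l),
      intervalIntegral.integral_interval_sub_interval_comm' ((hvl l).intervalIntegrable _ _)
      ((hvl l).intervalIntegrable _ _) ((hvl l).intervalIntegrable _ _), smul_sub]
  have happrox : ∀ l, ∀ t ∈ Icc 0 S, ‖v l 0 + (∫ τ in (0 : ℝ)..t, q₀ l τ) - v l t‖ ≤ η l / 2 := by
    intro l t ht
    rw [hq₀int, show ∀ a b c d : E, a + (b - c) - d = (b - d) - (c - a) from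
      fun a b c d => by abel]
    refine (norm_sub_le _ _).trans ?_
    linarith [hmean l t ht, hmean l 0 (left_mem_Icc.2 hS.le)]
  -- The error of the moving average at the end point is removed by the constant extra velocity `S⁻¹
  -- • e l`.
  let e : Λ → E := fun l => v l S - v l 0 - ∫ τ in (0 : ℝ)..S, q₀ l τ
  have he : Continuous e :=
    ((hv.comp (continuous_id.prodMk continuous_const)).sub
      (hv.comp (continuous_id.prodMk continuous_const))).sub
      (intervalIntegral.continuous_parametric_intervalIntegral_of_continuous' hq₀ _ _)
  have hen : ∀ l, ‖e l‖ ≤ η l / 2 := fun l => by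
    have := happrox l S (right_mem_Icc.2 hS.le)
    rwa [← norm_neg, show -(v l 0 + (∫ τ in (0 : ℝ)..S, q₀ l τ) - v l S) = e l by
      simp only [e]; abel] at this
  have hint : ∀ l t, ∫ τ in (0 : ℝ)..t, (q₀ l τ + S⁻¹ • e l)
      = (∫ τ in (0 : ℝ)..t, q₀ l τ) + (t / S) • e l := fun l t => by
    have h1 : Continuous (q₀ l) := hq₀.comp (continuous_const.prodMk continuous_id)
    rw [intervalIntegral.integral_add (h1.intervalIntegrable _ _)
      intervalIntegrable_const, intervalIntegral.integral_const, smul_smul, sub_zero]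
    rfl
  refine ⟨fun l t => q₀ l t + S⁻¹ • e l, ?_, fun l => ?_, fun l t ht => ?_⟩
  · exact hq₀.add (continuous_const.smul (he.comp continuous_fst))
  · rw [hint, div_self hS.ne', one_smul]
    simp only [e]
    abel
  · rw [hint, ← add_assoc, add_sub_right_comm]
    refine (norm_add_le _ _).trans ?_
    have h1 : ‖(t / S) • e l‖ ≤ 1 * (η l / 2) := by
      rw [norm_smul, Real.norm_of_nonneg (div_nonneg ht.1 hS.le)]
      exact mul_le_mul ((div_le_one hS).2 ht.2) (hen l) (norm_nonneg _) zero_le_one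
    linarith [happrox l t ht]

end Integrals

end TriangularControl

namespace TriangularControl

/-! ### Continuous weights representing a target as a convex combination of values. -/

section TimeSharing

/-- Labels of the vertices of a cross-polytope in `Y`, together with its centre. -/
abbrev Vertices (Y : Type*) [NormedAddCommGroup Y] [NormedSpace ℝ Y] : Type :=
  Option (Fin (Module.finrank ℝ Y) × Bool)


variable {P V Y : Type*} [TopologicalSpace P] [NormedAddCommGroup V] [NormedSpace ℝ V]
  [NormedAddCommGroup Y] [NormedSpace ℝ Y]

omit [NormedSpace ℝ V] in
/-- Near a point where `g(p₀, ·)` is onto, `q(p)` is a convex combination of the values of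
`g(p, ·)` at finitely many fixed points, with continuous weights. -/
lemma exists_local_weights [FiniteDimensional ℝ Y] {g : P → V → Y}
    (hg : Continuous (Function.uncurry g)) {q : P → Y} (hq : Continuous q) (p₀ : P)
    (hsurj : Function.Surjective (g p₀)) :
    ∃ (v : Vertices Y → V)
      (a : P → Vertices Y → ℝ), ∀ᶠ p in 𝓝 p₀,
      ContinuousAt a p ∧ (∀ j, 0 ≤ a p j) ∧ ∑ j, a p j = 1 ∧ ∑ j, a p j • g p (v j) = q p := by
  let b := Module.finBasis ℝ Y
  let dir : Vertices Y → Y := fun j => j.elim 0 fun i => cond i.2 (b i.1) (-b i.1)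
  -- The values at `p₀` are the vertices `q p₀ ± b i` and the centre. The directions cancel, so
  -- uniform weights represent `q p₀`; the centre keeps the index set nonempty when `Y` is trivial.
  choose v hv using fun j : Vertices Y => hsurj (q p₀ + dir j)
  -- Combination and total weight form one linear equation `T p a = (q p, 1)`. As `T p₀` is onto, a
  -- fixed right inverse of it corrects the uniform weights for `p` near `p₀`; strict positivity
  -- survives small corrections.
  let T : P → (Vertices Y → ℝ) →L[ℝ] Y × ℝ := fun p =>
    ∑ j, (ContinuousLinearMap.proj (R := ℝ) (φ := fun _ : Vertices Y => ℝ) j).smulRight (g p (v j), (1 : ℝ))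
  have hT : ∀ p a, T p a = (∑ j, a j • g p (v j), ∑ j, a j) := fun p a => by
    simp [T, Prod.ext_iff, Prod.fst_sum, Prod.snd_sum]
  have hTc : Continuous T := by
    refine continuous_finsetSum _ fun j _ => ?_
    have h1 : Continuous fun p => (g p (v j), (1 : ℝ)) :=
      (hg.comp (continuous_id.prodMk continuous_const)).prodMk continuous_const
    exact ((ContinuousLinearMap.smulRightL ℝ (Vertices Y → ℝ) (Y × ℝ)
      (ContinuousLinearMap.proj (R := ℝ) (φ := fun _ : Vertices Y => ℝ) j)).continuous).comp h1
  let N : ℝ := Fintype.card (Vertices Y)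
  have hN : 0 < N := by simp only [N]; exact_mod_cast Fintype.card_pos
  let a₀ : Vertices Y → ℝ := fun _ => N⁻¹
  have ha₀ : T p₀ a₀ = (q p₀, 1) := by
    have h1 : ∑ j, dir j = 0 := by
      rw [Fintype.sum_option, Fintype.sum_prod_type]
      simp [dir]
    rw [hT]
    simp only [a₀, hv, ← Finset.smul_sum, Finset.sum_add_distrib, h1, add_zero, Finset.sum_const,
      Finset.card_univ, Prod.mk.injEq]
    constructor
    · rw [← Nat.cast_smul_eq_nsmul ℝ, smul_smul, inv_mul_cancel₀ hN.ne', one_smul]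
    · rw [nsmul_eq_mul, mul_inv_cancel₀ hN.ne']
  have hsurjT : Function.Surjective (T p₀).toLinearMap := by
    rw [← LinearMap.range_eq_top, eq_top_iff]
    have hb : ∀ i, (b i, (0 : ℝ)) ∈ LinearMap.range (T p₀).toLinearMap := fun i => by
      refine ⟨Pi.single (some (i, true)) (1 / 2) - Pi.single (some (i, false)) (1 / 2), ?_⟩
      have h1 : ∀ j, T p₀ (Pi.single j (1 / 2)) = (1 / 2 : ℝ) • (q p₀ + dir j, 1) := fun j => by
        rw [hT]
        simp [Pi.single_apply, hv, -Fintype.sum_option, Finset.sum_add_distrib]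
      have h2 : dir (some (i, true)) - dir (some (i, false)) = (2 : ℝ) • b i := by
        simp [dir, two_smul]
      rw [ContinuousLinearMap.coe_coe, map_sub, h1, h1, ← smul_sub, Prod.mk_sub_mk,
        add_sub_add_left_eq_sub, h2, sub_self, Prod.smul_mk, smul_smul, smul_zero]
      norm_num
    have hY : ∀ y : Y, (y, (0 : ℝ)) ∈ LinearMap.range (T p₀).toLinearMap := fun y => by
      rw [show (y, (0 : ℝ)) = LinearMap.inl ℝ Y ℝ y from rfl, ← b.sum_repr y, map_sum]
      refine Submodule.sum_mem _ fun i _ => ?_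
      rw [map_smul]
      exact Submodule.smul_mem _ _ (hb i)
    rintro ⟨y, r⟩ -
    have h1 : ((y, r) : Y × ℝ) = (y - r • q p₀, 0) + r • (q p₀, 1) := by simp
    rw [h1]
    exact Submodule.add_mem _ (hY _) (Submodule.smul_mem _ _ ⟨a₀, ha₀⟩)
  obtain ⟨R₀, hR₀⟩ := (T p₀).toLinearMap.exists_rightInverse_of_surjective
    (LinearMap.range_eq_top.2 hsurjT)
  let R : Y × ℝ →L[ℝ] (Vertices Y → ℝ) := R₀.toContinuousLinearMap
  have hR : (T p₀).comp R = 1 := by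
    exact ContinuousLinearMap.ext fun x => LinearMap.congr_fun hR₀ x
  have hTR : Continuous fun p => (T p).comp R := hTc.clm_comp continuous_const
  have hU : ∀ᶠ p in 𝓝 p₀, IsUnit ((T p).comp R) :=
    hTR.continuousAt.eventually (Units.isOpen.mem_nhds (by simp only [mem_ofPred_eq, hR]; exact isUnit_one))
  let a : P → Vertices Y → ℝ := fun p => a₀ + R (Ring.inverse ((T p).comp R) ((q p, 1) - T p a₀))
  have hac : ∀ p, IsUnit ((T p).comp R) → ContinuousAt a p := fun p hp => by
    have h1 : ContinuousAt (fun p => Ring.inverse ((T p).comp R)) p := by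
      obtain ⟨u, hu⟩ := hp
      have := NormedRing.inverse_continuousAt u
      rw [hu] at this
      exact ContinuousAt.comp (f := fun p => (T p).comp R) this hTR.continuousAt
    have h2 : ContinuousAt (fun p => (q p, (1 : ℝ)) - T p a₀) p :=
      ((hq.prodMk continuous_const).sub (hTc.clm_apply continuous_const)).continuousAt
    exact continuousAt_const.add (R.continuous.continuousAt.comp (h1.clm_apply h2))
  have hap₀ : a p₀ = a₀ := by simp [a, ha₀]
  have hpos : ∀ᶠ p in 𝓝 p₀, ∀ j, 0 < a p j := by
    refine eventually_all.2 fun j => ?_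
    have h1 : ContinuousAt (fun p => a p j) p₀ :=
      (continuous_apply j).continuousAt.comp (hac p₀ (by rw [hR]; exact isUnit_one))
    refine h1.eventually (lt_mem_nhds ?_)
    simp only [hap₀]
    exact inv_pos.2 hN
  refine ⟨v, a, ?_⟩
  filter_upwards [hU, hpos] with p hp hp'
  have h1 : T p (a p) = (q p, 1) := by
    have h2 : (T p) (R (Ring.inverse ((T p).comp R) ((q p, 1) - T p a₀))) = (q p, 1) - T p a₀ :=
      DFunLike.congr_fun (Ring.mul_inverse_cancel _ hp) ((q p, (1 : ℝ)) - T p a₀)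
    simp only [a, map_add, h2, add_sub_cancel]
  rw [hT, Prod.mk.injEq] at h1
  exact ⟨hac p hp, fun j => (hp' j).le, h1.2, h1.1⟩

lemma finsum_partition_smul {J M : Type*} [Fintype J] [AddCommGroup M] [Module ℝ M]
    (φ : PartitionOfUnity ℕ P) (e : ℕ ≃ ℕ × J) {p : P} (a : ℕ → J → ℝ) (f : ℕ × J → M) (m : M)
    (h : ∀ n, φ n p ≠ 0 → ∑ j, a n j • f (n, j) = m) :
    ∑ᶠ k : ℕ, (φ (e k).1 p * a (e k).1 (e k).2) • f (e k) = m := by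
  classical
  rw [finsum_comp_equiv e (f := fun i : ℕ × J => (φ i.1 p * a i.1 i.2) • f i)]
  have hfin : (Function.support fun n => φ n p).Finite := φ.locallyFinite.point_finite p
  rw [finsum_eq_sum_of_support_subset (s := hfin.toFinset ×ˢ Finset.univ), Finset.sum_product]
  · have h1 : ∀ n ∈ hfin.toFinset, ∑ j, (φ n p * a n j) • f (n, j) = φ n p • m := by
      intro n hn
      rw [← h n (by simpa using hn), Finset.smul_sum]
      exact Finset.sum_congr rfl fun j _ => mul_smul _ _ _
    rw [Finset.sum_congr rfl h1, ← Finset.sum_smul, ← finsum_eq_sum_of_support_subset _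
      (by simp), φ.sum_eq_one (mem_univ p), one_smul]
  · rintro ⟨n, j⟩ h
    simp only [Function.mem_support] at h
    simp only [Finset.coe_product, Finite.coe_toFinset, Finset.coe_univ, mem_prod,
      Function.mem_support, mem_univ, and_true]
    intro h0
    rw [h0, zero_mul, zero_smul] at h
    exact h rfl

-- Only the weights vary with `p`, while the points are fixed, so local solutions can be glued: each
-- local weight is multiplied by its function of a partition of unity subordinate to a countable
-- cover. Numbering the pairs (chart, vertex) by `ℕ` provides the order in which the points are
-- visited later.
omit [NormedSpace ℝ V] in
theorem exists_weights [FiniteDimensional ℝ Y] [SecondCountableTopology P] [NormalSpace P]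
    [ParacompactSpace P] {g : P → V → Y}
    (hg : Continuous (Function.uncurry g)) {q : P → Y} (hq : Continuous q)
    (hsurj : ∀ p, Function.Surjective (g p)) :
    ∃ (v : ℕ → V) (α : ℕ → P → ℝ), (∀ k, Continuous (α k)) ∧
      LocallyFinite (fun k => Function.support (α k)) ∧ (∀ k p, 0 ≤ α k p) ∧
      (∀ p, ∑ᶠ k, α k p = 1) ∧ ∀ p, ∑ᶠ k, α k p • g p (v k) = q p := by
  classical
  rcases isEmpty_or_nonempty P with hP | ⟨⟨p₀⟩⟩
  · refine ⟨fun _ => 0, fun _ _ => 0, fun _ => continuous_const, fun p => hP.elim p,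
      fun _ p => hP.elim p, fun p => hP.elim p, fun p => hP.elim p⟩
  choose v a hva using fun p => exists_local_weights hg hq p (hsurj p)
  obtain ⟨s, hs, hcov⟩ := TopologicalSpace.countable_cover_nhds fun p =>
    interior_mem_nhds.2 (hva p)
  have hsne : s.Nonempty := by
    rw [nonempty_iff_ne_empty]
    rintro rfl
    simp only [mem_empty_iff_false, iUnion_of_empty, iUnion_empty] at hcov
    exact (hcov ▸ mem_univ p₀ : p₀ ∈ (∅ : Set P))
  obtain ⟨x, rfl⟩ := hs.exists_eq_range hsne
  rw [biUnion_range] at hcov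
  obtain ⟨φ, hφ⟩ := PartitionOfUnity.exists_isSubordinate isClosed_univ _
    (fun n : ℕ => isOpen_interior) hcov.ge
  have hloc : ∀ n p, φ n p ≠ 0 → ContinuousAt (a (x n)) p ∧ (∀ j, 0 ≤ a (x n) p j) ∧
      ∑ j, a (x n) p j = 1 ∧ ∑ j, a (x n) p j • g p (v (x n) j) = q p := fun n p hp =>
    by have h := interior_subset (hφ n (subset_tsupport _ hp)); exact h
  obtain ⟨e⟩ : Nonempty (ℕ ≃ ℕ × Vertices Y) := nonempty_equiv_of_countable
  refine ⟨fun k => v (x (e k).1) (e k).2, fun k p => φ (e k).1 p * a (x (e k).1) p (e k).2,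
    fun k => ?_, ?_, fun k p => ?_, fun p => ?_, fun p => ?_⟩
  · exact φ.continuous_smul (g := fun p => a (x (e k).1) p (e k).2) fun p hp =>
      (continuous_apply (e k).2).continuousAt.comp (interior_subset (hφ (e k).1 hp)).1
  · have h1 : LocallyFinite fun i : ℕ × Vertices Y => Function.support (φ i.1) := by
      intro p
      obtain ⟨U, hU, hfin⟩ := φ.locallyFinite p
      refine ⟨U, hU, (hfin.prod (finite_univ (α := Vertices Y))).subset ?_⟩
      rintro ⟨n, j⟩ h
      exact ⟨h, mem_univ _⟩
    exact (h1.comp_injective e.injective).subset fun k p hp =>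
      left_ne_zero_of_mul (Function.mem_support.1 hp)
  · simp only
    rcases eq_or_ne (φ (e k).1 p) 0 with h | h
    · rw [h, zero_mul]
    · exact mul_nonneg (φ.nonneg _ _) ((hloc _ _ h).2.1 _)
  · simpa using finsum_partition_smul φ e (fun n => a (x n) p) (fun _ => (1 : ℝ)) 1 fun n hn => by simpa using (hloc n p hn).2.2.1
  · exact finsum_partition_smul φ e (fun n => a (x n) p) (fun i => g p (v (x i.1) i.2)) (q p) fun n hn => (hloc n p hn).2.2.2

end TimeSharing

end TriangularControl

namespace TriangularControl

/-! ### Weights as shares of the unit time interval. -/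

section TimeSharing

variable {P V Y : Type*} [NormedAddCommGroup V] [NormedSpace ℝ V]
  [NormedAddCommGroup Y] [NormedSpace ℝ Y]

/-- Partial sums of a sequence of weights. -/
def partialSum (α : ℕ → P → ℝ) (k : ℕ) (p : P) : ℝ := ∑ j ∈ Finset.range k, α j p

/-- A trapezoid of slope `M` and height at most one over the `k`-th interval between consecutive
partial sums. -/
def trapezoid (α : ℕ → P → ℝ) (k : ℕ) (M : ℝ) (p : P) (θ : ℝ) : ℝ :=
  max 0 (min 1 (|M| * min (θ - partialSum α k p) (partialSum α (k + 1) p - θ)))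

/-- The curve that visits the points `v k` during intervals whose lengths are the weights. -/
noncomputable def visit (v : ℕ → V) (α : ℕ → P → ℝ) (M : ℝ) (p : P) (θ : ℝ) : V :=
  ∑ᶠ k, trapezoid α k M p θ • v k

lemma trapezoid_nonneg (α : ℕ → P → ℝ) (k : ℕ) (M : ℝ) (p : P) (θ : ℝ) :
    0 ≤ trapezoid α k M p θ := le_max_left _ _

lemma trapezoid_le_one (α : ℕ → P → ℝ) (k : ℕ) (M : ℝ) (p : P) (θ : ℝ) :
    trapezoid α k M p θ ≤ 1 := max_le zero_le_one (min_le_left _ _)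

/-- The absolute value of the slope makes this true for every real `M`, so the curves are closed and
bounded without a sign condition on `M`. -/
lemma trapezoid_eq_zero_of_min {α : ℕ → P → ℝ} {k : ℕ} {p : P} {θ : ℝ} (M : ℝ)
    (h : min (θ - partialSum α k p) (partialSum α (k + 1) p - θ) ≤ 0) :
    trapezoid α k M p θ = 0 :=
  max_eq_left ((min_le_right _ _).trans (mul_nonpos_of_nonneg_of_nonpos (abs_nonneg _) h))

lemma partialSum_succ (α : ℕ → P → ℝ) (k : ℕ) (p : P) :
    partialSum α (k + 1) p = partialSum α k p + α k p := Finset.sum_range_succ _ _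

lemma partialSum_mono {α : ℕ → P → ℝ} (h0 : ∀ k p, 0 ≤ α k p) (p : P) :
    Monotone fun k => partialSum α k p :=
  monotone_nat_of_le_succ fun k => by rw [partialSum_succ]; linarith [h0 k p]

lemma trapezoid_eq_zero {α : ℕ → P → ℝ} {k : ℕ} {p : P} (h : α k p = 0) (M θ : ℝ) :
    trapezoid α k M p θ = 0 := by
  refine trapezoid_eq_zero_of_min M ?_
  rw [partialSum_succ, h, add_zero]
  rcases le_total θ (partialSum α k p) with h | h
  · exact (min_le_left _ _).trans (by linarith)
  · exact (min_le_right _ _).trans (by linarith)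

variable [TopologicalSpace P]

lemma continuous_partialSum {α : ℕ → P → ℝ} (hα : ∀ k, Continuous (α k)) (k : ℕ) :
    Continuous (partialSum α k) := continuous_finsetSum _ fun j _ => hα j

/-- A trapezoid vanishes together with its weight, so the sum is locally finite; each trapezoid
stays continuous when its interval shrinks to a point. -/
lemma continuous_visit {α : ℕ → P → ℝ} (hα : ∀ k, Continuous (α k))
    (hlf : LocallyFinite fun k => Function.support (α k)) (v : ℕ → V) :
    Continuous fun x : ℝ × P × ℝ => visit v α x.1 x.2.1 x.2.2 := by
  refine continuous_finsum (fun k => ?_) ?_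
  · have h1 := continuous_partialSum hα k
    have h2 := continuous_partialSum hα (k + 1)
    unfold trapezoid
    fun_prop
  · refine (hlf.preimage_continuous (g := fun x : ℝ × P × ℝ => x.2.1) (by fun_prop)).subset
      fun k x hx => ?_
    contrapose! hx
    simp only [mem_preimage, Function.mem_support, not_not] at hx ⊢
    rw [trapezoid_eq_zero hx, zero_smul]

omit [TopologicalSpace P] in
lemma visit_eq_sum {α : ℕ → P → ℝ} {p : P} {N : ℕ} (hN : ∀ k ≥ N, α k p = 0) (v : ℕ → V)
    (M θ : ℝ) : visit v α M p θ = ∑ k ∈ Finset.range N, trapezoid α k M p θ • v k := by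
  refine finsum_eq_sum_of_support_subset _ fun k hk => ?_
  rw [Finset.coe_range, mem_Iio]
  contrapose! hk
  rw [Function.mem_support, not_not, trapezoid_eq_zero (hN k hk), zero_smul]

omit [TopologicalSpace P] in
lemma norm_visit_le {α : ℕ → P → ℝ} {p : P} {N : ℕ} (hN : ∀ k ≥ N, α k p = 0) (v : ℕ → V)
    (M θ : ℝ) : ‖visit v α M p θ‖ ≤ ∑ k ∈ Finset.range N, ‖v k‖ := by
  rw [visit_eq_sum hN]
  refine (norm_sum_le _ _).trans (Finset.sum_le_sum fun k _ => ?_)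
  rw [norm_smul, Real.norm_of_nonneg (trapezoid_nonneg _ _ _ _ _)]
  exact mul_le_of_le_one_left (norm_nonneg _) (trapezoid_le_one _ _ _ _ _)

omit [TopologicalSpace P] in
lemma visit_eq_smul {α : ℕ → P → ℝ} (h0 : ∀ k p, 0 ≤ α k p) {p : P} {k : ℕ} {θ : ℝ}
    (hθ : θ ∈ Icc (partialSum α k p) (partialSum α (k + 1) p)) (v : ℕ → V) (M : ℝ) :
    visit v α M p θ = trapezoid α k M p θ • v k := by
  refine finsum_eq_single _ _ fun j hj => ?_
  rw [trapezoid_eq_zero_of_min, zero_smul]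
  rcases lt_or_gt_of_ne hj with h | h
  · have : partialSum α (j + 1) p ≤ partialSum α k p := partialSum_mono h0 p h
    exact (min_le_right _ _).trans (by linarith [hθ.1])
  · have : partialSum α (k + 1) p ≤ partialSum α j p := partialSum_mono h0 p h
    exact (min_le_left _ _).trans (by linarith [hθ.2])

omit [TopologicalSpace P] in
lemma visit_zero {α : ℕ → P → ℝ} (h0 : ∀ k p, 0 ≤ α k p) (v : ℕ → V) (M : ℝ) (p : P) :
    visit v α M p 0 = 0 := by
  refine finsum_eq_zero_of_forall_eq_zero fun k => ?_
  rw [trapezoid_eq_zero_of_min, zero_smul]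
  have : partialSum α 0 p ≤ partialSum α k p := partialSum_mono h0 p (Nat.zero_le k)
  simp only [partialSum, Finset.range_zero, Finset.sum_empty] at this
  exact (min_le_left _ _).trans (by simpa [partialSum] using this)

omit [TopologicalSpace P] in
lemma visit_one {α : ℕ → P → ℝ} {p : P} (h1 : ∀ k, partialSum α k p ≤ 1) (v : ℕ → V) (M : ℝ) :
    visit v α M p 1 = 0 := by
  refine finsum_eq_zero_of_forall_eq_zero fun k => ?_
  rw [trapezoid_eq_zero_of_min, zero_smul]
  exact (min_le_right _ _).trans (by linarith [h1 (k + 1)])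

/-- On the `k`-th interval the curve rests at `v k` except on two ramps of length `1 / M`, where the
integrand is off by at most `2 * C`. This costs `4 * C / M` per interval. -/
lemma norm_integral_visit_sub_le [CompleteSpace Y] {g : V → Y} (hg : Continuous g) {α : ℕ → P → ℝ}
    (h0 : ∀ k p, 0 ≤ α k p) (hα : ∀ k, Continuous (α k))
    (hlf : LocallyFinite fun k => Function.support (α k)) {p : P} {N : ℕ}
    (hsum : partialSum α N p = 1) (v : ℕ → V) {C M : ℝ} (hM : 0 < M)
    (hC : ∀ w : V, ‖w‖ ≤ ∑ k ∈ Finset.range N, ‖v k‖ → ‖g w‖ ≤ C) :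
    ‖(∫ θ in (0 : ℝ)..1, g (visit v α M p θ)) - ∑ k ∈ Finset.range N, α k p • g (v k)‖
      ≤ N * (4 * C / M) := by
  have hcont : Continuous fun θ => visit v α M p θ :=
    (continuous_visit hα hlf v).comp (f := fun θ : ℝ => (M, p, θ)) (by fun_prop)
  have hgc : Continuous fun θ => g (visit v α M p θ) := hg.comp hcont
  have hS0 : partialSum α 0 p = 0 := by simp [partialSum]
  rw [← hsum, ← hS0, ← intervalIntegral.sum_integral_adjacent_intervals
    (a := fun k => partialSum α k p) fun k _ => hgc.intervalIntegrable _ _,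
    ← Finset.sum_sub_distrib]
  refine (norm_sum_le _ _).trans ?_
  rw [← nsmul_eq_mul, ← Finset.card_range N, ← Finset.sum_const, Finset.card_range]
  refine Finset.sum_le_sum fun k hk => ?_
  have hvk : ‖v k‖ ≤ ∑ k ∈ Finset.range N, ‖v k‖ :=
    Finset.single_le_sum (f := fun k => ‖v k‖) (fun _ _ => norm_nonneg _) hk
  have hle : partialSum α k p ≤ partialSum α (k + 1) p := partialSum_mono h0 p (Nat.le_succ k)
  have h1 : (∫ θ in (partialSum α k p)..(partialSum α (k + 1) p), g (visit v α M p θ))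
      - α k p • g (v k) =
      ∫ θ in (partialSum α k p)..(partialSum α (k + 1) p), (g (visit v α M p θ) - g (v k)) := by
    rw [intervalIntegral.integral_sub (hgc.intervalIntegrable _ _) intervalIntegrable_const,
      intervalIntegral.integral_const, partialSum_succ, add_sub_cancel_left]
  rw [h1]
  refine (norm_integral_le_of_eq_zero_middle (f := fun θ => g (visit v α M p θ) - g (v k))
    (hgc.sub continuous_const) (C := 2 * C) (δ := 1 / M) hle (by positivity) (fun θ hθ => ?_) fun θ hθ => ?_).trans (le_of_eq (by ring))
  · refine (norm_sub_le _ _).trans ?_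
    have h2 : ‖visit v α M p θ‖ ≤ ‖v k‖ := by
      rw [visit_eq_smul h0 hθ, norm_smul, Real.norm_of_nonneg (trapezoid_nonneg _ _ _ _ _)]
      exact mul_le_of_le_one_left (norm_nonneg _) (trapezoid_le_one _ _ _ _ _)
    linarith [hC _ (h2.trans hvk), hC _ hvk]
  · have hp : 0 < 1 / M := by positivity
    rw [visit_eq_smul h0 (k := k) (p := p) (θ := θ) ⟨by linarith [hθ.1], by linarith [hθ.2]⟩]
    have h3 : trapezoid α k M p θ = 1 := by
      have h4 : 1 / M ≤ min (θ - partialSum α k p) (partialSum α (k + 1) p - θ) :=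
        le_min (by linarith [hθ.1]) (by linarith [hθ.2])
      have h5 : 1 ≤ |M| * min (θ - partialSum α k p) (partialSum α (k + 1) p - θ) := by
        rw [abs_of_pos hM]
        rwa [div_le_iff₀' hM] at h4
      unfold trapezoid
      rw [min_eq_left h5, max_eq_right zero_le_one]
    rw [h3, one_smul, sub_self]

/-- A surjective family of maps `g(p, ·)` attains prescribed values `q(p)` on the average along
closed curves that depend continuously on `p`, up to an error that can be made small without
enlarging the curves. -/
theorem exists_timeSharing [FiniteDimensional ℝ Y] [FiniteDimensional ℝ V]
    [SecondCountableTopology P] [NormalSpace P]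
    [ParacompactSpace P] {g : P → V → Y}
    (hg : Continuous (Function.uncurry g)) {q : P → Y} (hq : Continuous q)
    (hsurj : ∀ p, Function.Surjective (g p)) :
    ∃ W : ℝ → P → ℝ → V, Continuous (fun x : ℝ × P × ℝ => W x.1 x.2.1 x.2.2) ∧
      (∀ M p, Function.Periodic (W M p) 1) ∧
      (∀ p₀, ∃ R, ∀ᶠ p in 𝓝 p₀, ∀ M θ, ‖W M p θ‖ ≤ R) ∧
      ∀ p₀, ∀ a > 0, ∃ c, ∀ᶠ p in 𝓝 p₀, ∀ M ≥ c,
        ‖(∫ θ in (0 : ℝ)..1, g p (W M p θ)) - q p‖ ≤ a := by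
  have : CompleteSpace Y := FiniteDimensional.complete ℝ Y
  obtain ⟨v, α, hα, hlf, h0, hα1, hαq⟩ := exists_weights hg hq hsurj
  have hN : ∀ p₀, ∃ N : ℕ, ∀ᶠ p in 𝓝 p₀, ∀ k ≥ N, α k p = 0 := by
    intro p₀
    obtain ⟨U, hU, hfin⟩ := hlf p₀
    obtain ⟨N, hN⟩ := hfin.bddAbove
    refine ⟨N + 1, Filter.mem_of_superset hU fun p hp k hk => ?_⟩
    by_contra hne
    have : k ≤ N := hN ⟨p, hne, hp⟩
    omega
  have hsum : ∀ p N, (∀ k ≥ N, α k p = 0) → partialSum α N p = 1 ∧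
      ∑ k ∈ Finset.range N, α k p • g p (v k) = q p := by
    intro p N hN
    have hs : ∀ k, k ∉ Finset.range N → α k p = 0 := fun k hk => hN k (by simpa using hk)
    rw [← hα1 p, ← hαq p]
    constructor
    · exact (finsum_eq_sum_of_support_subset _ fun k hk => by
        by_contra h
        exact hk (hs k (by simpa using h))).symm
    · refine (finsum_eq_sum_of_support_subset _ fun k hk => ?_).symm
      by_contra h
      rw [Function.mem_support, hs k (by simpa using h), zero_smul] at hk
      exact hk rfl
  have hle1 : ∀ p k, partialSum α k p ≤ 1 := by
    intro p k
    obtain ⟨N, hN'⟩ := hN p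
    have hNp := hN'.self_of_nhds
    rw [← (hsum p (max N k) fun j hj => hNp j ((le_max_left _ _).trans hj)).1]
    exact partialSum_mono h0 p (le_max_right _ _)
  have hends : ∀ M p, visit v α M p 0 = visit v α M p 1 := fun M p => by
    rw [visit_zero h0, visit_one (hle1 p)]
  have hvc := continuous_visit hα hlf v
  refine ⟨fun M p θ => visit v α M p (Int.fract θ), ?_, fun M p θ => ?_, fun p₀ => ?_,
    fun p₀ a ha => ?_⟩
  · have h1 := ContinuousOn.comp_fract' (f := fun (x : ℝ × P) (θ : ℝ) => visit v α x.1 x.2 θ)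
      (hvc.comp (f := fun y : (ℝ × P) × ℝ => (y.1.1, y.1.2, y.2)) (by fun_prop)).continuousOn
      fun x => hends x.1 x.2
    exact h1.comp (f := fun x : ℝ × P × ℝ => ((x.1, x.2.1), x.2.2)) (by fun_prop)
  · simp only [Int.fract_add_one]
  · obtain ⟨N, hN'⟩ := hN p₀
    exact ⟨_, hN'.mono fun p hp M θ => norm_visit_le hp v M _⟩
  · obtain ⟨N, hN'⟩ := hN p₀
    set R := ∑ k ∈ Finset.range N, ‖v k‖
    obtain ⟨C, hC⟩ := (isCompact_closedBall (0 : V) R).exists_bound_of_continuousOn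
      (hg.comp (continuous_const.prodMk continuous_id) : Continuous (g p₀)).continuousOn
    have hev : ∀ᶠ p in 𝓝 p₀, ∀ w ∈ Metric.closedBall (0 : V) R, ‖g p w‖ < |C| + 1 := by
      refine eventually_forall_lt (isCompact_closedBall (0 : V) R)
        (φ := fun p w => ‖g p w‖) (ψ := fun _ _ => |C| + 1) hg.norm continuous_const
        fun w hw => ?_
      have : ‖g p₀ w‖ ≤ C := hC w hw
      linarith [le_abs_self C]
    refine ⟨max 1 (N * (4 * (|C| + 1)) / a), ?_⟩
    filter_upwards [hN', hev] with p hp hp' M hM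
    have hM0 : 0 < M := one_pos.trans_le ((le_max_left _ _).trans hM)
    have hM1 := (le_max_right _ _).trans hM
    have hgp : Continuous (g p) := hg.comp (continuous_const.prodMk continuous_id)
    have h1 := norm_integral_visit_sub_le hgp h0 hα hlf (hsum p N hp).1 v hM0 (C := |C| + 1)
      fun w hw => (hp' w (by simpa using hw)).le
    rw [(hsum p N hp).2] at h1
    have h2 : ∫ θ in (0 : ℝ)..1, g p (visit v α M p (Int.fract θ))
        = ∫ θ in (0 : ℝ)..1, g p (visit v α M p θ) := by
      refine intervalIntegral.integral_congr fun θ hθ => ?_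
      rw [uIcc_of_le zero_le_one] at hθ
      rcases hθ.2.eq_or_lt with rfl | h
      · simp [hends]
      · simp only [Int.fract_eq_self.2 ⟨hθ.1, h⟩]
    rw [h2]
    refine h1.trans ?_
    rw [div_le_iff₀ ha] at hM1
    rw [← mul_div_assoc, div_le_iff₀ hM0]
    linarith

end TimeSharing

end TriangularControl

/-! ### Chattering: following a prescribed velocity on the average. -/

namespace TriangularControl

/-- A cutoff that vanishes at `0` and `S` and equals one away from these points. -/
noncomputable def endCutoff (S ω t : ℝ) : ℝ := max 0 (min 1 (ω * min t (S - t)))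

lemma continuous_endCutoff (S : ℝ) : Continuous fun x : ℝ × ℝ => endCutoff S x.1 x.2 := by
  unfold endCutoff
  fun_prop

lemma endCutoff_nonneg (S ω t : ℝ) : 0 ≤ endCutoff S ω t := le_max_left _ _

lemma endCutoff_le_one (S ω t : ℝ) : endCutoff S ω t ≤ 1 := max_le zero_le_one (min_le_left _ _)

lemma endCutoff_zero {S : ℝ} (hS : 0 ≤ S) (ω : ℝ) : endCutoff S ω 0 = 0 := by
  simp [endCutoff, hS]

lemma endCutoff_right {S : ℝ} (hS : 0 ≤ S) (ω : ℝ) : endCutoff S ω S = 0 := by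
  simp [endCutoff, hS]

lemma endCutoff_eq_one {S ω t : ℝ} (hω : 0 < ω) (h1 : 1 / ω ≤ t) (h2 : t ≤ S - 1 / ω) :
    endCutoff S ω t = 1 := by
  have h3 : 1 / ω ≤ min t (S - t) := le_min h1 (by linarith)
  rw [div_le_iff₀' hω] at h3
  unfold endCutoff
  rw [min_eq_left h3, max_eq_right zero_le_one]

lemma integral_sub_add_integral_sub {Y : Type*} [NormedAddCommGroup Y] [NormedSpace ℝ Y]
    {f g h : ℝ → Y} (hf : Continuous f) (hg : Continuous g) (hh : Continuous h) (a b : ℝ) :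
    ∫ τ in a..b, (f τ - h τ) = (∫ τ in a..b, (f τ - g τ)) + ∫ τ in a..b, (g τ - h τ) := by
  rw [intervalIntegral.integral_sub (hf.intervalIntegrable _ _) (hh.intervalIntegrable _ _),
    intervalIntegral.integral_sub (hf.intervalIntegrable _ _) (hg.intervalIntegrable _ _),
    intervalIntegral.integral_sub (hg.intervalIntegrable _ _) (hh.intervalIntegrable _ _),
    sub_add_sub_cancel]

section Chattering

variable {Λ V Y : Type*} [MetricSpace Λ] [SecondCountableTopology Λ] [NormedAddCommGroup V]
  [NormedSpace ℝ V] [FiniteDimensional ℝ V] [NormedAddCommGroup Y] [NormedSpace ℝ Y]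
  [FiniteDimensional ℝ Y]

omit [SecondCountableTopology Λ] [NormedSpace ℝ V] [FiniteDimensional ℝ V] [NormedSpace ℝ Y]
  [FiniteDimensional ℝ Y] in
lemma exists_continuous_bound {K : Set ℝ} (hK : IsCompact K) {f : Λ × ℝ → ℝ}
    (hf : ∀ p₀, ∃ R, ∀ᶠ p in 𝓝 p₀, f p ≤ R) :
    ∃ R : C(Λ, ℝ), ∀ l, 0 < R l ∧ ∀ t ∈ K, f (l, t) ≤ R l := by
  obtain ⟨R, hR⟩ := exists_continuous_of_eventually_forall_ge_prod hK
    (Q := fun p c => f p ≤ c) fun p₀ => by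
      obtain ⟨R, hR⟩ := hf p₀
      exact ⟨R, hR.mono fun p hp c hc => hp.trans hc⟩
  exact ⟨R, fun l => ⟨(hR l).1, fun t ht => (hR l).2 t ht _ le_rfl⟩⟩

/-- A control that oscillates rapidly between finitely many values steers a surjective family of
maps `g(l, t, ·)` so that it follows `q(l, t)` on the average. -/
theorem exists_chattering {g : Λ × ℝ → V → Y} (hg : Continuous (Function.uncurry g))
    (hsurj : ∀ p, Function.Surjective (g p)) {q : Λ → ℝ → Y}
    (hq : Continuous (Function.uncurry q)) {ℓ : Λ → ℝ → V} (hℓ : Continuous (Function.uncurry ℓ))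
    {S : ℝ} (hS : 0 < S) :
    ∃ R : C(Λ, ℝ), ∀ a : C(Λ, ℝ), (∀ l, 0 < a l) →
      ∃ w p : Λ → ℝ → V, Continuous (Function.uncurry w) ∧ Continuous (Function.uncurry p) ∧
        ∀ l, w l 0 = ℓ l 0 ∧ w l S = ℓ l S ∧ ∀ t ∈ Icc 0 S,
          w l t = w l 0 + (∫ τ in (0 : ℝ)..t, p l τ) ∧ ‖w l t‖ ≤ R l ∧
          ‖∫ τ in (0 : ℝ)..t, (g (l, τ) (w l τ) - q l τ)‖ ≤ a l := by
  have hYc : CompleteSpace Y := FiniteDimensional.complete ℝ Y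
  have hVc : CompleteSpace V := FiniteDimensional.complete ℝ V
  have hVp : ProperSpace V := FiniteDimensional.proper ℝ V
  obtain ⟨W, hW, hWper, hWb, hWmean⟩ := exists_timeSharing hg hq hsurj
  obtain ⟨RW, hRW⟩ := exists_continuous_bound (Λ := Λ) (isCompact_Icc (a := 0) (b := S))
    (f := fun p => ⨆ x : ℝ × ℝ, ‖W x.1 p x.2‖) fun p₀ => by
      obtain ⟨R, hR⟩ := hWb p₀
      exact ⟨R, hR.mono fun p hp => ciSup_le fun x => hp x.1 x.2⟩
  have hRW' : ∀ l, ∀ t ∈ Icc 0 S, ∀ M θ, ‖W M (l, t) θ‖ ≤ RW l := fun l t ht M θ => by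
    obtain ⟨R, hR⟩ := hWb (l, t)
    exact (le_ciSup (f := fun x : ℝ × ℝ => ‖W x.1 (l, t) x.2‖)
      ⟨R, by rintro _ ⟨x, rfl⟩; exact hR.self_of_nhds x.1 x.2⟩ (M, θ)).trans ((hRW l).2 t ht)
  obtain ⟨Rℓ, hRℓ⟩ := exists_continuous_bound (Λ := Λ) (isCompact_Icc (a := 0) (b := S))
    (f := fun p => ‖ℓ p.1 p.2‖) fun p₀ =>
      ⟨‖ℓ p₀.1 p₀.2‖ + 1, (hℓ.norm.tendsto p₀).eventually_le_const (lt_add_one _)⟩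
  -- The bound is fixed before the tolerance `a`, which is possible because the curves `W` are
  -- bounded independently of the slope; the summand `1` is room for smoothing. The tolerance is
  -- split into quarters: inexact averages, oscillation, cutoff, smoothing.
  refine ⟨Rℓ + RW + 1, fun a ha => ?_⟩
  have hS1 : 0 < S + 1 := by linarith
  -- the averages are nearly exact
  obtain ⟨M, hM⟩ := exists_continuous_of_eventually_forall_ge_prod (Λ := Λ)
    (isCompact_Icc (a := (0 : ℝ)) (b := S))
    (Q := fun p M => ‖(∫ θ in (0 : ℝ)..1, g p (W M p θ)) - q p.1 p.2‖ ≤ a p.1 / (4 * (S + 1)))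
    fun p₀ => by
      obtain ⟨c, hc⟩ := hWmean p₀ (a p₀.1 / (4 * (S + 1)) / 2) (by have := ha p₀.1; positivity)
      have h1 : Continuous fun p : Λ × ℝ => a p.1 / (4 * (S + 1)) := by fun_prop
      have h2 : ∀ᶠ p in 𝓝 p₀, a p₀.1 / (4 * (S + 1)) / 2 ≤ a p.1 / (4 * (S + 1)) :=
        (h1.tendsto p₀).eventually_const_le (half_lt_self (by have := ha p₀.1; positivity))
      exact ⟨c, (hc.and h2).mono fun p hp M hM => (hp.1 M hM).trans hp.2⟩
  let U : Λ → ℝ → ℝ → V := fun l τ θ => W (M l) (l, τ) θ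
  have hU : Continuous fun x : Λ × ℝ × ℝ => U x.1 x.2.1 x.2.2 :=
    hW.comp (f := fun x : Λ × ℝ × ℝ => (M x.1, (x.1, x.2.1), x.2.2)) (by fun_prop)
  let G : Λ → ℝ → ℝ → Y := fun l τ θ => g (l, τ) (U l τ θ)
  have hG : Continuous fun x : Λ × ℝ × ℝ => G x.1 x.2.1 x.2.2 :=
    hg.comp (Continuous.prodMk (by fun_prop : Continuous fun x : Λ × ℝ × ℝ => (x.1, x.2.1)) hU)
  let A : Λ → ℝ → Y := fun l τ => ∫ θ in (0 : ℝ)..1, G l τ θ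
  have hA : Continuous (Function.uncurry A) :=
    intervalIntegral.continuous_parametric_intervalIntegral_of_continuous'
      (f := fun (x : Λ × ℝ) θ => G x.1 x.2 θ)
      (hG.comp (f := fun y : (Λ × ℝ) × ℝ => (y.1.1, y.1.2, y.2)) (by fun_prop)) 0 1
  have hGper : ∀ l τ, Function.Periodic (G l τ) 1 := fun l τ θ => by
    simp only [G, U]
    rw [hWper (M l) (l, τ) θ]
  have hGθ : ∀ l τ, Continuous (G l τ) := fun l τ =>
    hG.comp (f := fun θ : ℝ => (l, τ, θ)) (by fun_prop)
  have hw₁ : Continuous fun x : ℝ × Λ × ℝ => ℓ x.2.1 x.2.2 +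
      endCutoff S x.1 x.2.2 • (U x.2.1 x.2.2 (x.1 * x.2.2) - ℓ x.2.1 x.2.2) := by
    have h1 : Continuous fun x : ℝ × Λ × ℝ => ℓ x.2.1 x.2.2 := hℓ.comp continuous_snd
    have h2 : Continuous fun x : ℝ × Λ × ℝ => endCutoff S x.1 x.2.2 :=
      (continuous_endCutoff S).comp (f := fun x : ℝ × Λ × ℝ => (x.1, x.2.2)) (by fun_prop)
    have h3 : Continuous fun x : ℝ × Λ × ℝ => U x.2.1 x.2.2 (x.1 * x.2.2) :=
      hU.comp (f := fun x : ℝ × Λ × ℝ => (x.2.1, x.2.2, x.1 * x.2.2)) (by fun_prop)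
    exact h1.add (h2.smul (h3.sub h1))
  -- The cutoff forces the values of `ℓ` at both ends. As a convex combination, `w₁` obeys a bound
  -- independent of `ω`.
  let w₁ : ℝ → Λ → ℝ → V := fun ω l t => ℓ l t + endCutoff S ω t • (U l t (ω * t) - ℓ l t)
  have hw₁b : ∀ ω l, ∀ t ∈ Icc 0 S, ‖w₁ ω l t‖ ≤ Rℓ l + RW l := fun ω l t ht => by
    have h1 : w₁ ω l t = (1 - endCutoff S ω t) • ℓ l t + endCutoff S ω t • U l t (ω * t) := by
      simp only [w₁, smul_sub, sub_smul, one_smul]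
      abel
    rw [h1]
    refine (norm_add_le _ _).trans (add_le_add ?_ ?_)
    · rw [norm_smul, Real.norm_of_nonneg (by linarith [endCutoff_le_one S ω t])]
      exact (mul_le_of_le_one_left (norm_nonneg _) (by linarith [endCutoff_nonneg S ω t])).trans
        ((hRℓ l).2 t ht)
    · rw [norm_smul, Real.norm_of_nonneg (endCutoff_nonneg _ _ _)]
      exact (mul_le_of_le_one_left (norm_nonneg _) (endCutoff_le_one _ _ _)).trans
        (hRW' l t ht _ _)
  have hcont : ∀ {u : Λ → ℝ → V} (l : Λ), Continuous (u l) →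
      Continuous fun τ => g (l, τ) (u l τ) := fun l hu =>
    hg.comp (Continuous.prodMk (by fun_prop : Continuous fun τ : ℝ => (l, τ)) hu)
  have hw₁l : ∀ ω l, Continuous (w₁ ω l) := fun ω l =>
    hw₁.comp (f := fun t : ℝ => (ω, l, t)) (by fun_prop)
  have hUl : ∀ ω l, Continuous fun t => U l t (ω * t) := fun ω l =>
    hU.comp (f := fun t : ℝ => (l, t, ω * t)) (by fun_prop)
  have hAl : ∀ l, Continuous (A l) := fun l => hA.comp (continuous_const.prodMk continuous_id)
  have hql : ∀ l, Continuous (q l) := fun l => hq.comp (continuous_const.prodMk continuous_id)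
  -- the oscillation averages out, and the cutoff is negligible
  obtain ⟨ω, hω⟩ := exists_continuous_of_eventually_forall_ge (Λ := Λ)
    (Q := fun l ω => ∀ t ∈ Icc 0 S, ‖∫ τ in (0 : ℝ)..t, (G l τ (ω * τ) - A l τ)‖ ≤ a l / 4 ∧
      ‖∫ τ in (0 : ℝ)..t, (g (l, τ) (w₁ ω l τ) - G l τ (ω * τ))‖ ≤ a l / 4) fun l₀ => by
    obtain ⟨c, hc⟩ := eventually_norm_integral_oscillating_le
      (G := fun l τ θ => G l τ θ - A l τ)
      (hG.sub (hA.comp (f := fun x : Λ × ℝ × ℝ => (x.1, x.2.1)) (by fun_prop)))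
      (fun l τ θ => by simp only [hGper l τ θ])
      (fun l τ => by
        rw [intervalIntegral.integral_sub ((hGθ l τ).intervalIntegrable _ _)
          intervalIntegrable_const, intervalIntegral.integral_const]
        simp [A]) hS.le (η := a l₀ / 8) (by have := ha l₀; positivity) l₀
    have ha' : ∀ᶠ l in 𝓝 l₀, a l₀ / 2 ≤ a l :=
      (a.continuous.tendsto l₀).eventually_const_le (half_lt_self (ha l₀))
    have hR' : ∀ᶠ l in 𝓝 l₀, Rℓ l + RW l ≤ Rℓ l₀ + RW l₀ + 1 := by
      have h1 : Continuous fun l => Rℓ l + RW l := by fun_prop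
      exact (h1.tendsto l₀).eventually_le_const (lt_add_one _)
    set K := Icc 0 S ×ˢ Metric.closedBall (0 : V) (Rℓ l₀ + RW l₀ + 1)
    have hK : IsCompact K := isCompact_Icc.prod (isCompact_closedBall _ _)
    have hgK : Continuous fun x : Λ × ℝ × V => g (x.1, x.2.1) x.2.2 :=
      hg.comp (f := fun x : Λ × ℝ × V => ((x.1, x.2.1), x.2.2)) (by fun_prop)
    obtain ⟨C, hC⟩ := hK.exists_bound_of_continuousOn
      (hgK.comp (f := fun y : ℝ × V => (l₀, y.1, y.2)) (by fun_prop)).continuousOn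
    have hev : ∀ᶠ l in 𝓝 l₀, ∀ y ∈ K, ‖g (l, y.1) y.2‖ < |C| + 1 := by
      refine eventually_forall_lt hK (φ := fun l y => ‖g (l, y.1) y.2‖)
        (ψ := fun _ _ => |C| + 1) hgK.norm continuous_const fun y hy => ?_
      have : ‖g (l₀, y.1) y.2‖ ≤ C := hC y hy
      linarith [le_abs_self C]
    -- Two end layers of width `1 / ω`, with integrand at most `2 * (|C| + 1)`, cost `4 * (|C| + 1)
    -- / ω`. Since only `a l₀ / 2 ≤ a l` is known nearby, a cost below `a l / 4` requires the factor
    -- `32`.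
    refine ⟨max (max c 1) (32 * (|C| + 1) / a l₀), ?_⟩
    filter_upwards [hc, ha', hR', hev] with l h1 h2 h3 h4 ω hω t ht
    have hωc : c ≤ ω := (le_max_left _ _).trans ((le_max_left _ _).trans hω)
    have hω0 : 0 < ω := one_pos.trans_le ((le_max_right _ _).trans ((le_max_left _ _).trans hω))
    have hωC : 32 * (|C| + 1) / a l₀ ≤ ω := (le_max_right _ _).trans hω
    refine ⟨(h1 ω hωc t ht).trans (by linarith), ?_⟩
    refine (norm_integral_le_of_eq_zero_middle
      (f := fun τ => g (l, τ) (w₁ ω l τ) - G l τ (ω * τ)) (C := 2 * (|C| + 1)) (δ := 1 / ω)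
      ((hcont (u := w₁ ω) l (hw₁l ω l)).sub (hcont (u := fun l t => U l t (ω * t)) l (hUl ω l)))
      ht.1 (by positivity) (fun τ hτ => ?_) fun τ hτ => ?_).trans ?_
    · have hτ' : τ ∈ Icc 0 S := ⟨hτ.1, hτ.2.trans ht.2⟩
      refine (norm_sub_le _ _).trans ?_
      have h5 := h4 (τ, w₁ ω l τ) ⟨hτ', mem_closedBall_zero_iff.2 ((hw₁b ω l τ hτ').trans h3)⟩
      have h6 := h4 (τ, U l τ (ω * τ)) ⟨hτ', mem_closedBall_zero_iff.2
        ((hRW' l τ hτ' _ _).trans (by linarith [(hRℓ l).1]))⟩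
      simp only at h5 h6
      linarith
    · have hp : 0 < 1 / ω := by positivity
      have h5 : endCutoff S ω τ = 1 :=
        endCutoff_eq_one hω0 (by linarith [hτ.1]) (by linarith [hτ.2, ht.2])
      simp only [w₁, G, h5, one_smul, add_sub_cancel, sub_self]
    · rw [div_le_iff₀ (ha l₀)] at hωC
      rw [mul_one_div, div_le_iff₀ hω0]
      nlinarith
  let w₂ : Λ → ℝ → V := fun l t => w₁ (ω l) l t
  have hw₂ : Continuous (Function.uncurry w₂) :=
    hw₁.comp (f := fun x : Λ × ℝ => (ω x.1, x.1, x.2)) (by fun_prop)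
  have hw₂l : ∀ l, Continuous (w₂ l) := fun l => hw₁l (ω l) l
  have hw₂b : ∀ l, ∀ t ∈ Icc 0 S, ‖w₂ l t‖ ≤ Rℓ l + RW l := fun l => hw₁b (ω l) l
  have hw₂int : ∀ l, ∀ t ∈ Icc 0 S,
      ‖∫ τ in (0 : ℝ)..t, (g (l, τ) (w₂ l τ) - q l τ)‖ ≤ 3 * a l / 4 := by
    intro l t ht
    obtain ⟨h1, h2⟩ := (hω l).2 _ le_rfl t ht
    have h3 : ‖∫ τ in (0 : ℝ)..t, (A l τ - q l τ)‖ ≤ a l / 4 := by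
      refine (intervalIntegral.norm_integral_le_of_norm_le_const
        (C := a l / (4 * (S + 1))) fun τ hτ => ?_).trans ?_
      · rw [uIoc_of_le ht.1] at hτ
        exact (hM l).2 τ ⟨hτ.1.le, hτ.2.trans ht.2⟩ _ le_rfl
      · rw [sub_zero, abs_of_nonneg ht.1, div_mul_eq_mul_div,
          div_le_div_iff₀ (by positivity) (by norm_num)]
        nlinarith [ht.2, ha l]
    have c1 := hcont (u := w₂) l (hw₂l l)
    have c2 := hcont (u := fun l t => U l t (ω l * t)) l (hUl (ω l) l)
    have h4 := integral_sub_add_integral_sub c1 c2 (hql l) 0 t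
    have h5 := integral_sub_add_integral_sub c2 (hAl l) (hql l) 0 t
    rw [h4, h5, ← add_assoc]
    refine (norm_add₃_le).trans ?_
    linarith
  -- smoothing
  obtain ⟨η, hη⟩ := exists_continuous_of_eventually_forall_ge (Λ := Λ)
    (Q := fun l η => ∀ τ ∈ Icc 0 S, ∀ w : V, ‖w‖ ≤ Rℓ l + RW l → ∀ s : V, ‖s‖ ≤ 1 / η →
      ‖g (l, τ) (w + s) - g (l, τ) w‖ ≤ a l / (4 * (S + 1))) fun l₀ => by
    set K := Icc 0 S ×ˢ Metric.closedBall (0 : V) (Rℓ l₀ + RW l₀ + 1)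
    have hK : IsCompact K := isCompact_Icc.prod (isCompact_closedBall _ _)
    have hR' : ∀ᶠ l in 𝓝 l₀, Rℓ l + RW l ≤ Rℓ l₀ + RW l₀ + 1 := by
      have h1 : Continuous fun l => Rℓ l + RW l := by fun_prop
      exact (h1.tendsto l₀).eventually_le_const (lt_add_one _)
    have hev : ∀ᶠ x in 𝓝 (l₀, (0 : V)), ∀ y ∈ K,
        ‖g (x.1, y.1) (y.2 + x.2) - g (x.1, y.1) y.2‖ < a x.1 / (4 * (S + 1)) := by
      refine eventually_forall_lt hK
        (φ := fun (x : Λ × V) (y : ℝ × V) => ‖g (x.1, y.1) (y.2 + x.2) - g (x.1, y.1) y.2‖)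
        (ψ := fun (x : Λ × V) _ => a x.1 / (4 * (S + 1))) ?_ (by fun_prop) fun y _ => ?_
      · exact ((hg.comp (f := fun z : (Λ × V) × ℝ × V => ((z.1.1, z.2.1), z.2.2 + z.1.2))
          (by fun_prop)).sub (hg.comp (f := fun z : (Λ × V) × ℝ × V => ((z.1.1, z.2.1), z.2.2))
          (by fun_prop))).norm
      · have := ha l₀
        simp only [add_zero, sub_self, norm_zero]
        positivity
    rw [nhds_prod_eq] at hev
    obtain ⟨p₁, hp₁, p₂, hp₂, h⟩ := eventually_prod_iff.1 hev
    obtain ⟨δ, hδ, hδ'⟩ := Metric.eventually_nhds_iff.1 hp₂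
    refine ⟨2 / δ, ?_⟩
    filter_upwards [hp₁, hR'] with l h1 h2 η hη τ hτ w hw s hs
    have hη0 : 0 < η := lt_of_lt_of_le (by positivity) hη
    have h3 : 1 / η < δ := by
      rw [ge_iff_le, div_le_iff₀ hδ] at hη
      rw [div_lt_iff₀ hη0]
      linarith
    exact (h h1 (hδ' (by rw [dist_zero_right]; exact hs.trans_lt h3)) (τ, w)
      ⟨hτ, mem_closedBall_zero_iff.2 (hw.trans h2)⟩).le
  have hηpos : ∀ l, 0 < min (1 / η l) 1 := fun l => lt_min (one_div_pos.2 (hη l).1) one_pos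
  -- The velocity `p` becomes the target for the next block. The bound `1 / η l` limits the effect
  -- of smoothing on `g`, the bound `1` its effect on the norm.
  obtain ⟨p, hp, hpS, hpη⟩ := exists_smoothing hw₂ hS (η := fun l => min (1 / η l) 1)
    ((continuous_const.div η.continuous fun l => (hη l).1.ne').min continuous_const) hηpos
  let w : Λ → ℝ → V := fun l t => w₂ l 0 + ∫ τ in (0 : ℝ)..t, p l τ
  have hw : Continuous (Function.uncurry w) := by
    refine (hw₂.comp (f := fun x : Λ × ℝ => (x.1, (0 : ℝ))) (by fun_prop)).add ?_
    exact intervalIntegral.continuous_parametric_intervalIntegral_of_continuous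
      (f := fun (x : Λ × ℝ) τ => p x.1 τ)
      (hp.comp (f := fun y : (Λ × ℝ) × ℝ => (y.1.1, y.2)) (by fun_prop)) continuous_snd
  have hwl : ∀ l, Continuous (w l) := fun l => hw.comp (continuous_const.prodMk continuous_id)
  have hw0 : ∀ l, w l 0 = w₂ l 0 := fun l => by simp [w]
  refine ⟨w, p, hw, hp, fun l => ⟨?_, ?_, fun t ht => ⟨?_, ?_, ?_⟩⟩⟩
  · rw [hw0]
    simp [w₂, w₁, endCutoff_zero hS.le]
  · simp only [w, hpS]
    simp [w₂, w₁, endCutoff_right hS.le]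
  · rw [hw0]
  · have h1 := hpη l t ht
    have h2 := norm_add_le (w₂ l t) (w l t - w₂ l t)
    rw [add_sub_cancel] at h2
    have h3 : ‖w l t - w₂ l t‖ ≤ 1 := h1.trans (min_le_right _ _)
    simp only [ContinuousMap.add_apply, ContinuousMap.one_apply]
    linarith [hw₂b l t ht]
  · have c1 := hcont (u := w) l (hwl l)
    have c2 := hcont (u := w₂) l (hw₂l l)
    have h1 := integral_sub_add_integral_sub c1 c2 (hql l) 0 t
    have h2 : ‖∫ τ in (0 : ℝ)..t, (g (l, τ) (w l τ) - g (l, τ) (w₂ l τ))‖ ≤ a l / 4 := by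
      refine (intervalIntegral.norm_integral_le_of_norm_le_const
        (C := a l / (4 * (S + 1))) fun τ hτ => ?_).trans ?_
      · rw [uIoc_of_le ht.1] at hτ
        have hτ' : τ ∈ Icc 0 S := ⟨hτ.1.le, hτ.2.trans ht.2⟩
        have := (hη l).2 _ le_rfl τ hτ' (w₂ l τ) (hw₂b l τ hτ') (w l τ - w₂ l τ)
          ((hpη l τ hτ').trans (min_le_left _ _))
        rwa [add_sub_cancel] at this
      · rw [sub_zero, abs_of_nonneg ht.1, div_mul_eq_mul_div,
          div_le_div_iff₀ (by positivity) (by norm_num)]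
        nlinarith [ht.2, ha l]
    rw [h1]
    refine (norm_add_le _ _).trans ?_
    linarith [hw₂int l t ht]

end Chattering

end TriangularControl

/-! ### Approximate steering, one block at a time. -/

namespace TriangularControl

variable {ν : ℕ} {m : Fin (ν + 1) → ℕ}

/-- The space of all blocks `(x_1, …, x_ν, x_{ν+1})`, the control `u = x_{ν+1}` included. -/
abbrev Ext (m : Fin (ν + 1) → ℕ) : Type := (j : Fin (ν + 1)) → Vec (m j)

/-- The right-hand side of triangular form as a function of all blocks. -/
def extField (F : Components m) (t : ℝ) (z : Ext m) : State m :=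
  fun i => F i t (fun j => z j.1.castSucc) (z i.succ)

lemma extField_congr (F : Components m) (t : ℝ) {z z' : Ext m} {i : Fin ν}
    (h : ∀ j ≤ i.succ, z j = z' j) : extField F t z i = extField F t z' i := by
  unfold extField
  rw [h _ le_rfl]
  congr 1
  funext j
  exact h _ ((Fin.castSucc_le_castSucc_iff.2 j.2).trans i.castSucc_lt_succ.le)

/-- The components `f_1, …, f_k` of the right-hand side; the other blocks do not move. -/
def maskField (F : Components m) (k : Fin ν) (t : ℝ) (z : Ext m) : Ext m :=
  Fin.snoc (α := fun j => Vec (m j)) (fun i : Fin ν => if i ≤ k then extField F t z i else 0) 0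

lemma maskField_castSucc (F : Components m) (k : Fin ν) (t : ℝ) (z : Ext m) (i : Fin ν) :
    maskField F k t z i.castSucc = if i ≤ k then extField F t z i else 0 :=
  Fin.snoc_castSucc (α := fun j => Vec (m j)) _ _ _

lemma maskField_of_lt (F : Components m) {k : Fin ν} (t : ℝ) (z : Ext m) {j : Fin (ν + 1)}
    (hj : k.castSucc < j) : maskField F k t z j = 0 := by
  induction j using Fin.lastCases with
  | last => exact Fin.snoc_last (α := fun j => Vec (m j)) _ _
  | cast i => rw [maskField_castSucc, if_neg (not_le.2 (Fin.castSucc_lt_castSucc_iff.1 hj))]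

lemma continuous_maskField {F : Components m} (hF : Continuous (Function.uncurry (extField F)))
    (k : Fin ν) : Continuous (Function.uncurry (maskField F k)) := by
  refine continuous_pi fun j => ?_
  induction j using Fin.lastCases with
  | last =>
    simp only [Function.uncurry_def, maskField_of_lt F _ _ (Fin.castSucc_lt_last k)]
    exact continuous_const
  | cast i =>
    simp only [Function.uncurry_def, maskField_castSucc]
    split_ifs
    · exact (continuous_apply i).comp hF
    · exact continuous_const

lemma lipschitzOnBalls_maskField {F : Components m} {S : ℝ}
    (hF : LipschitzOnBalls (extField F) S) (k : Fin ν) : LipschitzOnBalls (maskField F k) S := by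
  intro R
  obtain ⟨L, hL⟩ := hF R
  refine ⟨L, fun t ht x y hx hy => ?_⟩
  refine le_trans ?_ (hL t ht x y hx hy)
  refine (pi_norm_le_iff_of_nonneg (norm_nonneg _)).2 fun j => ?_
  induction j using Fin.lastCases with
  | last => simp [maskField_of_lt F _ _ (Fin.castSucc_lt_last k)]
  | cast i =>
    rw [Pi.sub_apply, maskField_castSucc, maskField_castSucc]
    split_ifs
    · exact norm_le_pi_norm (extField F t x - extField F t y) i
    · simp

lemma integral_pi_apply {ι : Type*} [Fintype ι] {E : ι → Type*} [∀ i, NormedAddCommGroup (E i)]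
    [∀ i, NormedSpace ℝ (E i)] [∀ i, CompleteSpace (E i)] {f : ℝ → (i : ι) → E i}
    (hf : Continuous f) (a b : ℝ) (i : ι) : (∫ τ in a..b, f τ) i = ∫ τ in a..b, f τ i :=
  ((ContinuousLinearMap.proj (R := ℝ) (φ := E) i).intervalIntegral_comp_comm
    (hf.intervalIntegrable a b)).symm

section Steering

variable {Λ : Type*} [MetricSpace Λ]

/-- Families of curves that start at `z₀`, end near `zS`, and whose blocks before the `k`-th one
follow the triangular system. -/
structure SteeredUpTo (F : Components m) (S : ℝ) (z₀ : Λ → Ext m) (zS : Ext m) (ε : ℝ) (k : ℕ)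
    (Z : Λ → ℝ → Ext m) : Prop where
  continuous : Continuous (Function.uncurry Z)
  start : ∀ l, Z l 0 = z₀ l
  solves : ∀ l, ∀ i : Fin ν, i.val < k → ∀ t ∈ Icc 0 S,
    Z l t i.castSucc = z₀ l i.castSucc + ∫ τ in (0 : ℝ)..t, extField F τ (Z l τ) i
  primitive : ∀ j : Fin (ν + 1), j.val = k → ∃ q : Λ → ℝ → Vec (m j),
    Continuous (Function.uncurry q) ∧
    ∀ l, ∀ t ∈ Icc 0 S, Z l t j = z₀ l j + ∫ τ in (0 : ℝ)..t, q l τ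
  terminal : ∀ l, ∀ j : Fin (ν + 1), k ≤ j.val → Z l S j = zS j
  near : ∀ l, ‖Z l S - zS‖ ≤ ε

/-- Straight segments suffice, since no equation is imposed yet. -/
lemma exists_steeredUpTo_zero (F : Components m) {S : ℝ} (hS : 0 < S) {z₀ : Λ → Ext m}
    (hz₀ : Continuous z₀) (zS : Ext m) {ε : ℝ} (hε : 0 ≤ ε) :
    ∃ Z, SteeredUpTo F S z₀ zS ε 0 Z := by
  have hend : ∀ l, z₀ l + (S / S) • (zS - z₀ l) = zS := fun l => by
    rw [div_self hS.ne', one_smul, add_sub_cancel]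
  refine ⟨fun l t => z₀ l + (t / S) • (zS - z₀ l), ?_, fun l => by simp, fun l i hi => by
    simp at hi, fun j hj => ⟨fun l _ => S⁻¹ • (zS j - z₀ l j), ?_, fun l t ht => ?_⟩,
    fun l j _ => ?_, fun l => ?_⟩
  · simp only [Function.uncurry_def]
    fun_prop
  · simp only [Function.uncurry_def]
    fun_prop
  · rw [intervalIntegral.integral_const, sub_zero, smul_smul]
    rfl
  · exact congrFun (hend l) j
  · simp only [hend, sub_self, norm_zero, hε]

/-- The velocity `q` of block `κ` is arbitrary so far. A chattering `w` in the following block makes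
component `κ` of the field equal to `q` on the average, so `Z` with that block replaced by `w`
solves the masked system up to a small defect, and a true solution lies within `δ`. The masked
system leaves the blocks after `κ` as given; hence they keep their exact terminal values, and the
end point moves by at most `δ`. -/
theorem SteeredUpTo.exists_succ [SecondCountableTopology Λ] {F : Components m}
    (hF : Continuous (Function.uncurry (extField F))) {S : ℝ} (hS : 0 < S)
    (hlip : LipschitzOnBalls (extField F) S) (hsurj : ∀ i t y, Function.Surjective (F i t y))
    {z₀ : Λ → Ext m} {zS : Ext m} {ε δ : ℝ} (hδ : 0 < δ) {κ : Fin ν} {Z : Λ → ℝ → Ext m}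
    (hZ : SteeredUpTo F S z₀ zS ε κ.val Z) :
    ∃ Z', SteeredUpTo F S z₀ zS (ε + δ) (κ.val + 1) Z' := by
  have hZc := hZ.continuous
  have hZl : ∀ l, Continuous (Z l) := fun l => hZc.comp (continuous_const.prodMk continuous_id)
  obtain ⟨q, hq, hZq⟩ := hZ.primitive κ.castSucc rfl
  have hql : ∀ l, Continuous (q l) := fun l => hq.comp (continuous_const.prodMk continuous_id)
  have hz₀ : Continuous z₀ := by
    have : z₀ = fun l => Z l 0 := funext fun l => (hZ.start l).symm
    rw [this]
    exact hZc.comp (f := fun l : Λ => (l, (0 : ℝ))) (by fun_prop)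
  have hκ : κ.castSucc < κ.succ := Fin.castSucc_lt_succ
  let g : Λ × ℝ → Vec (m κ.succ) → Vec (m κ.castSucc) := fun p w =>
    extField F p.2 (Function.update (Z p.1 p.2) κ.succ w) κ
  have hg : Continuous (Function.uncurry g) := by
    have h1 : Continuous fun x : (Λ × ℝ) × Vec (m κ.succ) =>
        Function.update (Z x.1.1 x.1.2) κ.succ x.2 :=
      (hZc.comp continuous_fst).update κ.succ continuous_snd
    exact (continuous_apply κ).comp (hF.comp (f := fun x : (Λ × ℝ) × Vec (m κ.succ) =>
      (x.1.2, Function.update (Z x.1.1 x.1.2) κ.succ x.2)) (by fun_prop))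
  have hgF : ∀ p w, g p w = F κ p.2 (fun j => Z p.1 p.2 j.1.castSucc) w := fun p w => by
    simp only [g, extField, Function.update_self]
    congr 1
    funext j
    exact Function.update_of_ne
      ((Fin.castSucc_le_castSucc_iff.2 j.2).trans_lt hκ).ne _ _
  have hgs : ∀ p, Function.Surjective (g p) := fun p => by
    rw [funext (hgF p)]
    exact hsurj _ _ _
  have hℓ : Continuous (Function.uncurry fun l t => Z l t κ.succ) :=
    (continuous_apply κ.succ).comp hZc
  obtain ⟨R, hR⟩ := exists_chattering hg hgs hq hℓ hS
  obtain ⟨RZ, hRZ⟩ := exists_continuous_bound (Λ := Λ) (isCompact_Icc (a := 0) (b := S))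
    (f := fun p => ‖Z p.1 p.2‖) fun p₀ =>
      ⟨‖Z p₀.1 p₀.2‖ + 1, (hZc.norm.tendsto p₀).eventually_le_const (lt_add_one _)⟩
  set H := maskField F κ
  have hH : Continuous (Function.uncurry H) := continuous_maskField hF κ
  have hHlip : LipschitzOnBalls H S := lipschitzOnBalls_maskField hlip κ
  -- The shadowing tolerance as a continuous function `1 / b`. It relies on the bound `R l + RZ l`,
  -- which is known before `w` is chosen.
  obtain ⟨b, hb⟩ := exists_continuous_of_eventually_forall_ge (Λ := Λ)
    (Q := fun l b => ∀ ρ c : ℝ → Ext m, Continuous ρ → Continuous c →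
      (∀ t ∈ Icc 0 S, ‖ρ t‖ ≤ R l + RZ l) →
      (∀ t ∈ Icc 0 S, ‖c t + (∫ τ in (0 : ℝ)..t, H τ (ρ τ)) - ρ t‖ ≤ 1 / b) →
      ∃ y : ℝ → Ext m, Continuous y ∧ SolvesVolterra H S c y ∧ ∀ t ∈ Icc 0 S, ‖y t - ρ t‖ ≤ δ)
    fun l₀ => by
      obtain ⟨a, ha, h⟩ := hHlip.exists_tolerance hH hS.le (R l₀ + RZ l₀ + 1) hδ
      have h1 : Continuous fun l => R l + RZ l := by fun_prop
      refine ⟨1 / a, ((h1.tendsto l₀).eventually_le_const (lt_add_one _)).mono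
        fun l hl b hb ρ c hρ hc hρR hres => h ρ c hρ hc (fun t ht => (hρR t ht).trans hl)
          fun t ht => (hres t ht).trans ?_⟩
      rw [one_div_le _ ha]
      · exact hb
      · exact (one_div_pos.2 ha).trans_le hb
  obtain ⟨w, p, hw, hp, hwp⟩ := hR ⟨fun l => 1 / b l,
    continuous_const.div b.continuous fun l => (hb l).1.ne'⟩ fun l => one_div_pos.2 (hb l).1
  let ρ : Λ → ℝ → Ext m := fun l t => Function.update (Z l t) κ.succ (w l t)
  have hρ : Continuous (Function.uncurry ρ) := hZc.update κ.succ hw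
  have hρl : ∀ l, Continuous (ρ l) := fun l => hρ.comp (continuous_const.prodMk continuous_id)
  -- Blocks up to `κ` carry their initial values; later blocks enter as prescribed functions of
  -- time.
  let c : Λ → ℝ → Ext m := fun l t j => if j ≤ κ.castSucc then z₀ l j else ρ l t j
  have hc : Continuous (Function.uncurry c) := by
    refine continuous_pi fun j => ?_
    simp only [c, Function.uncurry_def]
    split_ifs
    · fun_prop
    · exact (continuous_apply j).comp hρ
  have hcl : ∀ l, Continuous (c l) := fun l => hc.comp (continuous_const.prodMk continuous_id)
  have hρR : ∀ l, ∀ t ∈ Icc 0 S, ‖ρ l t‖ ≤ R l + RZ l := by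
    intro l t ht
    have h1 := (hRZ l).2 t ht
    have h2 := ((hwp l).2.2 t ht).2.1
    refine (pi_norm_le_iff_of_nonneg (add_nonneg ((norm_nonneg _).trans h2)
      (hRZ l).1.le)).2 fun j => ?_
    rcases eq_or_ne j κ.succ with rfl | hj
    · simp only [ρ, Function.update_self]
      linarith [(hRZ l).1]
    · simp only [ρ, Function.update_of_ne hj]
      linarith [norm_le_pi_norm (Z l t) j, (norm_nonneg _).trans h2]
  have hHρ : ∀ {y : ℝ → Ext m}, Continuous y → Continuous fun τ => H τ (y τ) := fun hy =>
    hH.comp (continuous_id.prodMk hy)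
  have hres : ∀ l, ∀ t ∈ Icc 0 S,
      ‖c l t + (∫ τ in (0 : ℝ)..t, H τ (ρ l τ)) - ρ l t‖ ≤ 1 / b l := by
    intro l t ht
    have hb0 : 0 ≤ 1 / b l := (one_div_pos.2 (hb l).1).le
    refine (pi_norm_le_iff_of_nonneg hb0).2 fun j => ?_
    rw [Pi.sub_apply, Pi.add_apply, integral_pi_apply (hHρ (hρl l))]
    rcases lt_or_ge κ.castSucc j with hj | hj
    · simp only [H, maskField_of_lt F _ _ hj, intervalIntegral.integral_zero, add_zero, c,
        if_neg (not_le.2 hj), sub_self, norm_zero, hb0]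
    obtain ⟨i, rfl⟩ : ∃ i : Fin ν, i.castSucc = j :=
      ⟨_, Fin.castSucc_castPred j (hj.trans_lt (Fin.castSucc_lt_last κ)).ne⟩
    have hi : i ≤ κ := Fin.castSucc_le_castSucc_iff.1 hj
    have hρi : ρ l t i.castSucc = Z l t i.castSucc :=
      Function.update_of_ne (hj.trans_lt hκ).ne _ _
    simp only [H, maskField_castSucc, if_pos hi, c, if_pos hj, hρi]
    -- Block `κ` has the averaging error as its defect; earlier blocks have none, because their
    -- components do not see the replaced block.
    rcases hi.eq_or_lt with rfl | hi'
    · have h1 := ((hwp l).2.2 t ht).2.2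
      have hgw : Continuous fun τ => g (l, τ) (w l τ) := hg.comp (f := fun τ => ((l, τ), w l τ))
        (Continuous.prodMk (by fun_prop) (hw.comp (continuous_const.prodMk continuous_id)))
      rw [intervalIntegral.integral_sub (hgw.intervalIntegrable _ _)
        ((hql l).intervalIntegrable _ _)] at h1
      rw [hZq l t ht, add_sub_add_left_eq_sub]
      exact h1
    · have h1 : ∀ τ, extField F τ (ρ l τ) i = extField F τ (Z l τ) i := fun τ =>
        extField_congr F τ fun j hj => Function.update_of_ne
          (hj.trans_lt (Fin.succ_lt_succ_iff.2 hi')).ne _ _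
      simp only [h1]
      rw [← hZ.solves l i hi' t ht, sub_self, norm_zero]
      exact hb0
  choose y hy hys hyρ using fun l =>
    (hb l).2 _ le_rfl (ρ l) (c l) (hρl l) (hcl l) (hρR l) (hres l)
  have hylast : ∀ l, ∀ t ∈ Icc 0 S, ∀ j, κ.castSucc < j → y l t j = ρ l t j := by
    intro l t ht j hj
    rw [hys l t ht, Pi.add_apply, integral_pi_apply (hHρ (hy l))]
    simp only [H, maskField_of_lt F _ _ hj, intervalIntegral.integral_zero, add_zero, c,
      if_neg (not_le.2 hj)]
  let Z' : Λ → ℝ → Ext m := fun l t => y l (projIcc 0 S hS.le t)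
  have hZ'y : ∀ l, ∀ t ∈ Icc 0 S, Z' l t = y l t := fun l t ht => by
    simp only [Z', projIcc_of_mem hS.le ht]
  have hρ0 : ∀ l, ρ l 0 = Z l 0 := fun l => by
    simp only [ρ]
    rw [(hwp l).1]
    exact Function.update_eq_self _ _
  have hρS : ∀ l, ρ l S = Z l S := fun l => by
    simp only [ρ]
    rw [(hwp l).2.1]
    exact Function.update_eq_self _ _
  have h0 : (0 : ℝ) ∈ Icc 0 S := left_mem_Icc.2 hS.le
  have hS' : S ∈ Icc 0 S := right_mem_Icc.2 hS.le
  refine ⟨Z', continuous_solvesVolterra hH hS.le hHlip hc hy hys, fun l => ?_,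
    fun l i hi t ht => ?_, fun j hj => ?_, fun l j hj => ?_, fun l => ?_⟩
  · rw [hZ'y l 0 h0, hys l 0 h0, intervalIntegral.integral_same, add_zero]
    funext j
    simp only [c]
    split_ifs
    · rfl
    · rw [hρ0, hZ.start]
  · have hi' : i ≤ κ := Fin.le_def.2 (Nat.lt_succ_iff.1 hi)
    have h1 : ∫ τ in (0 : ℝ)..t, extField F τ (Z' l τ) i
        = ∫ τ in (0 : ℝ)..t, extField F τ (y l τ) i := by
      refine intervalIntegral.integral_congr fun τ hτ => ?_
      rw [uIcc_of_le ht.1] at hτ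
      simp only [hZ'y l τ ⟨hτ.1, hτ.2.trans ht.2⟩]
    rw [h1, hZ'y l t ht]
    conv_lhs => rw [hys l t ht, Pi.add_apply, integral_pi_apply (hHρ (hy l))]
    simp only [H, maskField_castSucc, if_pos hi', c,
      if_pos (Fin.castSucc_le_castSucc_iff.2 hi')]
  · obtain rfl : j = κ.succ := Fin.ext hj
    refine ⟨p, hp, fun l t ht => ?_⟩
    have hw0 : w l 0 = z₀ l κ.succ := by rw [(hwp l).1, hZ.start]
    rw [hZ'y l t ht, hylast l t ht _ hκ, ← hw0, ← ((hwp l).2.2 t ht).1]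
    exact Function.update_self _ _ _
  · have hj' : κ.castSucc < j := Fin.lt_def.2 (Nat.lt_of_succ_le hj)
    rw [hZ'y l S hS', hylast l S hS' j hj', hρS]
    exact hZ.terminal l j (Nat.le_of_succ_le hj)
  · rw [hZ'y l S hS']
    have h1 := hyρ l S hS'
    rw [hρS] at h1
    have h2 := norm_add_le (y l S - Z l S) (Z l S - zS)
    rw [sub_add_sub_cancel] at h2
    linarith [hZ.near l]

/-- Approximate steering to a fixed state, with prescribed values of the control at both ends,
by controls depending continuously on a parameter. -/
theorem exists_approximate_steering [SecondCountableTopology Λ] {F : Components m}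
    (hF : Continuous (Function.uncurry (extField F))) {S : ℝ} (hS : 0 < S)
    (hlip : LipschitzOnBalls (extField F) S) (hsurj : ∀ i t y, Function.Surjective (F i t y))
    {z₀ : Λ → Ext m} (hz₀ : Continuous z₀) (zS : Ext m) {ε : ℝ} (hε : 0 < ε) :
    ∃ Z, SteeredUpTo F S z₀ zS ε ν Z := by
  have key : ∀ k ≤ ν, ∀ ε > 0, ∃ Z, SteeredUpTo F S z₀ zS ε k Z := by
    intro k
    induction k with
    | zero => exact fun _ ε hε => exists_steeredUpTo_zero F hS hz₀ zS (le_of_lt hε)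
    | succ k ih =>
      intro hk ε hε
      obtain ⟨Z, hZ⟩ := ih (Nat.le_of_succ_le hk) (ε / 2) (half_pos hε)
      obtain ⟨Z', hZ'⟩ := SteeredUpTo.exists_succ hF hS hlip hsurj (half_pos hε)
        (κ := ⟨k, hk⟩) hZ
      exact ⟨Z', by rwa [add_halves] at hZ'⟩
  exact key ν le_rfl ε hε

end Steering

end TriangularControl

namespace TriangularControl

/-! ### Linear control systems: controllability by duality. -/

section Linear

variable {E : Type*} [NormedAddCommGroup E] [NormedSpace ℝ E]

omit [NormedSpace ℝ E] in
lemma exists_pos_bound_norm {f : ℝ → E} (hf : Continuous f) (S : ℝ) :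
    ∃ L > 0, ∀ t ∈ Icc 0 S, ‖f t‖ ≤ L := by
  obtain ⟨L, hL⟩ := (isCompact_Icc (a := (0 : ℝ)) (b := S)).exists_bound_of_continuousOn
    hf.continuousOn
  exact ⟨max L 1, lt_max_of_lt_right one_pos, fun t ht => (hL t ht).trans (le_max_left _ _)⟩

lemma continuous_uncurry_apply {A : ℝ → E →L[ℝ] E} (hA : Continuous A) :
    Continuous (Function.uncurry fun t x => A t x) :=
  (hA.comp continuous_fst).clm_apply continuous_snd

lemma lipschitzOnBalls_apply {A : ℝ → E →L[ℝ] E} (hA : Continuous A) (S : ℝ) :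
    LipschitzOnBalls (fun t x => A t x) S := by
  obtain ⟨L, -, hL⟩ := exists_pos_bound_norm hA S
  refine fun _ => ⟨L, fun t ht x y _ _ => ?_⟩
  rw [← map_sub]
  exact (A t).le_of_opNorm_le (hL t ht) _

lemma exists_linear_solvesVolterra [CompleteSpace E] {A : ℝ → E →L[ℝ] E} (hA : Continuous A)
    {S : ℝ} (hS : 0 ≤ S) {h : ℝ → E} (hh : Continuous h) :
    ∃ ξ : ℝ → E, Continuous ξ ∧ SolvesVolterra (fun t x => A t x) S h ξ := by
  obtain ⟨L, hL0, hL⟩ := exists_pos_bound_norm hA S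
  obtain ⟨a, -, ha⟩ := exists_pos_bound_norm hh S
  obtain ⟨ξ, hξ, hξs, -⟩ := exists_solvesVolterra (continuous_uncurry_apply hA) hS
    (ρ := fun _ => 0) continuous_const hh (a := a) hL0 (fun t ht x y _ _ => by
      rw [← map_sub]
      exact (A t).le_of_opNorm_le (hL t ht) _) (fun t ht => by simpa using ha t ht) le_rfl
  exact ⟨ξ, hξ, hξs⟩

lemma eqOn_zero_of_integral_eq_zero {h : ℝ → ℝ} (hh : Continuous h) {δ : ℝ} (hδ : 0 < δ)
    (h0 : ∀ t ∈ Icc 0 δ, ∫ τ in t..δ, h τ = 0) : ∀ t ∈ Icc 0 δ, h t = 0 := by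
  intro t ht
  have h1 : HasDerivWithinAt (fun s => ∫ τ in s..δ, h τ) (-h t) (Icc 0 δ) t :=
    (intervalIntegral.integral_hasDerivAt_left (hh.intervalIntegrable _ _)
      hh.stronglyMeasurable.stronglyMeasurableAtFilter hh.continuousAt).hasDerivWithinAt
  have h2 : HasDerivWithinAt (fun s => ∫ τ in s..δ, h τ) 0 (Icc 0 δ) t :=
    (hasDerivWithinAt_const t _ (0 : ℝ)).congr h0 (h0 t ht)
  have h3 := (uniqueDiffOn_Icc hδ t ht).eq_deriv _ h1 h2
  linarith

variable {X U : Type*} [NormedAddCommGroup X] [NormedSpace ℝ X] [FiniteDimensional ℝ X]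
  [NormedAddCommGroup U] [NormedSpace ℝ U]

omit [FiniteDimensional ℝ X] in
lemma continuous_smulRight (p : X →L[ℝ] ℝ) {w : ℝ → U} (hw : Continuous w) :
    Continuous fun t => p.smulRight (w t) :=
  (ContinuousLinearMap.smulRightL ℝ X U p).continuous.comp hw

-- The substitution `t ↦ δ - t` turns the terminal value problem into a forward linear Volterra
-- equation in the dual space.
omit [FiniteDimensional ℝ X] in
lemma exists_adjoint_solution {A : ℝ → X →L[ℝ] X} (hA : Continuous A) {δ : ℝ} (hδ : 0 ≤ δ)
    (p : X →L[ℝ] ℝ) : ∃ η : ℝ → X →L[ℝ] ℝ, Continuous η ∧ η δ = p ∧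
      ∀ t ∈ Icc 0 δ, η t = p + ∫ τ in t..δ, (η τ).comp (A τ) := by
  have hA' : Continuous fun s => (ContinuousLinearMap.compL ℝ X X ℝ).flip (A (δ - s)) :=
    (ContinuousLinearMap.continuous _).comp (hA.comp (continuous_const.sub continuous_id))
  obtain ⟨ζ, hζ, hζs⟩ := exists_linear_solvesVolterra hA' hδ (h := fun _ => p) continuous_const
  refine ⟨fun t => ζ (δ - t), hζ.comp (continuous_const.sub continuous_id), ?_, fun t ht => ?_⟩
  · have := hζs 0 (left_mem_Icc.2 hδ)
    simpa using this
  · have h1 := hζs (δ - t) ⟨by linarith [ht.2], by linarith [ht.1]⟩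
    have h2 := intervalIntegral.integral_comp_sub_left (a := t) (b := δ)
      (fun τ => (ζ τ).comp (A (δ - τ))) δ
    simp only [sub_sub_cancel, sub_self] at h2
    rw [h2]
    exact h1

/-- A linear control system is controllable if it is observable in the dual sense. -/
theorem exists_linear_steering {A : ℝ → X →L[ℝ] X} (hA : Continuous A) {B : ℝ → U →L[ℝ] X}
    (hB : Continuous B) {δ : ℝ} (hδ : 0 < δ)
    (hobs : ∀ η : ℝ → X →L[ℝ] ℝ, Continuous η →
      (∀ t ∈ Icc 0 δ, η t = η δ + ∫ τ in t..δ, (η τ).comp (A τ)) →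
      (∀ t ∈ Icc 0 δ, (η t).comp (B t) = 0) → η δ = 0) (z : X) :
    ∃ (v : ℝ → U) (ξ : ℝ → X), Continuous v ∧ Continuous ξ ∧
      SolvesVolterra (fun t x => A t x) δ (fun t => ∫ τ in (0 : ℝ)..t, B τ (v τ)) ξ ∧ ξ δ = z := by
  have hX : CompleteSpace X := FiniteDimensional.complete ℝ X
  have hBv : ∀ {v : ℝ → U}, Continuous v → Continuous fun τ => B τ (v τ) := fun hv =>
    hB.clm_apply hv
  have hAx : ∀ {x : ℝ → X}, Continuous x → Continuous fun τ => A τ (x τ) := fun hx =>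
    hA.clm_apply hx
  let R : Submodule ℝ X :=
    { carrier := {z | ∃ (v : ℝ → U) (ξ : ℝ → X), Continuous v ∧ Continuous ξ ∧
        SolvesVolterra (fun t x => A t x) δ (fun t => ∫ τ in (0 : ℝ)..t, B τ (v τ)) ξ ∧ ξ δ = z}
      zero_mem' := ⟨fun _ => 0, fun _ => 0, continuous_const, continuous_const,
        fun t _ => by simp, rfl⟩
      add_mem' := by
        rintro _ _ ⟨v, ξ, hv, hξ, h, rfl⟩ ⟨v', ξ', hv', hξ', h', rfl⟩
        refine ⟨fun t => v t + v' t, fun t => ξ t + ξ' t, hv.add hv', hξ.add hξ', fun t ht => ?_,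
          rfl⟩
        simp only [map_add]
        rw [intervalIntegral.integral_add ((hBv hv).intervalIntegrable _ _)
          ((hBv hv').intervalIntegrable _ _), intervalIntegral.integral_add
          ((hAx hξ).intervalIntegrable _ _) ((hAx hξ').intervalIntegrable _ _)]
        conv_lhs => rw [h t ht, h' t ht]
        abel
      smul_mem' := by
        rintro r _ ⟨v, ξ, hv, hξ, h, rfl⟩
        refine ⟨fun t => r • v t, fun t => r • ξ t, hv.const_smul r, hξ.const_smul r,
          fun t ht => ?_, rfl⟩
        simp only [map_smul]
        rw [intervalIntegral.integral_smul, intervalIntegral.integral_smul, ← smul_add]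
        conv_lhs => rw [h t ht] }
  suffices hR : R = ⊤ by
    have : z ∈ R := hR ▸ Submodule.mem_top
    exact this
  -- Otherwise a nonzero functional annihilates the reachable subspace. Carried backward by the
  -- adjoint equation it annihilates `B` at all times, which observability forbids.
  by_contra hne
  obtain ⟨p₀, hp₀, hker⟩ := Submodule.exists_le_ker_of_lt_top R (lt_top_iff_ne_top.2 hne)
  let p : X →L[ℝ] ℝ := p₀.toContinuousLinearMap
  obtain ⟨η, hη, hηδ, hηs⟩ := exists_adjoint_solution hA hδ.le p
  have hηA : Continuous fun τ => (η τ).comp (A τ) := hη.clm_comp hA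
  have hzero : ∀ v : ℝ → U, Continuous v → ∫ τ in (0 : ℝ)..δ, η τ (B τ (v τ)) = 0 := by
    intro v hv
    have hint : Continuous fun t => ∫ τ in (0 : ℝ)..t, B τ (v τ) :=
      intervalIntegral.continuous_primitive (fun _ _ => (hBv hv).intervalIntegrable _ _) _
    obtain ⟨ξ, hξ, hξs⟩ := exists_linear_solvesVolterra hA hδ.le hint
    have hpξ : p (ξ δ) = 0 := hker ⟨v, ξ, hv, hξ, hξs, rfl⟩
    -- These primitives agree with `ξ` and `η` on `[0, δ]` and have two-sided derivatives at the end
    -- points, beyond which `ξ` and `η` satisfy no equation.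
    let ξ' : ℝ → X := fun t => ∫ τ in (0 : ℝ)..t, (B τ (v τ) + A τ (ξ τ))
    let η' : ℝ → X →L[ℝ] ℝ := fun t => p + ∫ τ in t..δ, (η τ).comp (A τ)
    have hξ' : ∀ t ∈ Icc 0 δ, ξ' t = ξ t := fun t ht => by
      rw [hξs t ht]
      exact intervalIntegral.integral_add ((hBv hv).intervalIntegrable _ _)
        ((hAx hξ).intervalIntegrable _ _)
    have hη' : ∀ t ∈ Icc 0 δ, η' t = η t := fun t ht => (hηs t ht).symm
    have hd : ∀ t ∈ uIcc 0 δ, HasDerivAt (fun s => η' s (ξ' s)) (η t (B t (v t))) t := by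
      intro t ht
      rw [uIcc_of_le hδ.le] at ht
      have hc := (hBv hv).add (hAx hξ)
      have h1 : HasDerivAt ξ' (B t (v t) + A t (ξ t)) t :=
        intervalIntegral.integral_hasDerivAt_right (hc.intervalIntegrable _ _)
          hc.stronglyMeasurable.stronglyMeasurableAtFilter hc.continuousAt
      have h2 : HasDerivAt η' (-(η t).comp (A t)) t :=
        (intervalIntegral.integral_hasDerivAt_left (hηA.intervalIntegrable _ _)
          hηA.stronglyMeasurable.stronglyMeasurableAtFilter hηA.continuousAt).const_add p
      have h3 := h2.clm_apply h1
      rw [hξ' t ht, hη' t ht] at h3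
      refine h3.congr_deriv ?_
      simp
    have hηB : Continuous fun τ => η τ (B τ (v τ)) := hη.clm_apply (hBv hv)
    rw [intervalIntegral.integral_eq_sub_of_hasDerivAt hd (hηB.intervalIntegrable _ _),
      hξ' δ (right_mem_Icc.2 hδ.le), hη' δ (right_mem_Icc.2 hδ.le), hηδ, hpξ]
    simp [ξ']
  have hηB : ∀ t ∈ Icc 0 δ, (η t).comp (B t) = 0 := by
    intro t ht
    ext w
    by_contra hw
    have hc : Continuous fun τ => η τ (B τ w) := hη.clm_apply (hB.clm_apply continuous_const)
    -- This control turns the integrand into a square.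
    have h1 := hzero (fun τ => η τ (B τ w) • w) (hc.smul continuous_const)
    simp only [map_smul, smul_eq_mul] at h1
    have h2 : 0 < ∫ τ in (0 : ℝ)..δ, η τ (B τ w) * η τ (B τ w) :=
      intervalIntegral.integral_pos hδ (hc.mul hc).continuousOn
        (fun τ _ => mul_self_nonneg _) ⟨t, ht, mul_self_pos.2 hw⟩
    exact h2.ne' h1
  have h1 := hobs η hη (fun t ht => by rw [hηδ]; exact hηs t ht) hηB
  refine hp₀ (LinearMap.ext fun x => ?_)
  have h2 : p x = 0 := by rw [← hηδ, h1]; rfl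
  exact h2

/-- The steering controls of a controllable linear system can be chosen linear in the target. -/
theorem exists_linear_steering_family {A : ℝ → X →L[ℝ] X} (hA : Continuous A)
    {B : ℝ → U →L[ℝ] X} (hB : Continuous B) {δ : ℝ} (hδ : 0 < δ)
    (hobs : ∀ η : ℝ → X →L[ℝ] ℝ, Continuous η →
      (∀ t ∈ Icc 0 δ, η t = η δ + ∫ τ in t..δ, (η τ).comp (A τ)) →
      (∀ t ∈ Icc 0 δ, (η t).comp (B t) = 0) → η δ = 0) :
    ∃ (V : ℝ → X →L[ℝ] U) (W : ℝ → X →L[ℝ] X), Continuous V ∧ Continuous W ∧ ∀ c,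
      SolvesVolterra (fun t x => A t x) δ (fun t => ∫ τ in (0 : ℝ)..t, B τ (V τ c))
        (fun t => W t c) ∧ W δ c = c := by
  let b := Module.finBasis ℝ X
  choose v ξ hv hξ hs hz using fun k => exists_linear_steering hA hB hδ hobs (b k)
  let p : ∀ _, X →L[ℝ] ℝ := fun k => (b.coord k).toContinuousLinearMap
  refine ⟨fun t => ∑ k, (p k).smulRight (v k t), fun t => ∑ k, (p k).smulRight (ξ k t),
    continuous_finsetSum _ fun k _ => continuous_smulRight _ (hv k),
    continuous_finsetSum _ fun k _ => continuous_smulRight _ (hξ k), fun c => ⟨fun t ht => ?_, ?_⟩⟩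
  · simp only [sum_apply, ContinuousLinearMap.smulRight_apply, map_sum,
      map_smul]
    have h1 := intervalIntegral.integral_finsetSum (μ := volume) (s := Finset.univ) (a := 0)
      (b := t) (f := fun k τ => p k c • B τ (v k τ)) fun k _ =>
        ((hB.clm_apply (hv k)).const_smul (p k c)).intervalIntegrable _ _
    have h2 := intervalIntegral.integral_finsetSum (μ := volume) (s := Finset.univ) (a := 0)
      (b := t) (f := fun k τ => p k c • A τ (ξ k τ)) fun k _ =>
        ((hA.clm_apply (hξ k)).const_smul (p k c)).intervalIntegrable _ _
    rw [h1, h2, ← Finset.sum_add_distrib]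
    refine Finset.sum_congr rfl fun k _ => ?_
    rw [intervalIntegral.integral_smul, intervalIntegral.integral_smul, ← smul_add]
    conv_lhs => rw [hs k t ht]
  · simp only [sum_apply, ContinuousLinearMap.smulRight_apply, hz]
    exact b.sum_repr c

end Linear

end TriangularControl

namespace TriangularControl

/-! ### Calculus in spaces of continuous functions. -/

section Superposition

variable {K Y Z : Type*} [TopologicalSpace K] [CompactSpace K]
  [NormedAddCommGroup Y] [NormedSpace ℝ Y] [NormedAddCommGroup Z] [NormedSpace ℝ Z]

/-- Pointwise application of a continuous family of operators. -/
noncomputable def pointwiseCLM (A : C(K, Y →L[ℝ] Z)) : C(K, Y) →L[ℝ] C(K, Z) :=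
  LinearMap.mkContinuous
    { toFun := fun w => ⟨fun t => A t (w t), A.continuous.clm_apply w.continuous⟩
      map_add' := fun w w' => by ext t; simp
      map_smul' := fun r w => by ext t; simp }
    ‖A‖ fun w => (ContinuousMap.norm_le _ (by positivity)).2 fun t =>
      ((A t).le_opNorm _).trans
        (mul_le_mul (A.norm_coe_le_norm t) (w.norm_coe_le_norm t) (by positivity) (by positivity))

@[simp]
lemma pointwiseCLM_apply (A : C(K, Y →L[ℝ] Z)) (w : C(K, Y)) (t : K) :
    pointwiseCLM A w t = A t (w t) := rfl

/-- The superposition operator of a continuous map. -/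
def superposition (f : C(K × Y, Z)) (w : C(K, Y)) : C(K, Z) :=
  ⟨fun t => f (t, w t), by fun_prop⟩

omit [CompactSpace K] [NormedSpace ℝ Y] [NormedSpace ℝ Z] in
@[simp]
lemma superposition_apply (f : C(K × Y, Z)) (w : C(K, Y)) (t : K) :
    superposition f w t = f (t, w t) := rfl

/-- Compactness of `K` makes the variation of `f'` near `w₀ t` small for all `t` at once. The mean
value inequality between two arbitrary points of a ball then gives strict differentiability, which
the inverse function theorem needs. -/
theorem hasStrictFDerivAt_superposition (f : C(K × Y, Z)) (f' : C(K × Y, Y →L[ℝ] Z))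
    (hf : ∀ t y, HasFDerivAt (fun y => f (t, y)) (f' (t, y)) y) (w₀ : C(K, Y)) :
    HasStrictFDerivAt (superposition f) (pointwiseCLM (superposition f' w₀)) w₀ := by
  rw [hasStrictFDerivAt_iff_isLittleO, Asymptotics.isLittleO_iff]
  intro ε hε
  have h1 : ∀ᶠ h in 𝓝 (0 : Y), ∀ t ∈ (univ : Set K),
      ‖f' (t, w₀ t + h) - f' (t, w₀ t)‖ < ε := by
    refine isCompact_univ.eventually_forall_of_forall_eventually fun t _ => ?_
    have hc : Continuous fun q : Y × K => ‖f' (q.2, w₀ q.2 + q.1) - f' (q.2, w₀ q.2)‖ := by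
      fun_prop
    exact hc.continuousAt.eventually_lt continuousAt_const (by simpa using hε)
  obtain ⟨r, hr, hball⟩ := Metric.eventually_nhds_iff_ball.1 h1
  have h2 : ∀ᶠ p : C(K, Y) × C(K, Y) in 𝓝 (w₀, w₀), p.1 ∈ Metric.ball w₀ r ∧
      p.2 ∈ Metric.ball w₀ r := by
    exact prod_mem_nhds (Metric.ball_mem_nhds _ hr) (Metric.ball_mem_nhds _ hr)
  filter_upwards [h2] with p hp
  refine (ContinuousMap.norm_le _ (by positivity)).2 fun t => ?_
  have hmem : ∀ w ∈ Metric.ball w₀ r, w t ∈ Metric.ball (w₀ t) r := fun w hw =>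
    (ContinuousMap.dist_apply_le_dist t).trans_lt hw
  have h3 := (convex_ball (w₀ t) r).norm_image_sub_le_of_norm_hasFDerivWithin_le'
    (f := fun y => f (t, y)) (f' := fun y => f' (t, y)) (φ := f' (t, w₀ t)) (C := ε)
    (fun y _ => (hf t y).hasFDerivWithinAt) (fun y hy => by
      have := hball (y - w₀ t) (by simpa [dist_eq_norm] using hy) t (mem_univ t)
      rw [add_sub_cancel] at this
      exact this.le) (hmem _ hp.2) (hmem _ hp.1)
  refine h3.trans (mul_le_mul_of_nonneg_left ?_ hε.le)
  exact (p.1 - p.2).norm_coe_le_norm t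

end Superposition

section Primitive

variable {X : Type*} [NormedAddCommGroup X] [NormedSpace ℝ X]

/-- The primitive on `[0, δ]` as an operator on continuous functions. -/
noncomputable def primitiveCLM {δ : ℝ} (hδ : 0 ≤ δ) : C(Icc 0 δ, X) →L[ℝ] C(Icc 0 δ, X) :=
  have hc : ∀ w : C(Icc 0 δ, X), Continuous fun τ => w (projIcc 0 δ hδ τ) := fun w =>
    w.continuous.comp continuous_projIcc
  LinearMap.mkContinuous
    { toFun := fun w => ⟨fun t => ∫ τ in (0 : ℝ)..t, w (projIcc 0 δ hδ τ),
        (intervalIntegral.continuous_primitive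
          (fun _ _ => (hc w).intervalIntegrable _ _) _).comp continuous_subtype_val⟩
      map_add' := fun w w' => by
        ext t
        exact intervalIntegral.integral_add ((hc w).intervalIntegrable _ _)
          ((hc w').intervalIntegrable _ _)
      map_smul' := fun r w => by
        ext t
        exact intervalIntegral.integral_smul _ _ }
    δ fun w => (ContinuousMap.norm_le _ (by positivity)).2 fun t => by
      refine (intervalIntegral.norm_integral_le_of_norm_le_const fun τ _ =>
        w.norm_coe_le_norm (projIcc 0 δ hδ τ)).trans ?_
      rw [sub_zero, abs_of_nonneg t.2.1, mul_comm]
      exact mul_le_mul_of_nonneg_right t.2.2 (norm_nonneg _)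

lemma primitiveCLM_apply {δ : ℝ} (hδ : 0 ≤ δ) (w : C(Icc 0 δ, X)) (t : Icc 0 δ) :
    primitiveCLM hδ w t = ∫ τ in (0 : ℝ)..t, w (projIcc 0 δ hδ τ) := rfl

lemma primitiveCLM_apply_of_eq {δ : ℝ} (hδ : 0 ≤ δ) (w : C(Icc 0 δ, X)) {h : ℝ → X}
    (hw : ∀ t : Icc 0 δ, w t = h t) (t : Icc 0 δ) :
    primitiveCLM hδ w t = ∫ τ in (0 : ℝ)..t, h τ := by
  rw [primitiveCLM_apply]
  refine intervalIntegral.integral_congr fun τ hτ => ?_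
  rw [uIcc_of_le t.2.1] at hτ
  have : τ ∈ Icc 0 δ := ⟨hτ.1, hτ.2.trans t.2.2⟩
  simp only [hw, projIcc_of_mem hδ this]

end Primitive

end TriangularControl

/-! ### Exact local steering by the inverse function theorem. -/

namespace TriangularControl

variable {X U : Type*} [NormedAddCommGroup X] [NormedSpace ℝ X] [FiniteDimensional ℝ X]
  [NormedAddCommGroup U] [NormedSpace ℝ U]

/-- If the linearization along a trajectory is controllable, then the nonlinear system can be
steered to all points near the end of this trajectory, by controls that depend continuously on the
target and keep their values at both ends of the time interval. -/
theorem exists_local_steering {f : ℝ → X × U → X} (hf : Continuous (Function.uncurry f))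
    {f' : ℝ → X × U → X × U →L[ℝ] X} (hf' : Continuous (Function.uncurry f'))
    (hd : ∀ t w, HasFDerivAt (f t) (f' t w) w) {δ : ℝ} (hδ : 0 < δ) {xs : X} {us : U} {ξ : ℝ → X}
    (hξ : Continuous ξ) (hξs : SolvesVolterra (fun t x => f t (x, us)) δ (fun _ => xs) ξ)
    (hobs : ∀ η : ℝ → X →L[ℝ] ℝ, Continuous η →
      (∀ t ∈ Icc 0 δ, η t = η δ +
        ∫ τ in t..δ, (η τ).comp ((f' τ (ξ τ, us)).comp (ContinuousLinearMap.inl ℝ X U))) →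
      (∀ t ∈ Icc 0 δ, (η t).comp ((f' t (ξ t, us)).comp (ContinuousLinearMap.inr ℝ X U)) = 0) →
      η δ = 0) :
    ∃ r > 0, ∃ u : X → ℝ → U, ContinuousOn (Function.uncurry u) (Metric.ball (ξ δ) r ×ˢ univ) ∧
      ∀ z ∈ Metric.ball (ξ δ) r, u z 0 = us ∧ u z δ = us ∧ ∃ x : ℝ → X, Continuous x ∧
        SolvesVolterra (fun t x => f t (x, u z t)) δ (fun _ => xs) x ∧ x δ = z := by
  have hX : CompleteSpace X := FiniteDimensional.complete ℝ X
  have hf'ξ : Continuous fun t => f' t (ξ t, us) :=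
    hf'.comp (continuous_id.prodMk (hξ.prodMk continuous_const))
  obtain ⟨A, hAdef⟩ : ∃ A : ℝ → X →L[ℝ] X, A = fun t =>
    (f' t (ξ t, us)).comp (ContinuousLinearMap.inl ℝ X U) := ⟨_, rfl⟩
  obtain ⟨B, hBdef⟩ : ∃ B : ℝ → U →L[ℝ] X, B = fun t =>
    (f' t (ξ t, us)).comp (ContinuousLinearMap.inr ℝ X U) := ⟨_, rfl⟩
  have hA : Continuous A := hAdef ▸ hf'ξ.clm_comp continuous_const
  have hB : Continuous B := hBdef ▸ hf'ξ.clm_comp continuous_const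
  have hAB : ∀ t (w : X × U), f' t (ξ t, us) w = A t w.1 + B t w.2 := fun t w => by
    simp [hAdef, hBdef, ← map_add]
  -- Multiplying control variations by `β` preserves the control at both ends. Observability is not
  -- lost: `β` is positive inside, and continuity recovers the end points.
  let β : ℝ → ℝ := fun t => t * (δ - t)
  have hβ : Continuous β := by fun_prop
  obtain ⟨V₀, W, hV₀, hW, hVW⟩ := exists_linear_steering_family hA (hβ.smul hB) hδ
    fun η hη hηA hηB => by
      refine hobs η hη (by simpa [hAdef] using hηA) ?_
      have hc : Continuous fun t => (η t).comp (B t) := hη.clm_comp hB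
      have h0 : EqOn (fun t => (η t).comp (B t)) (fun _ => 0) (Ioo 0 δ) := fun t ht => by
        have h1 := hηB t ⟨ht.1.le, ht.2.le⟩
        rw [Pi.smul_apply', ContinuousLinearMap.comp_smul] at h1
        exact (smul_eq_zero.1 h1).resolve_left
          (mul_pos ht.1 (sub_pos.2 ht.2)).ne'
      have h1 := h0.closure hc continuous_const
      rw [closure_Ioo hδ.ne] at h1
      intro t ht
      have h2 := h1 ht
      simp only [hBdef] at h2
      exact h2
  let V : ℝ → X →L[ℝ] U := fun t => β t • V₀ t
  have hV : Continuous V := hβ.smul hV₀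
  let K := Icc (0 : ℝ) δ
  have hq : Continuous fun q : K × (X × U) => ((q.1 : ℝ), q.2) := by fun_prop
  let fK : C(K × (X × U), X) := ⟨fun q => f q.1 q.2, hf.comp hq⟩
  let fK' : C(K × (X × U), X × U →L[ℝ] X) := ⟨fun q => f' q.1 q.2, hf'.comp hq⟩
  let ξK : C(K, X) := ⟨fun t => ξ t, by fun_prop⟩
  let VK : C(K, X →L[ℝ] X × U) := ⟨fun t => (ContinuousLinearMap.inr ℝ X U).comp (V t),
    continuous_const.clm_comp (hV.comp continuous_subtype_val)⟩
  let P : C(K, X) × X →L[ℝ] C(K, X × U) :=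
    (pointwiseCLM (ContinuousMap.const K (ContinuousLinearMap.inl ℝ X U))).comp
      (ContinuousLinearMap.fst ℝ _ _) +
    ((pointwiseCLM VK).comp (ContinuousLinearMap.const ℝ K)).comp (ContinuousLinearMap.snd ℝ _ _)
  have hP : ∀ (p : C(K, X) × X) (t : K), P p t = (p.1 t, V t p.2) := fun p t => by
    simp [P, VK]
  let ws : C(K, X × U) := ContinuousMap.const K (0, us)
  let J := primitiveCLM (X := X) hδ.le
  let e : C(K, X) →L[ℝ] X := ContinuousMap.evalCLM ℝ (⟨δ, right_mem_Icc.2 hδ.le⟩ : K)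
  -- The unknowns are a trajectory and a finite-dimensional parameter `c` for the control `us + V
  -- c`. The equation `Ψ p = (const xs, z)` says that the trajectory starts at `xs`, solves the
  -- system and ends at `z`.
  let Ψ : C(K, X) × X → C(K, X) × X := fun p => (p.1 - J (superposition fK (P p + ws)), e p.1)
  let w₀ : C(K, X × U) := P (ξK, 0) + ws
  have hw₀ : ∀ t : K, w₀ t = (ξ t, us) := fun t => by simp [w₀, hP, ws, ξK]
  let D : C(K, X) × X →L[ℝ] C(K, X) × X :=
    (ContinuousLinearMap.fst ℝ _ _ - J.comp ((pointwiseCLM (superposition fK' w₀)).comp P)).prod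
      (e.comp (ContinuousLinearMap.fst ℝ _ _))
  have hΨ : HasStrictFDerivAt Ψ D (ξK, 0) := by
    have h1 := hasStrictFDerivAt_superposition fK fK' (fun t y => hd t y) w₀
    have h2 : HasStrictFDerivAt (fun p => P p + ws) P (ξK, 0) := P.hasStrictFDerivAt.add_const ws
    exact (hasStrictFDerivAt_fst.sub (J.hasStrictFDerivAt.comp _ (h1.comp _ h2))).prodMk
      (e.hasStrictFDerivAt.comp _ hasStrictFDerivAt_fst)
  have hcont : ∀ h : C(K, X), Continuous fun t => h (projIcc 0 δ hδ.le t) := fun h =>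
    h.continuous.comp continuous_projIcc
  have hVW' : ∀ c, SolvesVolterra (fun t x => A t x) δ (fun t => ∫ τ in (0 : ℝ)..t, B τ (V τ c))
      (fun t => W t c) := fun c => by
    have := (hVW c).1
    simpa [V, Pi.smul_apply'] using this
  have hD : ∀ (p : C(K, X) × X) (h : ℝ → X), Continuous h → (∀ t : K, p.1 t = h t) → ∀ t : K,
      J (pointwiseCLM (superposition fK' w₀) (P p)) t =
      (∫ τ in (0 : ℝ)..t, B τ (V τ p.2)) + ∫ τ in (0 : ℝ)..t, A τ (h τ) := fun p h hh hph t => by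
    rw [← intervalIntegral.integral_add
      ((hB.clm_apply (hV.clm_apply continuous_const)).intervalIntegrable _ _)
      ((hA.clm_apply hh).intervalIntegrable _ _)]
    refine primitiveCLM_apply_of_eq hδ.le _ (fun t => ?_) t
    rw [pointwiseCLM_apply, superposition_apply, hw₀, hP, hph]
    change f' t (ξ t, us) _ = _
    rw [hAB, add_comm]
  -- A kernel element is the response `W c` of the linearized system to the control `V c`. Its end
  -- value is both `c` and `0`, so `c` and the response vanish.
  have hker : D.ker = ⊥ := by
    refine LinearMap.ker_eq_bot'.2 fun p hp => ?_
    have h1 : ∀ t : K, p.1 t = (∫ τ in (0 : ℝ)..t, B τ (V τ p.2)) +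
        ∫ τ in (0 : ℝ)..t, A τ (p.1 (projIcc 0 δ hδ.le τ)) := fun t => by
      rw [← hD p _ (hcont p.1) (fun t => by rw [projIcc_val]) t]
      have h2 := congrArg (fun q => q.1 t) hp
      change p.1 t - J (pointwiseCLM (superposition fK' w₀) (P p)) t = 0 at h2
      exact sub_eq_zero.1 h2
    have h2 : SolvesVolterra (fun t x => A t x) δ (fun t => ∫ τ in (0 : ℝ)..t, B τ (V τ p.2))
        (fun t => p.1 (projIcc 0 δ hδ.le t)) := fun t ht => by
      simp only [projIcc_of_mem hδ.le ht]
      exact h1 ⟨t, ht⟩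
    have h3 := h2.eqOn (continuous_uncurry_apply hA) (lipschitzOnBalls_apply hA δ) (hcont p.1)
      (hW.clm_apply continuous_const) (hVW' p.2)
    have h4 : p.1 ⟨δ, right_mem_Icc.2 hδ.le⟩ = 0 := congrArg Prod.snd hp
    have h5 : p.2 = 0 := by
      have h6 := h3 (right_mem_Icc.2 hδ.le)
      simp only [projIcc_right, (hVW p.2).2] at h6
      exact h6.symm.trans h4
    refine Prod.ext (ContinuousMap.ext fun t => ?_) h5
    have h6 := h3 t.2
    simpa [h5] using h6
  -- The linear equation is solved with zero control first; the response to `c = z - ζ δ` then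
  -- corrects the end value.
  have hrange : D.range = ⊤ := by
    refine LinearMap.range_eq_top.2 fun ⟨h, z⟩ => ?_
    obtain ⟨ζ, hζ, hζs⟩ := exists_linear_solvesVolterra hA hδ.le (hcont h)
    let c := z - ζ δ
    have hx : Continuous fun t => ζ t + W t c := hζ.add (hW.clm_apply continuous_const)
    refine ⟨(⟨fun t => ζ t + W t c, hx.comp continuous_subtype_val⟩, c),
      Prod.ext (ContinuousMap.ext fun t => ?_) ?_⟩
    · change ζ t + W t c - J (pointwiseCLM (superposition fK' w₀) (P _)) t = h t
      have h1 := hζs t t.2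
      have h2 := hVW' c t t.2
      simp only [projIcc_val] at h1 h2
      rw [hD _ _ hx (fun _ => rfl) t, h1, h2]
      simp only [map_add]
      rw [intervalIntegral.integral_add ((hA.clm_apply hζ).intervalIntegrable _ _)
        ((hA.clm_apply (hW.clm_apply continuous_const)).intervalIntegrable _ _)]
      abel
    · change ζ δ + W δ c = z
      rw [(hVW c).2]
      exact add_sub_cancel _ _
  let D' := ContinuousLinearEquiv.ofBijective D hker hrange
  have hΨ' : HasStrictFDerivAt Ψ (D' : C(K, X) × X →L[ℝ] C(K, X) × X) (ξK, 0) := hΨ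
  let G := hΨ'.toOpenPartialHomeomorph Ψ
  have hΨ0 : Ψ (ξK, 0) = (ContinuousMap.const K xs, ξ δ) := by
    refine Prod.ext (ContinuousMap.ext fun t => ?_) rfl
    change ξ t - J (superposition fK w₀) t = xs
    rw [show J (superposition fK w₀) t = ∫ τ in (0 : ℝ)..t, f τ (ξ τ, us) from
      primitiveCLM_apply_of_eq hδ.le _ (fun t => by rw [superposition_apply, hw₀]; rfl) t, hξs t t.2]
    simp
  have hmem : (ContinuousMap.const K xs, ξ δ) ∈ G.target :=
    hΨ0 ▸ hΨ'.image_mem_toOpenPartialHomeomorph_target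
  have hev : ∀ᶠ z in 𝓝 (ξ δ), (ContinuousMap.const K xs, z) ∈ G.target :=
    (Continuous.prodMk_right (ContinuousMap.const K xs)).continuousAt.eventually
      (G.open_target.mem_nhds hmem)
  obtain ⟨r, hr, hball⟩ := Metric.eventually_nhds_iff_ball.1 hev
  refine ⟨r, hr, fun z t => us + V t (G.symm (ContinuousMap.const K xs, z)).2, ?_, fun z hz => ?_⟩
  · have h1 : ContinuousOn (fun z => (G.symm (ContinuousMap.const K xs, z)).2)
        (Metric.ball (ξ δ) r) :=
      continuous_snd.comp_continuousOn (G.continuousOn_symm.comp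
        (Continuous.prodMk_right (ContinuousMap.const K xs)).continuousOn hball)
    exact continuousOn_const.add ((hV.comp continuous_snd).continuousOn.clm_apply
      (h1.comp continuousOn_fst fun p hp => hp.1))
  · have h1 : Ψ (G.symm (ContinuousMap.const K xs, z)) = (ContinuousMap.const K xs, z) :=
      G.right_inv (hball z hz)
    obtain ⟨p, hp⟩ : ∃ p, p = G.symm (ContinuousMap.const K xs, z) := ⟨_, rfl⟩
    rw [← hp] at h1
    simp only [← hp]
    refine ⟨by simp [V, β], by simp [V, β], fun t => p.1 (projIcc 0 δ hδ.le t), hcont _,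
      fun t ht => ?_, ?_⟩
    · have h2 := congrArg (fun q => q.1 ⟨t, ht⟩) h1
      change p.1 ⟨t, ht⟩ - J (superposition fK (P p + ws)) ⟨t, ht⟩ = xs at h2
      have h3 := primitiveCLM_apply_of_eq hδ.le (superposition fK (P p + ws))
        (h := fun τ => f τ (p.1 (projIcc 0 δ hδ.le τ), us + V τ p.2)) (fun t => by
          rw [superposition_apply, ContinuousMap.add_apply, hP]
          change f t ((p.1 t, V t p.2) + (0, us)) = _
          rw [projIcc_val, Prod.mk_add_mk, add_zero, add_comm us]) ⟨t, ht⟩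
      simp only [← h2, ← h3, projIcc_of_mem hδ.le ht]
      exact (sub_add_cancel _ _).symm
    · have h2 := congrArg Prod.snd h1
      simp only [projIcc_right]
      exact h2

end TriangularControl

/-! ### Derivatives of triangular right-hand sides. -/

namespace TriangularControl

variable {ν : ℕ} {m : Fin (ν + 1) → ℕ}

/-- A right-hand side of triangular form that is continuous, with a continuous total derivative
`D` in the state and the control, at all times. -/
structure HasContDeriv (F : Components m)
    (D : ℝ → State m × Control m → (State m × Control m →L[ℝ] State m)) : Prop where
  continuous_field : Continuous (Function.uncurry fun t (w : State m × Control m) =>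
    field F t w.1 w.2)
  continuous_deriv : Continuous (Function.uncurry D)
  hasFDerivAt : ∀ t w, HasFDerivAt (fun w : State m × Control m => field F t w.1 w.2) (D t w) w

/-- Change of time and of the speed in a right-hand side of triangular form. -/
def reparam (F : Components m) (σ : ℝ) (c : ℝ → ℝ) : Components m := fun i t y v => σ • F i (c t) y v

lemma field_reparam (F : Components m) (σ : ℝ) (c : ℝ → ℝ) (t : ℝ) (x : State m) (u : Control m) :
    field (reparam F σ c) t x u = σ • field F (c t) x u := rfl

lemma HasContDeriv.reparam {F : Components m}
    {D : ℝ → State m × Control m → (State m × Control m →L[ℝ] State m)} (h : HasContDeriv F D)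
    (σ : ℝ) {c : ℝ → ℝ} (hc : Continuous c) :
    HasContDeriv (reparam F σ c) fun t w => σ • D (c t) w where
  continuous_field := (h.continuous_field.comp (by fun_prop :
    Continuous fun p : ℝ × (State m × Control m) => (c p.1, p.2))).const_smul σ
  continuous_deriv := (h.continuous_deriv.comp (by fun_prop :
    Continuous fun p : ℝ × (State m × Control m) => (c p.1, p.2))).const_smul σ
  hasFDerivAt := fun t w => (h.hasFDerivAt (c t) w).const_smul σ

lemma surjective_reparam {F : Components m} (hF : ∀ i t y, Function.Surjective (F i t y)) {σ : ℝ}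
    (hσ : σ ≠ 0) (c : ℝ → ℝ) (i : Fin ν) (t : ℝ) (y : Head m i) :
    Function.Surjective (reparam F σ c i t y) := fun v => by
  obtain ⟨w, hw⟩ := hF i (c t) y (σ⁻¹ • v)
  exact ⟨w, by simp [reparam, hw, hσ]⟩

/-- All blocks as a state and a control. -/
def splitCLM (m : Fin (ν + 1) → ℕ) : Ext m →L[ℝ] State m × Control m :=
  (ContinuousLinearMap.pi fun i : Fin ν => ContinuousLinearMap.proj (φ := fun j => Vec (m j)) i.castSucc).prod
    (ContinuousLinearMap.proj (Fin.last ν))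

lemma splitCLM_apply (z : Ext m) :
    splitCLM m z = ((fun i : Fin ν => z i.castSucc : State m), z (Fin.last ν)) := rfl

/-- A state and a control as one tuple of blocks. -/
def join (x : State m) (u : Control m) : Ext m := Fin.snoc (α := fun j => Vec (m j)) x u

@[simp]
lemma join_castSucc (x : State m) (u : Control m) (i : Fin ν) : join x u i.castSucc = x i :=
  Fin.snoc_castSucc (α := fun j => Vec (m j)) _ _ _

@[simp]
lemma join_last (x : State m) (u : Control m) : join x u (Fin.last ν) = u :=
  Fin.snoc_last (α := fun j => Vec (m j)) _ _

lemma splitCLM_join (x : State m) (u : Control m) : splitCLM m (join x u) = (x, u) := by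
  simp [splitCLM_apply]

lemma continuous_join : Continuous fun p : State m × Control m => join p.1 p.2 := by
  refine continuous_pi fun j => ?_
  induction j using Fin.lastCases with
  | last => simpa using continuous_snd
  | cast i =>
    simp only [join_castSucc]
    exact (continuous_apply i).comp continuous_fst

lemma extField_join (F : Components m) (t : ℝ) (x : State m) (u : Control m) :
    extField F t (join x u) = field F t x u := by
  funext i
  simp only [extField, join_castSucc]
  rfl

lemma join_split (z : Ext m) : join (splitCLM m z).1 (splitCLM m z).2 = z := by
  funext j
  induction j using Fin.lastCases with
  | last => simp [splitCLM_apply]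
  | cast i => simp [splitCLM_apply]

lemma extField_eq_field (F : Components m) (t : ℝ) (z : Ext m) :
    extField F t z = field F t (splitCLM m z).1 (splitCLM m z).2 := by
  rw [← extField_join, join_split]

lemma lipschitzOnBalls_of_hasFDerivAt {E E' : Type*} [NormedAddCommGroup E] [NormedSpace ℝ E]
    [FiniteDimensional ℝ E] [NormedAddCommGroup E'] [NormedSpace ℝ E'] {f : ℝ → E → E'}
    {f' : ℝ → E → E →L[ℝ] E'} (hf' : Continuous (Function.uncurry f'))
    (hd : ∀ t x, HasFDerivAt (f t) (f' t x) x) (S : ℝ) : LipschitzOnBalls f S := by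
  intro R
  have hE : ProperSpace E := FiniteDimensional.proper ℝ E
  obtain ⟨L, hL⟩ := ((isCompact_Icc (a := (0 : ℝ)) (b := S)).prod
    (isCompact_closedBall (0 : E) R)).exists_bound_of_continuousOn hf'.continuousOn
  refine ⟨L, fun t ht x y hx hy => ?_⟩
  exact (convex_closedBall (0 : E) R).norm_image_sub_le_of_norm_hasFDerivWithin_le
    (fun z _ => (hd t z).hasFDerivWithinAt) (fun z hz => hL (t, z) ⟨ht, hz⟩)
    (mem_closedBall_zero_iff.2 hy) (mem_closedBall_zero_iff.2 hx)

section Regular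

variable {F : Components m} {D : ℝ → State m × Control m → (State m × Control m →L[ℝ] State m)}
  (h : HasContDeriv F D)
include h

lemma HasContDeriv.continuous_extField : Continuous (Function.uncurry (extField F)) := by
  simp only [Function.uncurry_def, extField_eq_field]
  exact h.continuous_field.comp (by fun_prop :
    Continuous fun p : ℝ × Ext m => (p.1, splitCLM m p.2))

lemma HasContDeriv.hasFDerivAt_extField (t : ℝ) (z : Ext m) :
    HasFDerivAt (extField F t) ((D t (splitCLM m z)).comp (splitCLM m)) z := by
  have : extField F t = fun z => field F t (splitCLM m z).1 (splitCLM m z).2 :=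
    funext (extField_eq_field F t)
  rw [this]
  exact (h.hasFDerivAt t (splitCLM m z)).comp z (splitCLM m).hasFDerivAt

lemma HasContDeriv.lipschitzOnBalls_extField (S : ℝ) : LipschitzOnBalls (extField F) S :=
  lipschitzOnBalls_of_hasFDerivAt
    (f' := fun t z => (D t (splitCLM m z)).comp (splitCLM m))
    ((h.continuous_deriv.comp (by fun_prop :
      Continuous fun p : ℝ × Ext m => (p.1, splitCLM m p.2))).clm_comp continuous_const)
    h.hasFDerivAt_extField S

lemma HasContDeriv.hasFDerivAt_update (t : ℝ) (z : Ext m) (k : Fin (ν + 1)) (i : Fin ν) :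
    HasFDerivAt (fun v => extField F t (Function.update z k v) i)
      ((ContinuousLinearMap.proj i).comp (((D t (splitCLM m z)).comp (splitCLM m)).comp
        (ContinuousLinearMap.single ℝ _ k))) (z k) := by
  have h1 := h.hasFDerivAt_extField t (Function.update z k (z k))
  have h2 := (hasFDerivAt_apply (𝕜 := ℝ) i _).comp _ (h1.comp (z k) (_root_.hasFDerivAt_update z (z k)))
  rw [Function.update_eq_self] at h2
  have h3 : ContinuousLinearMap.pi (Pi.single k (ContinuousLinearMap.id ℝ (Vec (m k)))) =
      ContinuousLinearMap.single ℝ (fun j => Vec (m j)) k := by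
    refine ContinuousLinearMap.ext fun v => funext fun j => ?_
    by_cases hj : j = k
    · subst hj; simp
    · simp [hj]
  rw [h3] at h2
  exact h2

/-- A component does not depend on the blocks after the next one. -/
lemma HasContDeriv.deriv_single_eq_zero (t : ℝ) (z : Ext m) {k : Fin (ν + 1)} {i : Fin ν}
    (hk : i.succ < k) (v : Vec (m k)) :
    D t (splitCLM m z) (splitCLM m (Pi.single k v)) i = 0 := by
  have h1 := h.hasFDerivAt_update t z k i
  have h2 : (fun v => extField F t (Function.update z k v) i) = fun _ => extField F t z i :=
    funext fun v => extField_congr F t fun j hj => Function.update_of_ne (hj.trans_lt hk).ne _ _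
  rw [h2] at h1
  exact congrArg (fun A => A v) (h1.unique (hasFDerivAt_const _ _))

lemma HasContDeriv.deriv_single_succ (t : ℝ) (z : Ext m) (i : Fin ν) (v : Vec (m i.succ)) :
    D t (splitCLM m z) (splitCLM m (Pi.single i.succ v)) i =
      fderiv ℝ (F i t fun j => z j.1.castSucc) (z i.succ) v := by
  have h1 := h.hasFDerivAt_update t z i.succ i
  have h2 : (fun v => extField F t (Function.update z i.succ v) i) =
      F i t fun j => z j.1.castSucc := by
    funext v
    simp only [extField, Function.update_self]
    congr 1
    funext j
    exact Function.update_of_ne (((Fin.castSucc_le_castSucc_iff.2 j.2).trans_lt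
      i.castSucc_lt_succ).ne) _ _
  rw [h2] at h1
  exact (congrArg (fun A => A v) h1.fderiv).symm

end Regular

/-- Composed with a fixed right inverse of `L t₀`, the operator `L t` is close to the identity, and
invertibility is an open condition. -/
lemma eventually_surjective {E G : Type*} [NormedAddCommGroup E] [NormedSpace ℝ E]
    [NormedAddCommGroup G] [NormedSpace ℝ G] [FiniteDimensional ℝ G] {L : ℝ → E →L[ℝ] G}
    (hL : Continuous L) {t₀ : ℝ} (h₀ : Function.Surjective (L t₀)) :
    ∀ᶠ t in 𝓝 t₀, Function.Surjective (L t) := by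
  have hG : CompleteSpace G := FiniteDimensional.complete ℝ G
  obtain ⟨R, hR⟩ := (L t₀).toLinearMap.exists_rightInverse_of_surjective (LinearMap.range_eq_top.2 h₀)
  let R' : G →L[ℝ] E := R.toContinuousLinearMap
  have h1 : Continuous fun t => (L t).comp R' := hL.clm_comp continuous_const
  have h2 : (L t₀).comp R' = 1 := by
    ext v
    exact congrArg (fun A : G →ₗ[ℝ] G => A v) hR
  have h3 : ∀ᶠ t in 𝓝 t₀, IsUnit ((L t).comp R') :=
    h1.continuousAt.eventually (Units.isOpen.mem_nhds (by
      change IsUnit ((L t₀).comp R')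
      rw [h2]
      exact isUnit_one))
  filter_upwards [h3] with t ht v
  obtain ⟨⟨a, b, hab, hba⟩, ha⟩ := ht
  refine ⟨R' (b v), ?_⟩
  have := congrArg (fun A : G →L[ℝ] G => A v) hab
  rw [show a = (L t).comp R' from ha] at this
  exact this

end TriangularControl

/-! ### Observability and local steering of triangular systems. -/

namespace TriangularControl

/-- The constant curve has defect at most `M * δ`, so on a short interval a solution exists within
distance `1` of it. -/
lemma exists_short_solvesVolterra {E : Type*} [NormedAddCommGroup E] [NormedSpace ℝ E]
    [CompleteSpace E] {H : ℝ → E → E} (hH : Continuous (Function.uncurry H)) {S : ℝ} (hS : 0 < S)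
    (hlip : LipschitzOnBalls H S) (x : E) :
    ∃ δ, 0 < δ ∧ δ ≤ S ∧ ∃ ξ : ℝ → E, Continuous ξ ∧ SolvesVolterra H δ (fun _ => x) ξ := by
  obtain ⟨L₀, hL₀⟩ := hlip (‖x‖ + 1)
  obtain ⟨M, hM, hMb⟩ := exists_pos_bound_norm
    (hH.comp (continuous_id.prodMk continuous_const : Continuous fun t : ℝ => (t, x))) S
  set L := max L₀ 1
  have hL : 0 < L := lt_max_of_lt_right one_pos
  let δ := min S (1 / (2 * M * Real.exp (2 * L * S)))
  have hδ : 0 < δ := lt_min hS (by positivity)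
  have hδS : δ ≤ S := min_le_left _ _
  suffices h : ∃ ξ : ℝ → E, Continuous ξ ∧ SolvesVolterra H δ (fun _ => x) ξ ∧
      ∀ t ∈ Icc 0 δ, ‖ξ t - x‖ ≤ 1 by
    obtain ⟨ξ, hξ, hξs, -⟩ := h
    exact ⟨δ, hδ, hδS, ξ, hξ, hξs⟩
  refine exists_solvesVolterra hH hδ.le (ρ := fun _ => x) (c := fun _ => x)
    continuous_const continuous_const (ε := 1) (a := M * δ) hL (fun t ht y z hy hz => ?_)
    (fun t ht => ?_) ?_
  · have aux : ∀ w : E, ‖w - x‖ ≤ 1 → ‖w‖ ≤ ‖x‖ + 1 := fun w hw => by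
      have := norm_add_le x (w - x)
      rw [add_sub_cancel] at this
      linarith
    exact (hL₀ t ⟨ht.1, ht.2.trans hδS⟩ y z (aux y hy) (aux z hz)).trans
      (mul_le_mul_of_nonneg_right (le_max_left _ _) (norm_nonneg _))
  · rw [add_sub_cancel_left]
    refine (intervalIntegral.norm_integral_le_of_norm_le_const (C := M) fun τ hτ => ?_).trans ?_
    · rw [uIoc_of_le ht.1] at hτ
      exact hMb τ ⟨hτ.1.le, hτ.2.trans (ht.2.trans hδS)⟩
    · rw [sub_zero, abs_of_nonneg ht.1]
      exact mul_le_mul_of_nonneg_left ht.2 hM.le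
  · have h1 : Real.exp (2 * L * δ) ≤ Real.exp (2 * L * S) :=
      Real.exp_le_exp.2 (mul_le_mul_of_nonneg_left hδS (by positivity))
    have h2 : δ * (2 * M * Real.exp (2 * L * S)) ≤ 1 := by
      rw [← le_div_iff₀ (by positivity)]
      exact min_le_right _ _
    calc 2 * (M * δ) * Real.exp (2 * L * δ) ≤ 2 * (M * δ) * Real.exp (2 * L * S) :=
          mul_le_mul_of_nonneg_left h1 (by positivity)
      _ ≤ 1 := by linarith

lemma SolvesVolterra.mono {E : Type*} [NormedAddCommGroup E] [NormedSpace ℝ E] {H : ℝ → E → E}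
    {S S' : ℝ} {c y : ℝ → E} (h : SolvesVolterra H S c y) (hS : S' ≤ S) :
    SolvesVolterra H S' c y := fun t ht => h t ⟨ht.1, ht.2.trans hS⟩

variable {ν : ℕ} {m : Fin (ν + 1) → ℕ} {F : Components m}
  {D : ℝ → State m × Control m → (State m × Control m →L[ℝ] State m)}

lemma splitCLM_single_castSucc (i : Fin ν) (v : Vec (m i.castSucc)) :
    splitCLM m (Pi.single i.castSucc v) = (Pi.single i v, 0) := by
  refine Prod.ext (funext fun j => ?_) ?_
  · by_cases hj : j = i
    · subst hj; simp [splitCLM_apply]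
    · simp [splitCLM_apply, hj]
  · simp [splitCLM_apply]

lemma splitCLM_single_last (v : Control m) :
    splitCLM m (Pi.single (Fin.last ν) v) = (0, v) := by
  refine Prod.ext (funext fun j => ?_) ?_
  · simp [splitCLM_apply]
  · simp [splitCLM_apply]

/-- A triangular system is observable in the dual sense along a curve on which its
derivatives have full rank. -/
theorem HasContDeriv.observable (h : HasContDeriv F D) {δ : ℝ} (hδ : 0 < δ) {ζ : ℝ → Ext m}
    (hζ : Continuous ζ)
    (hsurj : ∀ i : Fin ν, ∀ t ∈ Icc 0 δ, Function.Surjective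
      (fderiv ℝ (F i t fun j => ζ t j.1.castSucc) (ζ t i.succ)))
    {η : ℝ → State m →L[ℝ] ℝ} (hη : Continuous η)
    (hA : ∀ t ∈ Icc 0 δ, η t = η δ + ∫ τ in t..δ, (η τ).comp
      ((D τ (splitCLM m (ζ τ))).comp (ContinuousLinearMap.inl ℝ (State m) (Control m))))
    (hB : ∀ t ∈ Icc 0 δ, (η t).comp
      ((D t (splitCLM m (ζ t))).comp (ContinuousLinearMap.inr ℝ (State m) (Control m))) = 0) :
    η δ = 0 := by
  have hD : Continuous fun t => D t (splitCLM m (ζ t)) :=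
    h.continuous_deriv.comp (by fun_prop : Continuous fun t : ℝ => (t, splitCLM m (ζ t)))
  -- Downward induction. Suppose `η` annihilates the derivative of the field in block `k + 1` and
  -- all components after `k`. Components before `k` of this derivative vanish by triangularity and
  -- its component `k` is onto, so `η` annihilates block `k`. The adjoint equation for this
  -- vanishing block then says that `η` annihilates the derivative in block `k`.
  have key : ∀ k : Fin (ν + 1),
      (∀ i : Fin ν, k ≤ i.castSucc → ∀ t ∈ Icc 0 δ, ∀ v, η t (Pi.single i v) = 0) ∧
      ∀ t ∈ Icc 0 δ, ∀ v, η t (D t (splitCLM m (ζ t)) (splitCLM m (Pi.single k v))) = 0 := by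
    intro k
    induction k using Fin.reverseInduction with
    | last =>
      refine ⟨fun i hi => absurd hi (not_le.2 (Fin.castSucc_lt_last i)), fun t ht v => ?_⟩
      rw [splitCLM_single_last]
      exact congrArg (fun A => A v) (hB t ht)
    | cast k ih =>
      have hk : ∀ i : Fin ν, k.castSucc ≤ i.castSucc → ∀ t ∈ Icc 0 δ, ∀ v,
          η t (Pi.single i v) = 0 := by
        intro i hi t ht v
        rw [Fin.castSucc_le_castSucc_iff] at hi
        rcases hi.eq_or_lt with rfl | hi
        · obtain ⟨w, rfl⟩ := hsurj k t ht v
          have h1 := ih.2 t ht w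
          rw [← Finset.univ_sum_single (D t _ _), map_sum, Finset.sum_eq_single k] at h1
          · rwa [h.deriv_single_succ] at h1
          · intro j _ hj
            rcases lt_or_gt_of_ne hj with hj | hj
            · rw [h.deriv_single_eq_zero _ _ (Fin.succ_lt_succ_iff.2 hj)]
              simp
            · exact ih.1 j (Fin.succ_le_castSucc_iff.2 hj) t ht _
          · simp
        · exact ih.1 i (Fin.succ_le_castSucc_iff.2 hi) t ht v
      refine ⟨hk, fun t ht v => ?_⟩
      have hc : Continuous fun τ => (η τ).comp
          ((D τ (splitCLM m (ζ τ))).comp (ContinuousLinearMap.inl ℝ (State m) (Control m))) :=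
        hη.clm_comp (hD.clm_comp continuous_const)
      have h1 := eqOn_zero_of_integral_eq_zero (hc.clm_apply continuous_const) hδ
        (h := fun τ => ((η τ).comp ((D τ (splitCLM m (ζ τ))).comp
          (ContinuousLinearMap.inl ℝ (State m) (Control m)))) (Pi.single k v)) (fun t ht => by
          have h2 := congrArg (fun A => A (Pi.single k v)) (hA t ht)
          simp only [add_apply] at h2
          rw [hk k le_rfl t ht, hk k le_rfl δ (right_mem_Icc.2 hδ.le), zero_add,
            ContinuousLinearMap.intervalIntegral_apply (hc.intervalIntegrable _ _)] at h2
          exact h2.symm) t ht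
      rw [splitCLM_single_castSucc]
      exact h1
  refine ContinuousLinearMap.ext fun x => ?_
  rw [← Finset.univ_sum_single x, map_sum]
  exact Finset.sum_eq_zero fun i _ => (key 0).1 i (Fin.zero_le _) δ (right_mem_Icc.2 hδ.le) _

lemma HasContDeriv.lipschitzOnBalls_field (h : HasContDeriv F D) {u : ℝ → Control m}
    (hu : Continuous u) (S : ℝ) : LipschitzOnBalls (fun t x => field F t x (u t)) S := by
  have hD : Continuous (Function.uncurry fun t x => (D t (x, u t)).comp
      (ContinuousLinearMap.inl ℝ (State m) (Control m))) :=
    Continuous.clm_comp (h.continuous_deriv.comp (by fun_prop :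
      Continuous fun p : ℝ × State m => (p.1, (p.2, u p.1)))) continuous_const
  have hd : ∀ t x, HasFDerivAt (fun x => field F t x (u t)) ((D t (x, u t)).comp
      (ContinuousLinearMap.inl ℝ (State m) (Control m))) x := fun t x =>
    HasFDerivAt.comp (g := fun w : State m × Control m => field F t w.1 w.2)
      (f := fun e : State m => (e, u t)) x
      (h.hasFDerivAt t (x, u t)) (hasFDerivAt_prodMk_left (𝕜 := ℝ) x (u t))
  exact lipschitzOnBalls_of_hasFDerivAt hD hd S

/-- Exact steering on a short time interval to the points near the end of a reference
trajectory. -/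
theorem HasContDeriv.exists_local_steering (h : HasContDeriv F D) {xs : State m} {us : Control m}
    (hrank : ∀ i : Fin ν, Function.Surjective
      (fderiv ℝ (F i 0 (head xs i)) (next xs us i))) {S : ℝ} (hS : 0 < S) :
    ∃ δ, 0 < δ ∧ δ < S ∧ ∃ (x₁ : State m) (r : ℝ), 0 < r ∧ ∃ u : State m → ℝ → Control m,
      ContinuousOn (Function.uncurry u) (Metric.ball x₁ r ×ˢ univ) ∧
      ∀ z ∈ Metric.ball x₁ r, u z 0 = us ∧ u z δ = us ∧ ∃ x : ℝ → State m, Continuous x ∧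
        SolvesVolterra (fun t x => field F t x (u z t)) δ (fun _ => xs) x ∧ x δ = z := by
  have hH : Continuous (Function.uncurry fun t x => field F t x us) :=
    h.continuous_field.comp (by fun_prop : Continuous fun p : ℝ × State m => (p.1, (p.2, us)))
  have hHlip := h.lipschitzOnBalls_field (continuous_const (y := us)) S
  obtain ⟨δ₀, hδ₀, hδ₀S, ξ, hξ, hξs⟩ := exists_short_solvesVolterra hH hS hHlip xs
  have hξ0 : ξ 0 = xs := by simpa using hξs 0 (left_mem_Icc.2 hδ₀.le)
  let ζ : ℝ → Ext m := fun t => join (ξ t) us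
  have hζ : Continuous ζ := continuous_join.comp (hξ.prodMk continuous_const)
  -- Full rank is an open condition, so it persists for a short time along the reference trajectory.
  have hsurj : ∀ᶠ t in 𝓝 (0 : ℝ), ∀ i : Fin ν, Function.Surjective
      (fderiv ℝ (F i t fun j => ζ t j.1.castSucc) (ζ t i.succ)) := by
    refine eventually_all.2 fun i => ?_
    have hL : ∀ t, fderiv ℝ (F i t fun j => ζ t j.1.castSucc) (ζ t i.succ) =
        (ContinuousLinearMap.proj i).comp (((D t (splitCLM m (ζ t))).comp (splitCLM m)).comp
        (ContinuousLinearMap.single ℝ (fun j => Vec (m j)) i.succ)) := fun t =>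
      ContinuousLinearMap.ext fun v => (h.deriv_single_succ t (ζ t) i v).symm
    have hc : Continuous fun t => fderiv ℝ (F i t fun j => ζ t j.1.castSucc) (ζ t i.succ) := by
      simp only [hL]
      exact continuous_const.clm_comp (((h.continuous_deriv.comp (by fun_prop :
        Continuous fun t : ℝ => (t, splitCLM m (ζ t)))).clm_comp
        continuous_const).clm_comp continuous_const)
    refine eventually_surjective hc ?_
    have := hrank i
    simp only [ζ, join_castSucc, hξ0]
    exact this
  obtain ⟨ε, hε, hball⟩ := Metric.eventually_nhds_iff_ball.1 hsurj
  let δ := min (δ₀ / 2) (ε / 2)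
  have hδ : 0 < δ := lt_min (half_pos hδ₀) (half_pos hε)
  have hδδ₀ : δ < δ₀ := (min_le_left _ _).trans_lt (half_lt_self hδ₀)
  have hδε : δ < ε := (min_le_right _ _).trans_lt (half_lt_self hε)
  have hs : ∀ i : Fin ν, ∀ t ∈ Icc 0 δ, Function.Surjective
      (fderiv ℝ (F i t fun j => ζ t j.1.castSucc) (ζ t i.succ)) := fun i t ht =>
    hball t (by
      rw [Metric.mem_ball, Real.dist_eq, sub_zero, abs_of_nonneg ht.1]
      exact ht.2.trans_lt hδε) i
  obtain ⟨r, hr, u, hu, hsteer⟩ := TriangularControl.exists_local_steering h.continuous_field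
    h.continuous_deriv h.hasFDerivAt hδ hξ (hξs.mono hδδ₀.le) (fun η hη hA hB =>
      h.observable hδ hζ hs hη (by simpa only [ζ, splitCLM_join] using hA)
        (by simpa only [ζ, splitCLM_join] using hB))
  exact ⟨δ, hδ, hδδ₀.trans_le hδ₀S, ξ δ, r, hr, u, hu, hsteer⟩

end TriangularControl

/-! ### Exact global steering by concatenation. -/

namespace TriangularControl

variable {ν : ℕ} {m : Fin (ν + 1) → ℕ} {F : Components m}
  {D : ℝ → State m × Control m → (State m × Control m →L[ℝ] State m)}

lemma HasContDeriv.continuous_field_comp (h : HasContDeriv F D) {c : ℝ → ℝ} (hc : Continuous c)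
    {x : ℝ → State m} (hx : Continuous x) {u : ℝ → Control m} (hu : Continuous u) :
    Continuous fun t => field F (c t) (x t) (u t) :=
  h.continuous_field.comp (hc.prodMk (hx.prodMk hu))

/-- Exact steering from a fixed state to an arbitrary one, by controls that depend continuously on
the target and have a prescribed value at the initial time. -/
theorem HasContDeriv.exists_steering (h : HasContDeriv F D)
    (hsurj : ∀ i t y, Function.Surjective (F i t y)) {xs : State m} {us : Control m}
    (hrank : ∀ i : Fin ν, Function.Surjective
      (fderiv ℝ (F i 0 (head xs i)) (next xs us i))) {S : ℝ} (hS : 0 < S) :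
    ∃ (U : State m → ℝ → Control m) (X : State m → ℝ → State m),
      Continuous (Function.uncurry U) ∧ ∀ l, U l 0 = us ∧ Continuous (X l) ∧
        SolvesVolterra (fun t x => field F t x (U l t)) S (fun _ => xs) (X l) ∧ X l S = l := by
  obtain ⟨δ, hδ, hδS, x₁, r, hr, u, hu, hloc⟩ := h.exists_local_steering hrank hS
  -- The interval `[δ, S]` is run backward from the exact target; the inexact end then lies in the
  -- ball that the local piece reaches exactly. Both pieces have control `us` at the junction.
  have hG := h.reparam (-1) (c := fun s => S - s) (by fun_prop)
  obtain ⟨Z, hZ⟩ := exists_approximate_steering hG.continuous_extField (sub_pos.2 hδS)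
    (hG.lipschitzOnBalls_extField _) (surjective_reparam hsurj (by norm_num) _)
    (z₀ := fun l : State m => join l us) (continuous_join.comp
      (by fun_prop : Continuous fun l : State m => (l, us))) (join x₁ us)
    (half_pos hr)
  let y : State m → ℝ → State m := fun l s => (splitCLM m (Z l s)).1
  let v : State m → ℝ → Control m := fun l s => (splitCLM m (Z l s)).2
  have hZs : Continuous fun p : State m × ℝ => splitCLM m (Z p.1 p.2) :=
    (splitCLM m).continuous.comp hZ.continuous
  have hy : Continuous (Function.uncurry y) := continuous_fst.comp hZs
  have hv : Continuous (Function.uncurry v) := continuous_snd.comp hZs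
  have hyl : ∀ l, Continuous (y l) := fun l => hy.comp (by fun_prop : Continuous fun s : ℝ => (l, s))
  have hvl : ∀ l, Continuous (v l) := fun l => hv.comp (by fun_prop : Continuous fun s : ℝ => (l, s))
  have hy0 : ∀ l, y l 0 = l := fun l => by simp only [y, hZ.start, splitCLM_join]
  let w : State m → ℝ → State m := fun l τ => field F (S - τ) (y l τ) (v l τ)
  have hw : ∀ l, Continuous (w l) := fun l =>
    h.continuous_field_comp (by fun_prop) (hyl l) (hvl l)
  have hys : ∀ l, ∀ s ∈ Icc 0 (S - δ), y l s = l - ∫ τ in (0 : ℝ)..s, w l τ := fun l s hs => by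
    funext i
    have h1 := hZ.solves l i i.2 s hs
    rw [join_castSucc] at h1
    rw [Pi.sub_apply, integral_pi_apply (hw l)]
    refine h1.trans ?_
    rw [sub_eq_add_neg, ← intervalIntegral.integral_neg]
    congr 1
    refine intervalIntegral.integral_congr fun τ _ => ?_
    simp only [extField_eq_field, field_reparam, neg_smul, one_smul]
    rfl
  let e : State m → State m := fun l => y l (S - δ)
  have he : Continuous e := hy.comp (by fun_prop : Continuous fun l : State m => (l, S - δ))
  have heb : ∀ l, e l ∈ Metric.ball x₁ r := fun l => by
    rw [mem_ball_iff_norm]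
    refine lt_of_le_of_lt ?_ (half_lt_self hr)
    refine le_trans ?_ (hZ.near l)
    refine (pi_norm_le_iff_of_nonneg (norm_nonneg _)).2 fun i => ?_
    have := norm_le_pi_norm (Z l (S - δ) - join x₁ us) i.castSucc
    rwa [Pi.sub_apply, join_castSucc] at this
  have hve : ∀ l, v l (S - δ) = us := fun l => by
    have := hZ.terminal l (Fin.last ν) le_rfl
    rwa [join_last] at this
  choose hu0 huδ x hx hxs hxe using fun l => hloc (e l) (heb l)
  let U : State m → ℝ → Control m := fun l t => if t ≤ δ then u (e l) t else v l (S - t)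
  let X : State m → ℝ → State m := fun l t => if t ≤ δ then x l t else y l (S - t)
  have hU : Continuous (Function.uncurry U) := by
    refine Continuous.if_le (f := fun p : State m × ℝ => p.2) (g := fun _ => δ)
      (f' := fun p => u (e p.1) p.2) (g' := fun p => v p.1 (S - p.2)) ?_ ?_ continuous_snd
      continuous_const fun p hp => ?_
    · exact hu.comp_continuous
        (by fun_prop : Continuous fun p : State m × ℝ => (e p.1, p.2)) fun p => ⟨heb p.1, mem_univ _⟩
    · exact hv.comp (by fun_prop : Continuous fun p : State m × ℝ => (p.1, S - p.2))
    · change p.2 = δ at hp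
      simp only [hp, huδ, hve]
  have hX : ∀ l, Continuous (X l) := fun l =>
    Continuous.if_le (hx l) ((hyl l).comp (by fun_prop : Continuous fun t => S - t)) continuous_id
      continuous_const fun t ht => by
        change t = δ at ht
        simp only [ht, hxe]
        rfl
  have hUl : ∀ l, Continuous (U l) := fun l => hU.comp (by fun_prop : Continuous fun s : ℝ => (l, s))
  have hg : ∀ l, Continuous fun τ => field F τ (X l τ) (U l τ) := fun l =>
    h.continuous_field_comp continuous_id (hX l) (hUl l)
  have hfirst : ∀ l, ∀ t ∈ Icc 0 δ,
      x l t = xs + ∫ τ in (0 : ℝ)..t, field F τ (X l τ) (U l τ) := fun l t ht => by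
    rw [hxs l t ht]
    congr 1
    refine intervalIntegral.integral_congr fun τ hτ => ?_
    rw [uIcc_of_le ht.1] at hτ
    simp only [X, U, if_pos (hτ.2.trans ht.2)]
  refine ⟨U, X, hU, fun l => ⟨?_, hX l, fun t ht => ?_, ?_⟩⟩
  · simp only [U, if_pos hδ.le, hu0]
  · rcases le_or_gt t δ with htδ | htδ
    · simp only [X, if_pos htδ]
      exact hfirst l t ⟨ht.1, htδ⟩
    · have h1 : ∫ τ in δ..t, field F τ (X l τ) (U l τ) = ∫ τ in δ..t, w l (S - τ) := by
        refine intervalIntegral.integral_congr_ae (Eventually.of_forall fun τ hτ => ?_)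
        rw [uIoc_of_le htδ.le] at hτ
        simp only [X, U, if_neg (not_le.2 hτ.1), w, sub_sub_cancel]
      have h2 := hfirst l δ (right_mem_Icc.2 hδ.le)
      rw [hxe] at h2
      have h3 := intervalIntegral.integral_interval_sub_left (μ := volume)
        ((hw l).intervalIntegrable 0 (S - δ)) ((hw l).intervalIntegrable 0 (S - t))
      have h4 : e l = _ := hys l (S - δ) ⟨sub_nonneg.2 hδS.le, le_rfl⟩
      have h5 := hys l (S - t) ⟨sub_nonneg.2 ht.2, by linarith⟩
      have h6 := intervalIntegral.integral_add_adjacent_intervals (μ := volume)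
        ((hg l).intervalIntegrable 0 δ) ((hg l).intervalIntegrable δ t)
      rw [h1, intervalIntegral.integral_comp_sub_left, ← h3] at h6
      simp only [X, if_neg (not_le.2 htδ)]
      change y l (S - t) = xs + ∫ τ in (0 : ℝ)..t, field F τ (X l τ) (U l τ)
      rw [← h6, ← add_assoc, ← h2, h4, h5]
      abel
  · simp only [X, if_neg (not_le.2 hδS), sub_self, hy0]

end TriangularControl

/-! ### Return to the original time intervals. -/

namespace TriangularControl

variable {ν : ℕ} {m : Fin (ν + 1) → ℕ} {F : Components m}

/-- Partial derivatives on a time interval give a total derivative after the time is clamped to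
this interval. -/
lemma ConditionI.hasContDeriv {t₀ T : ℝ} (hI : ConditionI t₀ T (field F)) {c : ℝ → ℝ}
    (hc : Continuous c) (hcI : ∀ t, c t ∈ Icc t₀ T) (σ : ℝ) :
    ∃ D, HasContDeriv (reparam F σ c) D := by
  have hq : Continuous fun p : ℝ × (State m × Control m) => (c p.1, p.2) := by fun_prop
  have hmem : ∀ p : ℝ × (State m × Control m), (c p.1, p.2) ∈ Icc t₀ T ×ˢ univ := fun p =>
    ⟨hcI p.1, mem_univ _⟩
  have h1 := hI.continuousOn_deriv_state.comp_continuous hq hmem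
  have h2 := hI.continuousOn_deriv_control.comp_continuous hq hmem
  let D : ℝ → State m × Control m → (State m × Control m →L[ℝ] State m) := fun t w =>
    (fderiv ℝ (fun x => field F (c t) x w.2) w.1).coprod
      (fderiv ℝ (fun u => field F (c t) w.1 u) w.2)
  have hD : Continuous (Function.uncurry D) := by
    simp only [Function.uncurry_def, D, ← ContinuousLinearMap.comp_fst_add_comp_snd]
    exact (h1.clm_comp continuous_const).add (h2.clm_comp continuous_const)
  have hF : HasContDeriv (reparam F 1 c) D :=
    { continuous_field := by
        simp only [field_reparam, one_smul]
        exact hI.continuousOn.comp_continuous hq hmem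
      continuous_deriv := hD
      hasFDerivAt := fun t w => by
        simp only [field_reparam, one_smul]
        have hqt : Continuous fun w : State m × Control m => (t, w) := by fun_prop
        exact (hasStrictFDerivAt_uncurry_coprod (𝕜 := ℝ) (u := w) (f := field F (c t))
          (f₁ := fun x u => fderiv ℝ (fun x => field F (c t) x u) x)
          (f₂ := fun x u => fderiv ℝ (fun u => field F (c t) x u) u)
          (Eventually.of_forall fun v =>
            (hI.differentiable_state _ (hcI t) v.2 v.1).hasFDerivAt)
          (Eventually.of_forall fun v =>
            (hI.differentiable_control _ (hcI t) v.1 v.2).hasFDerivAt)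
          (h1.comp hqt).continuousAt (h2.comp hqt).continuousAt).hasFDerivAt }
  have hF' := hF.reparam σ (c := id) continuous_id
  have heq : reparam (reparam F 1 c) σ id = reparam F σ c := by
    funext i t y v
    simp [reparam]
  exact ⟨_, heq ▸ hF'⟩

lemma HasFullRanks.surjective {t₁ : ℝ} {xs : State m} {us : Control m}
    (h : HasFullRanks F t₁ xs us) (i : Fin ν) :
    Function.Surjective (fderiv ℝ (F i t₁ (head xs i)) (next xs us i)) :=
  LinearMap.range_eq_top.1 (Submodule.eq_top_of_finrank_eq (by simp [h i]))

/-- Competing solutions have one-sided derivatives at the ends and are arbitrary outside the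
interval. Compactness puts both in one ball, where the standard uniqueness theorem applies. -/
lemma LipschitzOnBalls.eqOn_of_hasDerivWithinAt {E : Type*} [NormedAddCommGroup E]
    [NormedSpace ℝ E] {H : ℝ → E → E} {S : ℝ} (hH : LipschitzOnBalls H S) {x y : ℝ → E}
    (hx : ∀ t ∈ Icc 0 S, HasDerivWithinAt x (H t (x t)) (Icc 0 S) t)
    (hy : ∀ t ∈ Icc 0 S, HasDerivWithinAt y (H t (y t)) (Icc 0 S) t) (h0 : x 0 = y 0) :
    EqOn x y (Icc 0 S) := by
  have hxc : ContinuousOn x (Icc 0 S) := fun t ht => (hx t ht).continuousWithinAt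
  have hyc : ContinuousOn y (Icc 0 S) := fun t ht => (hy t ht).continuousWithinAt
  obtain ⟨R₁, hR₁⟩ := isCompact_Icc.exists_bound_of_continuousOn hxc
  obtain ⟨R₂, hR₂⟩ := isCompact_Icc.exists_bound_of_continuousOn hyc
  obtain ⟨L, hL⟩ := hH (max R₁ R₂)
  have hnhds : ∀ t ∈ Ico 0 S, Icc 0 S ∈ 𝓝[≥] t := fun t ht => Icc_mem_nhdsGE_of_mem ht
  refine ODE_solution_unique_of_mem_Icc_right (v := H) (K := L.toNNReal)
    (s := fun _ => {z | ‖z‖ ≤ max R₁ R₂}) (fun t ht => ?_) hxc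
    (fun t ht => (hx t (Ico_subset_Icc_self ht)).mono_of_mem_nhdsWithin (hnhds t ht))
    (fun t ht => (hR₁ t (Ico_subset_Icc_self ht)).trans (le_max_left _ _)) hyc
    (fun t ht => (hy t (Ico_subset_Icc_self ht)).mono_of_mem_nhdsWithin (hnhds t ht))
    (fun t ht => (hR₂ t (Ico_subset_Icc_self ht)).trans (le_max_right _ _)) h0
  refine LipschitzOnWith.of_dist_le_mul fun z hz z' hz' => ?_
  rw [dist_eq_norm, dist_eq_norm]
  exact (hL t (Ico_subset_Icc_self ht) z z' hz hz').trans
    (mul_le_mul_of_nonneg_right (Real.le_coe_toNNReal L) (norm_nonneg _))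

lemma SolvesVolterra.hasDerivWithinAt {E : Type*} [NormedAddCommGroup E] [NormedSpace ℝ E]
    [CompleteSpace E] {H : ℝ → E → E} {S : ℝ} {a : E} {x : ℝ → E}
    (hx : SolvesVolterra H S (fun _ => a) x) (hc : Continuous fun t => H t (x t)) {t : ℝ}
    (ht : t ∈ Icc 0 S) : HasDerivWithinAt x (H t (x t)) (Icc 0 S) t := by
  have h1 : HasDerivAt (fun t => a + ∫ τ in (0 : ℝ)..t, H τ (x τ)) (H t (x t)) t :=
    (intervalIntegral.integral_hasDerivAt_right (hc.intervalIntegrable _ _)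
      hc.stronglyMeasurable.stronglyMeasurableAtFilter hc.continuousAt).const_add a
  exact h1.hasDerivWithinAt.congr hx (hx t ht)

/-- Exact steering forward (`σ = 1`) or backward (`σ = -1`) in time. -/
theorem exists_steering_family {t₀ T t₁ : ℝ} (hI : ConditionI t₀ T (field F))
    (hsurj : ∀ i : Fin ν, ∀ t ∈ Icc t₀ T, ∀ y, Function.Surjective (F i t y))
    {xs : State m} {us : Control m} (hrank : HasFullRanks F t₁ xs us) {σ S : ℝ}
    (hσ : σ * σ = 1) (hS : 0 < S) {J : Set ℝ} (hJ : ∀ s, s ∈ J ↔ σ * (s - t₁) ∈ Icc 0 S)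
    (hJT : J ⊆ Icc t₀ T) :
    ∃ U : State m → ℝ → Control m, Continuous (Function.uncurry U) ∧ ∀ l, U l t₁ = us ∧
      TrajectoryReaches (field F) J (fun t => U l t) t₁ xs (t₁ + σ * S) l := by
  have hσ0 : σ ≠ 0 := fun h => by simp [h] at hσ
  -- `c` maps `[0, S]` onto `J`, moving away from `t₁`, and is constant beyond each end, so the
  -- reparametrized field is regular at all times.
  let c : ℝ → ℝ := fun t => t₁ + σ * projIcc 0 S hS.le t
  have hc : Continuous c := continuous_const.add
    (continuous_const.mul (continuous_subtype_val.comp continuous_projIcc))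
  have hback : ∀ t, σ * (t₁ + σ * t - t₁) = t := fun t => by
    rw [add_sub_cancel_left, ← mul_assoc, hσ, one_mul]
  have hforth : ∀ s, t₁ + σ * (σ * (s - t₁)) = s := fun s => by
    rw [← mul_assoc, hσ, one_mul, add_sub_cancel]
  have hmem : ∀ t ∈ Icc 0 S, t₁ + σ * t ∈ J := fun t ht => by rwa [hJ, hback]
  have hcJ : ∀ t, c t ∈ J := fun t => hmem _ (projIcc 0 S hS.le t).2
  have hct : ∀ t ∈ Icc 0 S, c t = t₁ + σ * t := fun t ht => by simp [c, projIcc_of_mem hS.le ht]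
  have hc0 : c 0 = t₁ := by rw [hct 0 (left_mem_Icc.2 hS.le), mul_zero, add_zero]
  obtain ⟨D, hD⟩ := hI.hasContDeriv hc (fun t => hJT (hcJ t)) σ
  obtain ⟨U, X, hU, hUX⟩ := hD.exists_steering (xs := xs) (us := us) (fun i t y v => by
      obtain ⟨w, hw⟩ := hsurj i (c t) (hJT (hcJ t)) y (σ⁻¹ • v)
      exact ⟨w, by simp [reparam, hw, hσ0]⟩) (fun i v => by
      obtain ⟨w, hw⟩ := hrank.surjective i (σ⁻¹ • v)
      refine ⟨w, ?_⟩
      have h1 : reparam F σ c i 0 (head xs i) = σ • F i t₁ (head xs i) := by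
        funext v
        simp [reparam, hc0]
      rw [h1, fderiv_const_smul_field, Pi.smul_apply, smul_apply, hw, smul_smul,
        mul_inv_cancel₀ hσ0, one_smul]) hS
  have hderiv : ∀ s : ℝ, HasDerivWithinAt (fun s => σ * (s - t₁)) σ J s := fun s => by
    simpa using (((hasDerivAt_id s).sub_const t₁).const_mul σ).hasDerivWithinAt
  have hderiv' : ∀ t : ℝ, HasDerivWithinAt (fun t => t₁ + σ * t) σ (Icc 0 S) t := fun t => by
    simpa using (((hasDerivAt_id t).const_mul σ).const_add t₁).hasDerivWithinAt
  refine ⟨fun l s => U l (σ * (s - t₁)), hU.comp (by fun_prop :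
    Continuous fun p : State m × ℝ => (p.1, σ * (p.2 - t₁))), fun l => ⟨by simp [hUX l], ?_⟩⟩
  obtain ⟨hU0, hX, hXs, hXS⟩ := hUX l
  have hUl : Continuous (U l) := hU.comp (by fun_prop : Continuous fun s : ℝ => (l, s))
  have hX' := fun t ht => hXs.hasDerivWithinAt
    (hD.continuous_field_comp continuous_id hX hUl) (t := t) ht
  have hX0 : X l 0 = xs := by simpa using hXs 0 (left_mem_Icc.2 hS.le)
  refine ⟨fun s => X l (σ * (s - t₁)), ⟨by simp [hX0], fun s => ?_⟩, fun y hy => ?_, ?_⟩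
  · have hs := (hJ s).1 s.2
    have h1 := HasDerivWithinAt.scomp (s : ℝ) (hX' _ hs) (hderiv s) fun s hs => (hJ s).1 hs
    rw [field_reparam, smul_smul, hσ, one_smul, hct _ hs, hforth] at h1
    exact h1
  · have hY : ∀ t ∈ Icc 0 S, HasDerivWithinAt (fun t => y (t₁ + σ * t))
        (field (reparam F σ c) t (y (t₁ + σ * t)) (U l t)) (Icc 0 S) t := fun t ht => by
      have h1 := HasDerivWithinAt.scomp t (hy.hasDerivWithinAt ⟨_, hmem t ht⟩) (hderiv' t) hmem
      simp only [hback] at h1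
      rw [field_reparam, hct t ht]
      exact h1
    have h2 := (hD.lipschitzOnBalls_field hUl S).eqOn_of_hasDerivWithinAt hY hX'
      (by simp [hX0, hy.initial])
    intro s hs
    have h3 := h2 ((hJ s).1 hs)
    simpa only [hforth] using h3
  · simp only [hback, hXS]

end TriangularControl

theorem theorem2p1 {ν : ℕ} (m : Fin (ν + 1) → ℕ) (hm : ∀ i : Fin ν, m i.castSucc ≤ m i.succ)
    (t₀ T t₁ : ℝ) (ht₁ : t₁ ∈ Set.Ioo t₀ T)
    (F : TriangularControl.Components m)
    (hI : TriangularControl.ConditionI t₀ T (TriangularControl.field F))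
    (hII : TriangularControl.ConditionII t₀ T F)
    (xs : TriangularControl.State m) (us : TriangularControl.Control m)
    (hrank : TriangularControl.HasFullRanks F t₁ xs us) :
    ∃ (ubar : C(TriangularControl.State m, C(Set.Icc t₁ T, TriangularControl.Control m)))
      (utilde : C(TriangularControl.State m, C(Set.Icc t₀ t₁, TriangularControl.Control m))),
      (∀ x0 xT : TriangularControl.State m,
        utilde x0 ⟨t₁, Set.right_mem_Icc.mpr ht₁.1.le⟩ = us ∧
        ubar xT ⟨t₁, Set.left_mem_Icc.mpr ht₁.2.le⟩ = us) ∧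
      (∀ xT : TriangularControl.State m,
        TriangularControl.TrajectoryReaches (TriangularControl.field F)
          (Set.Icc t₁ T) (ubar xT) t₁ xs T xT) ∧
      (∀ x0 : TriangularControl.State m,
        TriangularControl.TrajectoryReaches (TriangularControl.field F)
          (Set.Icc t₀ t₁) (utilde x0) t₁ xs t₀ x0) := by
  obtain ⟨U, hU, hUs⟩ := TriangularControl.exists_steering_family hI hII.surjective hrank
    (σ := 1) (S := T - t₁) (J := Set.Icc t₁ T) (by norm_num) (sub_pos.2 ht₁.2)
    (fun s => by simp) (Set.Icc_subset_Icc_left ht₁.1.le)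
  obtain ⟨V, hV, hVs⟩ := TriangularControl.exists_steering_family hI hII.surjective hrank
    (σ := -1) (S := t₁ - t₀) (J := Set.Icc t₀ t₁) (by norm_num) (sub_pos.2 ht₁.1)
    (fun s => by
      simp only [Set.mem_Icc]
      constructor <;> rintro ⟨h₁, h₂⟩ <;> constructor <;> linarith) (Set.Icc_subset_Icc_right ht₁.2.le)
  -- Currying turns joint continuity in target and time into continuity for the compact-open
  -- topology on controls, which over a compact interval is uniform convergence.
  refine ⟨ContinuousMap.curry ⟨fun p => U p.1 p.2, hU.comp (by fun_prop :
      Continuous fun p : TriangularControl.State m × Set.Icc t₁ T => (p.1, (p.2 : ℝ)))⟩,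
    ContinuousMap.curry ⟨fun p => V p.1 p.2, hV.comp (by fun_prop :
      Continuous fun p : TriangularControl.State m × Set.Icc t₀ t₁ => (p.1, (p.2 : ℝ)))⟩,
    fun x0 xT => ⟨(hVs x0).1, (hUs xT).1⟩, fun xT => ?_, fun x0 => ?_⟩
  · have h := (hUs xT).2
    rw [show t₁ + 1 * (T - t₁) = T by ring] at h
    exact h
  · have h := (hVs x0).2
    rw [show t₁ + -1 * (t₁ - t₀) = t₀ by ring] at h
    exact h
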